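/- **Stability of the semi-discrete formulation.** *Setting.* Let $d\in\{2,3\}$, let $\Omega_e,\Omega_p\subset\mathbb R^d$ be disjoint open (elastic and poroelastic) regions, and let $\mathcal T_h=\mathcal T_h^e\cup\mathcal T_h^p$ be a polytopic mesh aligned with them: finitely many disjoint, connected, bounded open elements $\kappa$ with diameters $h_\kappa$, the closures of those in $\mathcal T_h^\#$ covering $\overline\Omega_\#$, whose boundaries are unions of non-overlapping faces, which are segments ($d=2$) or triangles ($d=3$). The faces split into the interface faces $\mathcal F_h^I$ (shared by an element of $\mathcal T_h^e$ and one of $\mathcal T_h^p$) and the remaining faces $\mathcal F_h^e,\mathcal F_h^p$ (interior and boundary) of the elements of $\mathcal T_h^e,\mathcal T_h^p$. Let $p_\kappa\ge1$, let $V_h^\#$ be the $\mathbb R^d$-valued functions that are polynomials of total degree $\le p_\kappa$ on each $\kappa\in\mathcal T_h^\#$, and $V_h=V_h^e\times V_h^p\times V_h^p$. On a face, $[\![v]\!]=\sum v_\kappa\otimes n_\kappa$, $[\![v]\!]_n=\sum v_\kappa\cdot n_\kappa$ and $\{\!\{\cdot\}\!\}$ (arithmetic mean) are taken over the one or two elements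 having it as a face, $n_\kappa$ being the outward unit normal; $n_p$ is the normal on $\mathcal F_h^I$ pointing out of $\Omega_p$. $(\cdot,\cdot)_{\Omega_\#}$ and $\langle\cdot,\cdot\rangle_{\mathcal F}$ are sums of integrals over elements and faces, $\nabla_h$ and $\epsilon_h$ are the broken gradient and strain. *Coefficients.* All are measurable. For some $K\ge1$: $\rho_e,\rho_f,\rho_s,\zeta,\eta,k,\mu,m\in[1/K,K]$, $0\le\lambda\le K$, $1<a\le K$, $1/K\le\phi\le1-1/K$, $\phi<\beta\le1$; $\delta\in[0,1]$ is constant and $\lambda,\mu,m,\beta$ are constant on each element. Put $\rho_p=\phi\rho_f+(1-\phi)\rho_s$, $\rho_w=a\rho_f/\phi$, $\rho_u=(1-\phi)\rho_s/2$, $\mathbb C:\tau=2\mu\tau+\lambda\,\mathrm{tr}(\tau)I$, $\sigma_{eh}(v)=\mathbb C:\epsilon_h(v)$ and $\overline{\mathbb C}_\kappa=|\mathbb C^{1/2}|_2^2=2\mu+d\lambda$ on $\kappa$. On each face, $$\alpha=c_1\max_\kappa\big(\overline{\mathbb C}_\kappa p_\kappa^2h_\kappa^{-1}\big),\qquad \gamma=c_2\max_\kappa\big(m_\kappa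 p_\kappa^2h_\kappa^{-1}\big),$$ with maxima over all elements, respectively all poroelastic elements, having it as a face. *Semi-discrete problem.* For loads $f_e\in L^2(0,T;L^2(\Omega_e)^d)$, $f_p,g_p\in L^2(0,T;L^2(\Omega_p)^d)$ let $U_h=(u_e,u_p,u_f)\in C^1([0,T];V_h)$, with $\dot U_h$ absolutely continuous, satisfy for almost every $t\in(0,T]$ $$\mathcal M(\ddot U_h,V)+\mathcal D(\dot U_h,V)+\mathcal A_h(U_h,V)+\mathcal C_h(U_h,V)=(f_e,v_e)_{\Omega_e}+(f_p,v_p)_{\Omega_p}+(g_p,v_f)_{\Omega_p}\quad\forall V=(v_e,v_p,v_f)\in V_h,$$ where $$\mathcal M(U,V)=(\rho_eu_e,v_e)_{\Omega_e}+(\rho_pu_p+\rho_fu_f,v_p)_{\Omega_p}+(\rho_fu_p+\rho_wu_f,v_f)_{\Omega_p},$$ $$\mathcal D(U,V)=(2\rho_e\zeta u_e,v_e)_{\Omega_e}+(2\rho_p\zeta u_p,v_p)_{\Omega_p}+(\eta k^{-1}u_f,v_f)_{\Omega_p},$$ $$\mathcal A_h(U,V)=\mathcal A_h^e(u_e,v_e)+\mathcal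 A_h^p(u_p,v_p)+\mathcal B_h^p(\beta u_p+u_f,\beta v_p+v_f),$$ $$\mathcal A_h^\star(u,v)=(\sigma_{eh}(u),\epsilon_h(v))_{\Omega_\star}+(\rho_\star\zeta^2u,v)_{\Omega_\star}-\langle\{\!\{\sigma_{eh}(u)\}\!\},[\![v]\!]\rangle_{\mathcal F_h^\star}-\langle[\![u]\!],\{\!\{\sigma_{eh}(v)\}\!\}\rangle_{\mathcal F_h^\star}+\langle\alpha[\![u]\!],[\![v]\!]\rangle_{\mathcal F_h^\star},$$ $$\mathcal B_h^p(u,v)=(m\nabla_h\!\cdot u,\nabla_h\!\cdot v)_{\Omega_p}-\langle\{\!\{m\nabla_h\!\cdot u\}\!\},[\![v]\!]_n\rangle_{\mathcal F_h^p}-\langle[\![u]\!]_n,\{\!\{m\nabla_h\!\cdot v\}\!\}\rangle_{\mathcal F_h^p}+\langle\gamma[\![u]\!]_n,[\![v]\!]_n\rangle_{\mathcal F_h^p},$$ and, with $w(U)=((1-\delta)\beta u_p+u_f)\cdot n_p$ and $q(U)=m\nabla_h\!\cdot(\beta u_p+u_f)$, $$\begin{aligned}\mathcal C_h(U,V)=&-\langle\sigma_{eh}(u_e)n_p,v_p-v_e\rangle_{\mathcal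 F_h^I}-\langle\sigma_{eh}(v_e)n_p,u_p-u_e\rangle_{\mathcal F_h^I}+\langle\alpha(u_p-u_e),v_p-v_e\rangle_{\mathcal F_h^I}\\&-\langle q(U),w(V)\rangle_{\mathcal F_h^I}-\langle q(V),w(U)\rangle_{\mathcal F_h^I}+\langle\gamma\,w(U),w(V)\rangle_{\mathcal F_h^I}.\end{aligned}$$ *Energy norm.* Let $$\|U(t)\|_E^2=\|\dot U(t)\|_0^2+|U(t)|_{dG}^2+|U(t)|_{\Gamma_I}^2+\int_0^t\mathcal D(\dot U,\dot U)(s)\,ds+\mathcal D(U,U)(0),$$ where $$\|U\|_0^2=\|\rho_e^{1/2}u_e\|_{\Omega_e}^2+\|\rho_u^{1/2}u_p\|_{\Omega_p}^2+\|(\rho_f\phi)^{1/2}(u_p+\phi^{-1}u_f)\|_{\Omega_p}^2,$$ $$|U|_{dG}^2=\sum_{\star\in\{e,p\}}\Big(\|\mathbb C^{1/2}:\epsilon_h(u_\star)\|_{\Omega_\star}^2+\|\alpha^{1/2}[\![u_\star]\!]\|_{\mathcal F_h^\star}^2\Big)+\|m^{1/2}\nabla_h\!\cdot(\beta u_p+u_f)\|_{\Omega_p}^2+\|\gamma^{1/2}[\![\beta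 u_p+u_f]\!]_n\|_{\mathcal F_h^p}^2,$$ $$|U|_{\Gamma_I}^2=\|\alpha^{1/2}(u_p-u_e)\|_{\mathcal F_h^I}^2+\|\gamma^{1/2}((1-\delta)\beta u_p+u_f)\cdot n_p\|_{\mathcal F_h^I}^2.$$ *Mesh assumptions.* (i) Polytopic regularity with constant $C_{reg}$: every $\kappa$ contains (in its closure) non-overlapping $d$-simplices $S_\kappa^F$, one for each face $F\subseteq\partial\kappa$ and having $F$ as a face, with $h_\kappa\le C_{reg}\,d\,|S_\kappa^F|\,|F|^{-1}$. (ii) $hp$-local bounded variation with constant $C_{bv}$: $h_\kappa\le C_{bv}h_{\kappa'}$ and $p_\kappa\le C_{bv}p_{\kappa'}$ for all $\kappa,\kappa'$ in the same $\mathcal T_h^\#$ having a common face. **Theorem.** For all $d,C_{reg},C_{bv}$ there are thresholds $c_1^0,c_2^0>0$ such that for all $c_1\ge c_1^0$, $c_2\ge c_2^0$, $T>0$ and $K$ there is a constant $C>0$, depending only on these data, such that for all regions, meshes and degrees satisfying (i) and (ii), all coefficients with bound $K$, all loads, and every solution $U_h$ of the semi-discrete problem, $$\sup_{0\le t\le T}\|U_h(t)\|_E^2\le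 C\Big(\|U_h(0)\|_E^2+\int_0^T\big(\|(2\rho_e\zeta)^{-1/2}f_e\|_{\Omega_e}^2+\|(2\rho_p\zeta)^{-1/2}f_p\|_{\Omega_p}^2+\|(k/\eta)^{1/2}g_p\|_{\Omega_p}^2\big)ds\Big).$$ -/

import Mathlib

open MeasureTheory Set

open scoped BigOperators

noncomputable section

namespace PoroDG

/-- Points and vectors of `ℝᵈ`, with the Euclidean norm. -/
abbrev Pt (d : ℕ) := EuclideanSpace ℝ (Fin d)

/-- `(d-1)`-dimensional surface measure on `ℝᵈ` (Hausdorff measure with the Euclidean normalization,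
so that it is length for `d = 2` and area for `d = 3`). -/
abbrev surface (d : ℕ) : Measure (Pt d) := μHE[d - 1]

/-- `ν` is the unit normal of the flat face `F` that points out of `K`. -/
def IsOutwardNormal {d : ℕ} (K F : Set (Pt d)) (ν : Pt d) : Prop :=
  ‖ν‖ = 1 ∧ (∀ x ∈ F, ∀ y ∈ F, inner ℝ ν (x - y) = 0) ∧
    ∀ x ∈ intrinsicInterior ℝ F, ∃ ε > 0, ∀ s : ℝ, 0 < s → s < ε → x - s • ν ∈ K ∧ x + s • ν ∉ K

/-! ### Polytopic meshes -/

/-- A polytopic mesh of `Ωe ∪ Ωp`, aligned with the two regions. The elements are open polygons or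
polyhedra. The faces are closed `(d-1)`-simplices given by their `d` vertices (segments for `d = 2`,
triangles for `d = 3`; general interfaces are decomposed into such simplices); hanging nodes are
allowed, and an element may have any number of faces. The outward unit normals are recorded
for convenience: they are determined by the geometry. -/
structure PolytopicMesh (d : ℕ) (Ωe Ωp : Set (Pt d)) where
  Cell : Type
  Face : Type
  fintypeCell : Fintype Cell
  fintypeFace : Fintype Face
  cell : Cell → Set (Pt d)
  vertex : Face → Fin d → Pt d
  normal : Cell → Face → Pt d
  cell_open : ∀ κ, IsOpen (cell κ)
  cell_connected : ∀ κ, IsConnected (cell κ)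
  cell_bounded : ∀ κ, Bornology.IsBounded (cell κ)
  cell_disjoint : ∀ κ κ', κ ≠ κ' → Disjoint (cell κ) (cell κ')
  cell_subset : ∀ κ, cell κ ⊆ Ωe ∨ cell κ ⊆ Ωp
  cover_e : closure Ωe = ⋃ κ ∈ {κ | cell κ ⊆ Ωe}, closure (cell κ)
  cover_p : closure Ωp = ⋃ κ ∈ {κ | cell κ ⊆ Ωp}, closure (cell κ)
  vertex_indep : ∀ F, AffineIndependent ℝ (vertex F)
  face_disjoint : ∀ F F', F ≠ F' →
    Disjoint (intrinsicInterior ℝ (convexHull ℝ (range (vertex F))))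
      (intrinsicInterior ℝ (convexHull ℝ (range (vertex F'))))
  /-- The boundary of an element is the union of the faces it contains. -/
  frontier_cell : ∀ κ, frontier (cell κ) =
    ⋃ F ∈ {F | convexHull ℝ (range (vertex F)) ⊆ frontier (cell κ)},
      convexHull ℝ (range (vertex F))
  /-- A face belongs to one element (boundary face) or to two (interior or interface face). -/
  face_cells : ∀ F, {κ | convexHull ℝ (range (vertex F)) ⊆ frontier (cell κ)}.ncard = 1 ∨
    {κ | convexHull ℝ (range (vertex F)) ⊆ frontier (cell κ)}.ncard = 2
  normal_outward : ∀ κ F, convexHull ℝ (range (vertex F)) ⊆ frontier (cell κ) →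
    IsOutwardNormal (cell κ) (convexHull ℝ (range (vertex F))) (normal κ F)

attribute [instance] PolytopicMesh.fintypeCell PolytopicMesh.fintypeFace

/-- Maximum of a function over a nonempty finite set (`0` on the empty set). -/
def maxOver {ι : Type} (s : Finset ι) (f : ι → ℝ) : ℝ :=
  open Classical in if h : s.Nonempty then s.sup' h f else 0

namespace PolytopicMesh

variable {d : ℕ} {Ωe Ωp : Set (Pt d)} (M : PolytopicMesh d Ωe Ωp)

/-- The closed simplex that is the face `F`. -/
def face (F : M.Face) : Set (Pt d) := convexHull ℝ (range (M.vertex F))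

/-- The elements having `F` as a face. -/
def adj (F : M.Face) : Finset M.Cell :=
  open Classical in Finset.univ.filter fun κ => M.face F ⊆ frontier (M.cell κ)

/-- The elastic elements. -/
def cellsE : Finset M.Cell := open Classical in Finset.univ.filter fun κ => M.cell κ ⊆ Ωe

/-- The poroelastic elements. -/
def cellsP : Finset M.Cell := open Classical in Finset.univ.filter fun κ => M.cell κ ⊆ Ωp

/-- The elastic element(s) at the face `F`: exactly one if `F` lies on the interface. -/
def adjE (F : M.Face) : Finset M.Cell := open Classical in M.adj F ∩ M.cellsE

/-- The poroelastic element(s) at the face `F`: exactly one if `F` lies on the interface. -/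
def adjP (F : M.Face) : Finset M.Cell := open Classical in M.adj F ∩ M.cellsP

/-- The faces on the interface `Γ_I`. -/
def facesI : Finset M.Face :=
  open Classical in Finset.univ.filter fun F => (M.adjE F).Nonempty ∧ (M.adjP F).Nonempty

/-- The faces (interior and boundary) of the elastic elements that do not lie on the interface. -/
def facesE : Finset M.Face :=
  open Classical in Finset.univ.filter fun F => (M.adjE F).Nonempty ∧ ¬ (M.adjP F).Nonempty

/-- The faces (interior and boundary) of the poroelastic elements not lying on the interface. -/
def facesP : Finset M.Face :=
  open Classical in Finset.univ.filter fun F => ¬ (M.adjE F).Nonempty ∧ (M.adjP F).Nonempty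

/-- The diameter `h_κ`. -/
def h (κ : M.Cell) : ℝ := Metric.diam (M.cell κ)

/-- The simplex with face `F` and apex `a`. -/
def cone (F : M.Face) (a : Pt d) : Set (Pt d) := convexHull ℝ (insert a (range (M.vertex F)))

/-- Polytopic regularity with constant `C`: every element `κ` contains non-overlapping
`d`-simplices `S_κ^F`, one for each face `F ⊆ ∂κ` and having `F` as a face, with
`h_κ ≤ C d |S_κ^F| / |F|`. -/
def PolytopicRegular (C : ℝ) : Prop :=
  ∀ κ : M.Cell, ∃ apex : M.Face → Pt d,
    (∀ F, κ ∈ M.adj F → M.cone F (apex F) ⊆ closure (M.cell κ) ∧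
      M.h κ ≤ C * (d * volume.real (M.cone F (apex F)) / (surface d).real (M.face F))) ∧
    ∀ F F', κ ∈ M.adj F → κ ∈ M.adj F' → F ≠ F' →
      Disjoint (interior (M.cone F (apex F))) (interior (M.cone F' (apex F')))

/-- `hp`-local bounded variation with constant `C`: element diameters and polynomial degrees are
comparable on neighbouring elements of the same region. (The condition is symmetric in the two
elements.) -/
def BoundedVariation (deg : M.Cell → ℕ) (C : ℝ) : Prop :=
  ∀ κ κ' : M.Cell, ((κ ∈ M.cellsE ∧ κ' ∈ M.cellsE) ∨ (κ ∈ M.cellsP ∧ κ' ∈ M.cellsP)) →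
    (∃ F, κ ∈ M.adj F ∧ κ' ∈ M.adj F) →
      M.h κ ≤ C * M.h κ' ∧ (deg κ : ℝ) ≤ C * deg κ'

end PolytopicMesh

/-! ### Tensors and differential operators -/

/-- The double contraction `σ : τ`. -/
def ddot {d : ℕ} (σ τ : Matrix (Fin d) (Fin d) ℝ) : ℝ := ∑ i, ∑ j, σ i j * τ i j

/-- The isotropic elasticity tensor `ℂ : τ = 2 μ τ + λ tr(τ) I`. -/
def elast {d : ℕ} (lam mu : ℝ) (τ : Matrix (Fin d) (Fin d) ℝ) : Matrix (Fin d) (Fin d) ℝ :=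
  (2 * mu) • τ + (lam * τ.trace) • (1 : Matrix (Fin d) (Fin d) ℝ)

/-- `|ℂ^{1/2}|₂²`, that is, the largest eigenvalue of `ℂ` on symmetric tensors; see
`isGreatest_elastNormSq`. -/
def elastNormSq (d : ℕ) (lam mu : ℝ) : ℝ := 2 * mu + d * lam

/-- For `λ ≥ 0` the number `2 μ + d λ` is the maximum of `|ℂ^{1/2} : τ|² = (ℂ : τ) : τ` over the
symmetric tensors `τ` with `|τ| = 1`. -/
theorem isGreatest_elastNormSq {d : ℕ} (hd : 0 < d) {lam mu : ℝ} (hl : 0 ≤ lam) :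
    IsGreatest {r : ℝ | ∃ τ : Matrix (Fin d) (Fin d) ℝ, τ.IsSymm ∧ ddot τ τ = 1 ∧
      r = ddot (elast lam mu τ) τ} (elastNormSq d lam mu) := by
  have key : ∀ τ : Matrix (Fin d) (Fin d) ℝ,
      ddot (elast lam mu τ) τ = 2 * mu * ddot τ τ + lam * τ.trace ^ 2 := by
    intro τ
    have h1 : ∀ i j : Fin d, elast lam mu τ i j * τ i j =
        2 * mu * (τ i j * τ i j) + lam * τ.trace * (if i = j then τ i j else 0) := by
      intro i j
      by_cases hij : i = j
      · subst hij
        simp [elast]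
        ring
      · simp [elast, hij]
        ring
    simp only [ddot, h1, Finset.sum_add_distrib, ← Finset.mul_sum, Finset.sum_ite_eq,
      Finset.mem_univ, if_true]
    simp only [Matrix.trace, Matrix.diag]
    ring
  have hd' : (0 : ℝ) < d := by exact_mod_cast hd
  constructor
  · refine ⟨(√(d : ℝ))⁻¹ • (1 : Matrix (Fin d) (Fin d) ℝ), ?_, ?_, ?_⟩
    · rw [Matrix.IsSymm, Matrix.transpose_smul, Matrix.transpose_one]
    · simp [ddot, Matrix.one_apply]
      rw [← mul_inv, Real.mul_self_sqrt hd'.le, mul_inv_cancel₀ hd'.ne']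
    · rw [key]
      have h2 : ddot ((√(d : ℝ))⁻¹ • (1 : Matrix (Fin d) (Fin d) ℝ))
          ((√(d : ℝ))⁻¹ • (1 : Matrix (Fin d) (Fin d) ℝ)) = 1 := by
        simp [ddot, Matrix.one_apply]
        rw [← mul_inv, Real.mul_self_sqrt hd'.le, mul_inv_cancel₀ hd'.ne']
      rw [h2, Matrix.trace_smul, Matrix.trace_one, elastNormSq]
      simp only [Fintype.card_fin, smul_eq_mul, mul_pow, inv_pow, Real.sq_sqrt hd'.le]
      field_simp
  · rintro r ⟨τ, -, hτ, rfl⟩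
    rw [key, hτ, elastNormSq]
    have h3 : τ.trace ^ 2 ≤ d * ∑ i, (τ i i) ^ 2 := by
      have := sq_sum_le_card_mul_sum_sq (s := (Finset.univ : Finset (Fin d))) (f := fun i => τ i i)
      simpa [Matrix.trace] using this
    have h4 : ∑ i, (τ i i) ^ 2 ≤ ddot τ τ := by
      refine Finset.sum_le_sum fun i _ => ?_
      have := Finset.single_le_sum (f := fun j => τ i j * τ i j)
        (fun j _ => mul_self_nonneg _) (Finset.mem_univ i)
      simpa [sq] using this
    rw [hτ] at h4
    nlinarith [mul_le_mul_of_nonneg_left h3 hl, mul_le_mul_of_nonneg_left h4 (mul_nonneg hl hd'.le)]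

/-- The partial derivative `∂ⱼ vᵢ`. -/
def partialD {d : ℕ} (v : Pt d → Pt d) (x : Pt d) (i j : Fin d) : ℝ :=
  (fderiv ℝ v x (EuclideanSpace.single j 1)) i

/-- The strain `ε(v) = (∇v + ∇vᵀ)/2`. -/
def strain {d : ℕ} (v : Pt d → Pt d) (x : Pt d) : Matrix (Fin d) (Fin d) ℝ :=
  Matrix.of fun i j => (partialD v x i j + partialD v x j i) / 2

/-- The divergence `∇·v`. -/
def divg {d : ℕ} (v : Pt d → Pt d) (x : Pt d) : ℝ := ∑ i, partialD v x i i

/-- The normal trace `σ n` of a tensor. -/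
def traction {d : ℕ} (σ : Matrix (Fin d) (Fin d) ℝ) (n : Pt d) : Pt d :=
  WithLp.toLp 2 (σ.mulVec n.ofLp)

/-- `v` is a vector field whose components are polynomials of total degree at most `n`. -/
def IsPolyField {d : ℕ} (n : ℕ) (v : Pt d → Pt d) : Prop :=
  ∀ i, ∃ P : MvPolynomial (Fin d) ℝ, P.totalDegree ≤ n ∧
    ∀ x, v x i = MvPolynomial.eval (fun j => x j) P

/-! ### Material data -/

/-- The coefficients: densities `ρ_e, ρ_f, ρ_s`, damping `ζ`, porosity `φ`, tortuosity `a`,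
viscosity `η`, permeability `k` as functions of the point; the Lamé parameters `λ, μ`, Biot's
modulus `m` and the Biot--Willis coefficient `β` element by element (they are element-wise constant);
and the fluid entry resistance `δ` of the interface. -/
structure Material {d : ℕ} {Ωe Ωp : Set (Pt d)} (M : PolytopicMesh d Ωe Ωp) where
  rhoE : Pt d → ℝ
  rhoF : Pt d → ℝ
  rhoS : Pt d → ℝ
  zeta : Pt d → ℝ
  phi : Pt d → ℝ
  a : Pt d → ℝ
  eta : Pt d → ℝ
  k : Pt d → ℝ
  lam : M.Cell → ℝ
  mu : M.Cell → ℝ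
  m : M.Cell → ℝ
  beta : M.Cell → ℝ
  delta : ℝ

namespace Material

variable {d : ℕ} {Ωe Ωp : Set (Pt d)} {M : PolytopicMesh d Ωe Ωp} (c : Material M)

/-- `ρ_p = φ ρ_f + (1-φ) ρ_s` -/
def rhoP (x : Pt d) : ℝ := c.phi x * c.rhoF x + (1 - c.phi x) * c.rhoS x

/-- `ρ_w = a ρ_f / φ` -/
def rhoW (x : Pt d) : ℝ := c.a x / c.phi x * c.rhoF x

/-- `ρ_u = (1-φ) ρ_s / 2` -/
def rhoU (x : Pt d) : ℝ := (1 - c.phi x) * c.rhoS x / 2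

/-- The physical assumptions on the coefficients, quantified by one number `K`: the positive
coefficients lie in `[1/K, K]`, `0 ≤ λ ≤ K`, `1 < a ≤ K`, `1/K ≤ φ ≤ 1 - 1/K`, `φ < β ≤ 1`
and `δ ∈ [0,1]`. -/
structure Admissible (K : ℝ) : Prop where
  one_le : 1 ≤ K
  meas_rhoE : Measurable c.rhoE
  meas_rhoF : Measurable c.rhoF
  meas_rhoS : Measurable c.rhoS
  meas_zeta : Measurable c.zeta
  meas_phi : Measurable c.phi
  meas_a : Measurable c.a
  meas_eta : Measurable c.eta
  meas_k : Measurable c.k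
  rhoE_mem : ∀ x ∈ Ωe, c.rhoE x ∈ Icc K⁻¹ K
  zeta_mem : ∀ x ∈ Ωe ∪ Ωp, c.zeta x ∈ Icc K⁻¹ K
  rhoF_mem : ∀ x ∈ Ωp, c.rhoF x ∈ Icc K⁻¹ K
  rhoS_mem : ∀ x ∈ Ωp, c.rhoS x ∈ Icc K⁻¹ K
  eta_mem : ∀ x ∈ Ωp, c.eta x ∈ Icc K⁻¹ K
  k_mem : ∀ x ∈ Ωp, c.k x ∈ Icc K⁻¹ K
  phi_mem : ∀ x ∈ Ωp, c.phi x ∈ Icc K⁻¹ (1 - K⁻¹)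
  a_mem : ∀ x ∈ Ωp, c.a x ∈ Ioc 1 K
  mu_mem : ∀ κ, c.mu κ ∈ Icc K⁻¹ K
  lam_mem : ∀ κ, c.lam κ ∈ Icc 0 K
  m_mem : ∀ κ ∈ M.cellsP, c.m κ ∈ Icc K⁻¹ K
  beta_mem : ∀ κ ∈ M.cellsP, ∀ x ∈ M.cell κ, c.beta κ ∈ Ioc (c.phi x) 1
  delta_mem : c.delta ∈ Icc (0 : ℝ) 1

end Material

/-! ### Discrete spaces -/

section Forms

variable {d : ℕ} {Ωe Ωp : Set (Pt d)}

/-- Element-wise defined vector fields; the field on the element `κ` (and its trace on `∂κ`) is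
`v κ`. -/
abbrev Broken (M : PolytopicMesh d Ωe Ωp) := M.Cell → Pt d → Pt d

/-- A triple `(u_e, u_p, u_f)` of element-wise defined fields. -/
structure Triple (M : PolytopicMesh d Ωe Ωp) where
  e : Broken M
  p : Broken M
  f : Broken M

variable (M : PolytopicMesh d Ωe Ωp)

/-- Piecewise polynomial vector fields on the elements of `R`, of degree at most `deg κ` on `κ`
(set to zero on the other elements). -/
def IsPiecewisePoly (deg : M.Cell → ℕ) (R : Finset M.Cell) (v : Broken M) : Prop :=
  (∀ κ ∈ R, IsPolyField (deg κ) (v κ)) ∧ ∀ κ, κ ∉ R → v κ = 0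

/-- The discrete space `V_h = V_h^e × V_h^p × V_h^p`. -/
def Vh (deg : M.Cell → ℕ) : Set (Triple M) :=
  {V | IsPiecewisePoly M deg M.cellsE V.e ∧ IsPiecewisePoly M deg M.cellsP V.p ∧
    IsPiecewisePoly M deg M.cellsP V.f}

variable {M}

/-! ### Jumps and averages

They are written as sums over the elements sharing the face, which covers interior faces (two
elements) and boundary faces (one element) at once. -/

/-- `⟦v⟧ = v⁺ ⊗ n⁺ + v⁻ ⊗ n⁻`, and `v ⊗ n` on a boundary face. -/
def jump (v : Broken M) (F : M.Face) (x : Pt d) : Matrix (Fin d) (Fin d) ℝ :=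
  ∑ κ ∈ M.adj F, Matrix.vecMulVec (v κ x).ofLp (M.normal κ F).ofLp

/-- `⟦v⟧ₙ = v⁺ · n⁺ + v⁻ · n⁻`, and `v · n` on a boundary face. -/
def jumpN (v : Broken M) (F : M.Face) (x : Pt d) : ℝ :=
  ∑ κ ∈ M.adj F, inner ℝ (v κ x) (M.normal κ F)

/-- The average `{w} = (w⁺ + w⁻)/2`, and `w` on a boundary face. -/
def avg {α : Type} [AddCommMonoid α] [Module ℝ α] (w : M.Cell → α) (F : M.Face) : α :=
  ((M.adj F).card : ℝ)⁻¹ • ∑ κ ∈ M.adj F, w κ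

/-- The trace on an interface face from the elastic side. -/
def trE {α : Type} [AddCommMonoid α] (w : M.Cell → α) (F : M.Face) : α := ∑ κ ∈ M.adjE F, w κ

/-- The trace on an interface face from the poroelastic side. -/
def trP {α : Type} [AddCommMonoid α] (w : M.Cell → α) (F : M.Face) : α := ∑ κ ∈ M.adjP F, w κ

/-- The unit normal `n_p` on an interface face, pointing out of the poroelastic region. -/
def nP (F : M.Face) : Pt d := trP (fun κ => M.normal κ F) F

variable (c : Material M) (deg : M.Cell → ℕ) (c₁ c₂ : ℝ)

/-- The broken stress `σ_{eh}(v) = ℂ : ε_h(v)` on the element `κ`. -/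
def stress (v : Broken M) (κ : M.Cell) (x : Pt d) : Matrix (Fin d) (Fin d) ℝ :=
  elast (c.lam κ) (c.mu κ) (strain (v κ) x)

/-- The field `β u_p + u_f`. -/
def flux (U : Triple M) : Broken M := fun κ x => c.beta κ • U.p κ x + U.f κ x

/-- The field `(1-δ) β u_p + u_f`. -/
def fluxI (U : Triple M) : Broken M :=
  fun κ x => ((1 - c.delta) * c.beta κ) • U.p κ x + U.f κ x

/-- The penalty function `α`: `c₁` times the maximum of `|ℂ^{1/2}|₂² p_κ² / h_κ` over the elements
sharing the face. -/
def alpha (F : M.Face) : ℝ :=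
  c₁ * maxOver (M.adj F) fun κ => elastNormSq d (c.lam κ) (c.mu κ) * (deg κ : ℝ) ^ 2 / M.h κ

/-- The penalty function `γ`: `c₂` times the maximum of `m_κ p_κ² / h_κ` over the poroelastic
elements sharing the face. -/
def gamma (F : M.Face) : ℝ :=
  c₂ * maxOver (M.adjP F) fun κ => c.m κ * (deg κ : ℝ) ^ 2 / M.h κ

/-! ### Bilinear forms -/

/-- The form `𝓜`. -/
def massForm (U V : Triple M) : ℝ :=
  (∑ κ ∈ M.cellsE, ∫ x in M.cell κ, c.rhoE x * inner ℝ (U.e κ x) (V.e κ x)) +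
  (∑ κ ∈ M.cellsP, ∫ x in M.cell κ,
    inner ℝ (c.rhoP x • U.p κ x + c.rhoF x • U.f κ x) (V.p κ x)) +
  ∑ κ ∈ M.cellsP, ∫ x in M.cell κ,
    inner ℝ (c.rhoF x • U.p κ x + c.rhoW x • U.f κ x) (V.f κ x)

/-- The form `𝓓`. -/
def dampForm (U V : Triple M) : ℝ :=
  (∑ κ ∈ M.cellsE, ∫ x in M.cell κ, 2 * c.rhoE x * c.zeta x * inner ℝ (U.e κ x) (V.e κ x)) +
  (∑ κ ∈ M.cellsP, ∫ x in M.cell κ, 2 * c.rhoP x * c.zeta x * inner ℝ (U.p κ x) (V.p κ x)) +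
  ∑ κ ∈ M.cellsP, ∫ x in M.cell κ, c.eta x / c.k x * inner ℝ (U.f κ x) (V.f κ x)

/-- The interior penalty elasticity form `𝓐_h^⋆` on the elements `R` with the faces `Fs` and
density `ρ`. -/
def elasticForm (R : Finset M.Cell) (Fs : Finset M.Face) (ρ : Pt d → ℝ) (u v : Broken M) : ℝ :=
  (∑ κ ∈ R, ∫ x in M.cell κ, ddot (stress c u κ x) (strain (v κ) x)) +
  (∑ κ ∈ R, ∫ x in M.cell κ, ρ x * c.zeta x ^ 2 * inner ℝ (u κ x) (v κ x)) -
  (∑ F ∈ Fs, ∫ x in M.face F, ddot (avg (fun κ => stress c u κ x) F) (jump v F x) ∂surface d) -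
  (∑ F ∈ Fs, ∫ x in M.face F, ddot (jump u F x) (avg (fun κ => stress c v κ x) F) ∂surface d) +
  ∑ F ∈ Fs, ∫ x in M.face F, alpha c deg c₁ F * ddot (jump u F x) (jump v F x) ∂surface d

/-- The form `𝓑_h^p`. -/
def pressureForm (u v : Broken M) : ℝ :=
  (∑ κ ∈ M.cellsP, ∫ x in M.cell κ, c.m κ * divg (u κ) x * divg (v κ) x) -
  (∑ F ∈ M.facesP, ∫ x in M.face F,
    avg (fun κ => c.m κ * divg (u κ) x) F * jumpN v F x ∂surface d) -
  (∑ F ∈ M.facesP, ∫ x in M.face F,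
    jumpN u F x * avg (fun κ => c.m κ * divg (v κ) x) F ∂surface d) +
  ∑ F ∈ M.facesP, ∫ x in M.face F, gamma c deg c₂ F * (jumpN u F x * jumpN v F x) ∂surface d

/-- The form `𝓐_h`. -/
def Ah (U V : Triple M) : ℝ :=
  elasticForm c deg c₁ M.cellsE M.facesE c.rhoE U.e V.e +
  elasticForm c deg c₁ M.cellsP M.facesP c.rhoP U.p V.p +
  pressureForm c deg c₂ (flux c U) (flux c V)

/-- The jump `u_p - u_e` across an interface face. -/
def jumpI (U : Triple M) (F : M.Face) (x : Pt d) : Pt d :=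
  trP (fun κ => U.p κ x) F - trE (fun κ => U.e κ x) F

/-- The normal trace `((1-δ) β u_p + u_f) · n_p` on an interface face. -/
def filtI (U : Triple M) (F : M.Face) (x : Pt d) : ℝ :=
  inner ℝ (trP (fun κ => fluxI c U κ x) F) (nP F)

/-- The elastic traction `σ_{eh}(u_e) n_p` on an interface face, taken from the elastic side. -/
def tractionI (U : Triple M) (F : M.Face) (x : Pt d) : Pt d :=
  traction (trE (fun κ => stress c U.e κ x) F) (nP F)

/-- `m ∇_h · (β u_p + u_f)` on an interface face, taken from the poroelastic side. -/
def pressI (U : Triple M) (F : M.Face) (x : Pt d) : ℝ :=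
  trP (fun κ => c.m κ * divg (flux c U κ) x) F

/-- The coupling form `𝓒_h`: the sum of the interface contributions of the elastic, poroelastic
and filtration displacements. -/
def Ch (U V : Triple M) : ℝ :=
  ∑ F ∈ M.facesI, ∫ x in M.face F,
    (- inner ℝ (tractionI c U F x) (jumpI V F x) - inner ℝ (tractionI c V F x) (jumpI U F x) +
      alpha c deg c₁ F * inner ℝ (jumpI U F x) (jumpI V F x) -
      pressI c U F x * filtI c V F x - pressI c V F x * filtI c U F x +
      gamma c deg c₂ F * (filtI c U F x * filtI c V F x)) ∂surface d

/-- The load functional `𝓕`. -/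
def loadForm (fe fp gp : Pt d → Pt d) (V : Triple M) : ℝ :=
  (∑ κ ∈ M.cellsE, ∫ x in M.cell κ, inner ℝ (fe x) (V.e κ x)) +
  (∑ κ ∈ M.cellsP, ∫ x in M.cell κ, inner ℝ (fp x) (V.p κ x)) +
  ∑ κ ∈ M.cellsP, ∫ x in M.cell κ, inner ℝ (gp x) (V.f κ x)

/-! ### Norms -/

/-- `‖U‖₀²` -/
def normZeroSq (U : Triple M) : ℝ :=
  (∑ κ ∈ M.cellsE, ∫ x in M.cell κ, c.rhoE x * ‖U.e κ x‖ ^ 2) +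
  (∑ κ ∈ M.cellsP, ∫ x in M.cell κ, c.rhoU x * ‖U.p κ x‖ ^ 2) +
  ∑ κ ∈ M.cellsP, ∫ x in M.cell κ,
    c.rhoF x * c.phi x * ‖U.p κ x + (c.phi x)⁻¹ • U.f κ x‖ ^ 2

/-- `‖u‖²_{dG,⋆} = ‖ℂ^{1/2} : ε_h(u)‖² + ‖α^{1/2} ⟦u⟧‖²` on the elements `R` and the faces `Fs`. -/
def normDGSq (R : Finset M.Cell) (Fs : Finset M.Face) (u : Broken M) : ℝ :=
  (∑ κ ∈ R, ∫ x in M.cell κ, ddot (stress c u κ x) (strain (u κ) x)) +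
  ∑ F ∈ Fs, ∫ x in M.face F, alpha c deg c₁ F * ddot (jump u F x) (jump u F x) ∂surface d

/-- `|w|²_{dG,p} = ‖m^{1/2} ∇_h · w‖² + ‖γ^{1/2} ⟦w⟧ₙ‖²` -/
def seminormDivSq (w : Broken M) : ℝ :=
  (∑ κ ∈ M.cellsP, ∫ x in M.cell κ, c.m κ * divg (w κ) x ^ 2) +
  ∑ F ∈ M.facesP, ∫ x in M.face F, gamma c deg c₂ F * jumpN w F x ^ 2 ∂surface d

/-- `|U|²_{dG}` -/
def seminormDGSq (U : Triple M) : ℝ :=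
  normDGSq c deg c₁ M.cellsE M.facesE U.e + normDGSq c deg c₁ M.cellsP M.facesP U.p +
  seminormDivSq c deg c₂ (flux c U)

/-- `|U|²_{Γ_I}` -/
def seminormISq (U : Triple M) : ℝ :=
  (∑ F ∈ M.facesI, ∫ x in M.face F, alpha c deg c₁ F * ‖jumpI U F x‖ ^ 2 ∂surface d) +
  ∑ F ∈ M.facesI, ∫ x in M.face F, gamma c deg c₂ F * filtI c U F x ^ 2 ∂surface d

/-- The squared energy norm `‖U(t)‖_E²` of a time-dependent `U` with time derivative `U'`. -/
def energySq (U U' : ℝ → Triple M) (t : ℝ) : ℝ :=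
  normZeroSq c (U' t) + seminormDGSq c deg c₁ c₂ (U t) + seminormISq c deg c₁ c₂ (U t) +
  (∫ s in (0 : ℝ)..t, dampForm c (U' s) (U' s)) + dampForm c (U 0) (U 0)

/-- The weighted squared norm of the loads
`‖(2ρ_e ζ)^{-1/2} f_e‖² + ‖(2ρ_p ζ)^{-1/2} f_p‖² + ‖(k/η)^{1/2} g_p‖²`. -/
def loadNormSq (fe fp gp : Pt d → Pt d) : ℝ :=
  (∫ x in Ωe, (2 * c.rhoE x * c.zeta x)⁻¹ * ‖fe x‖ ^ 2) +
  (∫ x in Ωp, (2 * c.rhoP x * c.zeta x)⁻¹ * ‖fp x‖ ^ 2) +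
  ∫ x in Ωp, c.k x / c.eta x * ‖gp x‖ ^ 2

/-! ### The semi-discrete problem -/

/-- `f ∈ L²((0,T); L²(Ω))`. -/
def IsLoad (T : ℝ) (Ω : Set (Pt d)) (f : ℝ → Pt d → Pt d) : Prop :=
  MemLp (fun z : ℝ × Pt d => f z.1 z.2) 2
    ((volume.restrict (Ioc 0 T)).prod (volume.restrict Ω))

/-- On `[0,T]`, `u` is continuously differentiable with derivative `u'`, and `u'` is absolutely
continuous with (almost everywhere defined) derivative `u''`. Since the fields live in a
finite-dimensional space of piecewise polynomials, this can be said pointwise in `x`. -/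
def HasTimeDerivs (T : ℝ) (u u' u'' : ℝ → Broken M) : Prop :=
  ∀ κ x,
    (∀ t ∈ Icc 0 T, HasDerivWithinAt (fun s => u s κ x) (u' t κ x) (Icc 0 T) t) ∧
    IntervalIntegrable (fun s => u'' s κ x) volume 0 T ∧
    ∀ t ∈ Icc 0 T, u' t κ x = u' 0 κ x + ∫ s in (0 : ℝ)..t, u'' s κ x

/-- `U` (with time derivatives `U'` and `U''`) solves the semi-discrete problem
`𝓜(U'',V) + 𝓓(U',V) + 𝓐_h(U,V) + 𝓒_h(U,V) = 𝓕(V)` for all `V ∈ V_h` at almost every time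
of `(0,T]`. -/
structure IsSemidiscreteSolution (T : ℝ) (fe fp gp : ℝ → Pt d → Pt d)
    (U U' U'' : ℝ → Triple M) : Prop where
  mem : ∀ t ∈ Icc 0 T, U t ∈ Vh M deg ∧ U' t ∈ Vh M deg ∧ U'' t ∈ Vh M deg
  deriv_e : HasTimeDerivs T (fun t => (U t).e) (fun t => (U' t).e) (fun t => (U'' t).e)
  deriv_p : HasTimeDerivs T (fun t => (U t).p) (fun t => (U' t).p) (fun t => (U'' t).p)
  deriv_f : HasTimeDerivs T (fun t => (U t).f) (fun t => (U' t).f) (fun t => (U'' t).f)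
  eqn : ∀ᵐ t ∂(volume.restrict (Ioc 0 T)), ∀ V ∈ Vh M deg,
    massForm c (U'' t) V + dampForm c (U' t) V + Ah c deg c₁ c₂ (U t) V +
      Ch c deg c₁ c₂ (U t) V = loadForm (fe t) (fp t) (gp t) V

end Forms

end PoroDG

end

open PoroDG MeasureTheory Set

open scoped BigOperators

noncomputable section

namespace PoroDG

/-! The proof is the energy method: the equation is tested with the velocity `U'`. The forms 𝓜 and
𝓐_h + 𝓒_h are symmetric, so the time derivative of 𝓜(U',U') + (𝓐_h + 𝓒_h)(U,U) equals 2𝓕(U') -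
2𝓓(U',U'). All three velocities are damped, and the load norm carries the reciprocal weights of 𝓓,
so Young's inequality gives 2𝓕(U') ≤ 𝓓(U',U') + load norm. The loads are thus absorbed without
Gronwall's lemma, and integration in time leaves one copy of ∫𝓓 on the left
(`IsSemidiscreteSolution.energy_le`). It remains to compare the discrete energy with the energy
norm.

Kinetic part: completing the square in the coupled density (`mass_density_eq`) makes 𝓜(V,V)
equivalent to `normZeroSq`, with constants depending on `K` only (`mass_sandwich`).

Stiffness part: on the diagonal, 𝓐_h + 𝓒_h is the sum of the squared seminorms, a nonnegative
zero-order term, and cross terms pairing a stress or pressure trace with a jump.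
`abs_stiffness_sub_le` bounds the cross terms by half of the seminorms. Young's inequality spends
half of each penalty on the jump; what remains is h/p² times a face integral of the energy density,
divided by the penalty parameter, and a trace inequality for polynomials turns it into a small
multiple of the volume energy. That inequality (`PolytopicMesh.sum_integral_face_sq_le`) is uniform
in the number and size of the faces because each face has its own simplex and these do not overlap.
Its one-dimensional core, `endpoint_sq_le_integral`, is applied on the rays of a simplex issuing
from the apex (`integral_base_sq_le`).

The zero-order term is dropped at time t by its sign, and at time 0 it is bounded by 𝓓(U,U)(0),
which is why the norm contains that term.

Differentiating the energy needs care: `U''` is only integrable in time and the time derivatives are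
given pointwise in x. On the finite-dimensional discrete space every form is a finite combination of
products of point values (`exists_sampling`), so the product rule for absolutely continuous scalar
functions suffices. -/

/-! ### Markov's inequality and the one-dimensional trace estimate. -/

open Polynomial in
/-- Markov's inequality at the right end point of `[0, 1]`. -/
theorem markov_endpoint (n : ℕ) (Q : ℝ[X]) (hQ : Q.natDegree ≤ n) (B : ℝ)
    (hB : ∀ x ∈ Icc (0 : ℝ) 1, |Q.eval x| ≤ B) : (derivative Q).eval 1 ≤ 2 * n ^ 2 * B := by
  -- The normalisation divides by the bound, and `B` may be zero; a strict majorant `B'` avoids this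
  -- and tends to `B` at the end.
  have main : ∀ B' : ℝ, B < B' → (derivative Q).eval 1 ≤ 2 * n ^ 2 * B' := by
    intro B' hBB'
    have hB0 : 0 ≤ B := (abs_nonneg _).trans (hB 0 (by simp))
    have hpos : 0 < B' := lt_of_le_of_lt hB0 hBB'
    -- `L` maps `[-1, 1]` onto `[0, 1]` and fixes 1; its slope 1/2 is the source of the factor 2.
    -- Among polynomials of degree at most `n` bounded by 1 on `[-1, 1]`, the Chebyshev polynomial
    -- has the largest derivative at 1, namely `n²`.
    set L : ℝ[X] := C (1 / 2) * (X + 1) with hL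
    have hLd : L.natDegree ≤ 1 := by
      rw [hL]; compute_degree
    set P : ℝ[X] := C B'⁻¹ * Q.comp L with hP
    have hPn : P.natDegree ≤ n := by
      refine (natDegree_C_mul_le _ _).trans (natDegree_comp_le.trans ?_)
      calc Q.natDegree * L.natDegree ≤ n * 1 := Nat.mul_le_mul hQ hLd
        _ = n := mul_one n
    have hev : ∀ x : ℝ, P.eval x = B'⁻¹ * Q.eval ((x + 1) / 2) := by
      intro x
      simp [hP, hL, eval_comp]
      left; congr 1; ring
    have hPb : ∀ x ∈ Icc (-1 : ℝ) 1, |P.eval x| ≤ 1 := by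
      intro x hx
      rw [hev, abs_mul, abs_of_pos (inv_pos.2 hpos), inv_mul_le_iff₀ hpos, mul_one]
      exact (hB _ ⟨by linarith [hx.1], by linarith [hx.2]⟩).trans hBB'.le
    have h1 := Chebyshev.eval_iterate_derivative_le_of_forall_abs_le_one (n := n) (P := P) (k := 1)
      (x := 1) le_rfl (natDegree_le_iff_degree_le.1 hPn) hPb
    have h2 : (derivative (Chebyshev.T ℝ n)).eval 1 = (n : ℝ) ^ 2 := by
      have := Chebyshev.derivative_T_eval_one (R := ℝ) (n : ℤ)
      simpa using this
    have h3 : (derivative P).eval 1 = B'⁻¹ * (1 / 2) * (derivative Q).eval 1 := by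
      have hLe : L.eval 1 = 1 := by norm_num [hL]
      have hLd : derivative L = C (1 / 2) := by simp [hL]
      rw [hP, derivative_C_mul, derivative_comp, eval_mul, eval_C, eval_mul, eval_comp, hLe, hLd,
        eval_C]
      ring
    simp only [Function.iterate_one] at h1
    rw [h2, h3] at h1
    have : (derivative Q).eval 1 = 2 * B' * (B'⁻¹ * (1 / 2) * (derivative Q).eval 1) := by
      field_simp
    rw [this]
    nlinarith
  refine le_of_forall_pos_le_add fun ε hε => ?_
  -- The `+ 1` keeps the denominator positive when `n = 0`.
  have := main (B + ε / (2 * n ^ 2 + 1)) (lt_add_of_pos_right _ (by positivity))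
  refine this.trans ?_
  rw [mul_add]
  have : 2 * (n : ℝ) ^ 2 * (ε / (2 * n ^ 2 + 1)) ≤ ε := by
    rw [mul_div_assoc', div_le_iff₀ (by positivity)]
    nlinarith
  linarith

open Polynomial in
theorem exists_antiderivative (P : ℝ[X]) (n : ℕ) (hP : P.natDegree ≤ n) :
    ∃ Q : ℝ[X], Q.natDegree ≤ n + 1 ∧ derivative Q = P ∧ Q.eval 0 = 0 := by
  refine ⟨∑ i ∈ Finset.range (n + 1), C (P.coeff i / (i + 1)) * X ^ (i + 1), ?_, ?_, ?_⟩
  · refine natDegree_sum_le_of_forall_le _ _ fun i hi => ?_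
    refine (natDegree_C_mul_X_pow_le _ _).trans ?_
    have := Finset.mem_range.1 hi
    omega
  · rw [derivative_sum]
    conv_rhs => rw [P.as_sum_range_C_mul_X_pow' (n := n + 1) (by omega)]
    refine Finset.sum_congr rfl fun i _ => ?_
    rw [derivative_C_mul_X_pow]
    congr 2
    push_cast
    field_simp
  · simp [eval_finsetSum]

open Polynomial in
/-- A polynomial is controlled at an end point by its weighted `L²` norm. -/
theorem endpoint_sq_le_integral (n p : ℕ) (w : ℝ[X]) (hw : w.natDegree ≤ p) :
    w.eval 1 ^ 2 ≤ 2 * (2 * p + n + 1) ^ 2 * ∫ s in (0 : ℝ)..1, s ^ n * w.eval s ^ 2 := by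
  -- The antiderivative `Q` of the weighted square increases on `[0, 1]`, so its maximum there is
  -- `Q(1)`, the integral in question. Markov's inequality for `Q`, of degree at most `2p + n + 1`,
  -- bounds `Q'(1) = w(1)²`.
  obtain ⟨Q, hQd, hQ, hQ0⟩ := exists_antiderivative (X ^ n * w ^ 2) (2 * p + n) (by
    refine natDegree_mul_le.trans ?_
    have h1 : (w ^ 2).natDegree ≤ 2 * p := natDegree_pow_le.trans (by omega)
    have h2 : (X ^ n : ℝ[X]).natDegree ≤ n := natDegree_X_pow_le n
    omega)
  have hcont : Continuous fun s : ℝ => s ^ n * w.eval s ^ 2 := by fun_prop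
  have hI : ∀ x : ℝ, ∫ s in (0 : ℝ)..x, s ^ n * w.eval s ^ 2 = Q.eval x := by
    intro x
    have := intervalIntegral.integral_eq_sub_of_hasDerivAt (a := 0) (b := x)
      (f := fun s => Q.eval s) (f' := fun s : ℝ => s ^ n * w.eval s ^ 2)
      (fun s _ => by simpa [hQ] using Q.hasDerivAt s) (hcont.intervalIntegrable _ _)
    rw [this, hQ0, sub_zero]
  rw [hI]
  have hmono : ∀ x ∈ Icc (0 : ℝ) 1, |Q.eval x| ≤ Q.eval 1 := by
    intro x hx
    rw [← hI x, ← hI 1]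
    have hnn : ∀ s ∈ Icc (0 : ℝ) 1, 0 ≤ s ^ n * w.eval s ^ 2 := fun s hs =>
      mul_nonneg (pow_nonneg hs.1 _) (sq_nonneg _)
    have h0 : 0 ≤ ∫ s in (0 : ℝ)..x, s ^ n * w.eval s ^ 2 :=
      intervalIntegral.integral_nonneg hx.1 fun s hs => hnn s ⟨hs.1, hs.2.trans hx.2⟩
    have h1 : 0 ≤ ∫ s in x..1, s ^ n * w.eval s ^ 2 :=
      intervalIntegral.integral_nonneg hx.2 fun s hs => hnn s ⟨hx.1.trans hs.1, hs.2⟩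
    rw [abs_of_nonneg h0, ← intervalIntegral.integral_add_adjacent_intervals
      (hcont.intervalIntegrable 0 x) (hcont.intervalIntegrable x 1)]
    linarith
  have := markov_endpoint (2 * p + n + 1) Q hQd _ hmono
  rw [hQ] at this
  simpa using this

/-! ### Integration over a cone and the trace inequality on its base. -/

section Cone

variable {E : Type*} [NormedAddCommGroup E] [InnerProductSpace ℝ E] [FiniteDimensional ℝ E]
  [MeasurableSpace E] [BorelSpace E]

/-- Orthogonal coordinates in `V × ℝ` for a hyperplane direction `V`. -/
theorem exists_hyperplane_coordinates (V : Submodule ℝ E) (hV : Module.finrank ℝ Vᗮ = 1) (p : E) :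
    ∃ e : ℝ ≃ₗᵢ[ℝ] Vᗮ, ∃ Φ : V × ℝ ≃ᵐ E, (∀ z t, Φ (z, t) = (z : E) + e t + p) ∧
      MeasurePreserving Φ volume volume := by
  have e : ℝ ≃ₗᵢ[ℝ] Vᗮ := (OrthonormalBasis.singleton (Fin 1) ℝ).equiv
    (stdOrthonormalBasis ℝ Vᗮ) (finCongr hV.symm)
  have h1 := V.measurePreserving_measurableEquivProd p
  rw [InnerProductSpace.euclideanHausdorffMeasure_eq_volume] at h1
  have h2 := h1.symm
  let e' : ℝ ≃ᵐ Vᗮ := e.toHomeomorph.toMeasurableEquiv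
  have h3 : MeasurePreserving e' volume volume := e.measurePreserving
  refine ⟨e, (MeasurableEquiv.prodCongr (MeasurableEquiv.refl V) e').trans
    (V.measurableEquivProd p).symm, ?_, ?_⟩
  · intro z t
    have : (V.measurableEquivProd p).symm (z, e t) = (z : E) + e t + p := by
      rw [Submodule.measurableEquivProd_symm_apply]; rfl
    exact this
  · exact h2.comp ((MeasurePreserving.id volume).prod h3)

/-- The isometry `z ↦ z + p` carries Lebesgue measure on `V` to the Hausdorff measure on the
hyperplane, thanks to the Euclidean normalisation. Surface integrals become integrals over a vector
space, where translations and dilations are available. -/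
theorem setIntegral_hyperplane (V : Submodule ℝ E) (p : E) (F : Set E)
    (hFV : ∀ y ∈ F, y - p ∈ V) (G : E → ℝ) :
    ∫ y in F, G y ∂(μHE[Module.finrank ℝ V] : Measure E) =
      ∫ z in {z : V | (z : E) + p ∈ F}, G ((z : E) + p) := by
  let j : V → E := fun z => (z : E) + p
  have hj : Isometry j := (isometry_add_right p).comp isometry_subtype_coe
  have hje : MeasurableEmbedding j := hj.isClosedEmbedding.measurableEmbedding
  have hmap := hj.map_euclideanHausdorffMeasure (d := Module.finrank ℝ V)
  rw [InnerProductSpace.euclideanHausdorffMeasure_eq_volume] at hmap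
  have h := hje.setIntegral_map (μ := volume) G F
  have hsub : F ⊆ range j := fun y hy => ⟨⟨y - p, hFV y hy⟩, by simp [j]⟩
  have : ((μHE[Module.finrank ℝ V] : Measure E).restrict (range j)).restrict F =
      (μHE[Module.finrank ℝ V] : Measure E).restrict F := by
    rw [Measure.restrict_restrict_of_subset hsub]
  rw [hmap, this] at h
  exact h

/-- Integration over the cone with apex `a` and base `F`. -/
theorem setIntegral_cone (V : Submodule ℝ E) (hV : Module.finrank ℝ Vᗮ = 1) (p a : E) (F S : Set E)
    (hF : IsCompact F) (hFV : ∀ y ∈ F, y - p ∈ V)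
    (hS : S = (fun q : ℝ × E => a + q.1 • (q.2 - a)) '' (Icc 0 1 ×ˢ F))
    (hpos : volume S ≠ 0) :
    ∃ H : ℝ, 0 < H ∧ ∀ g : E → ℝ, Continuous g → ∫ x in S, g x =
      H * ∫ s in Ioc (0 : ℝ) 1, ∫ y in F, s ^ Module.finrank ℝ V * g (a + s • (y - a))
        ∂(μHE[Module.finrank ℝ V] : Measure E) := by
  obtain ⟨e, Φ, hΦ, hmp⟩ := exists_hyperplane_coordinates V hV p
  obtain ⟨⟨a', h⟩, ha⟩ := Φ.surjective a
  rw [hΦ] at ha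
  have hScomp : IsCompact S := by
    rw [hS]
    exact (isCompact_Icc.prod hF).image (by fun_prop)
  have hdec : ∀ (z z' : V) (t t' : ℝ), (z : E) + e t + p = (z' : E) + e t' + p →
      z = z' ∧ t = t' := by
    intro z z' t t' hh
    rw [← hΦ, ← hΦ] at hh
    simpa using Φ.injective hh
  -- In these coordinates the base has height 0 and the apex is `(a', h)`. The point with parameter
  -- `s` on the ray towards `y` has height `h (1 - s)`, and the slice at that height is a copy of
  -- `F` contracted by `s`.
  have hpt : ∀ (s : ℝ) (y : V), a + s • ((y : E) + p - a) =
      ((s • y + (1 - s) • a' : V) : E) + e (h * (1 - s)) + p := by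
    intro s y
    have : e (h * (1 - s)) = (1 - s) • e h := by rw [mul_comm, ← smul_eq_mul, map_smul]
    rw [this, ← ha]
    push_cast
    module
  have hmem : ∀ (z : V) (t : ℝ), Φ (z, t) ∈ S ↔ ∃ s ∈ Icc (0 : ℝ) 1, ∃ y : V, (y : E) + p ∈ F ∧
      z = s • y + (1 - s) • a' ∧ t = h * (1 - s) := by
    intro z t
    rw [hS]
    constructor
    · rintro ⟨⟨s, y⟩, ⟨hs, hy⟩, heq⟩
      refine ⟨s, hs, ⟨y - p, hFV y hy⟩, by simpa using hy, ?_⟩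
      have := hpt s ⟨y - p, hFV y hy⟩
      simp only [sub_add_cancel] at this
      simp only at heq
      rw [this, hΦ] at heq
      have := hdec _ _ _ _ heq
      exact ⟨this.1.symm, this.2.symm⟩
    · rintro ⟨s, hs, y, hy, rfl, rfl⟩
      refine ⟨(s, (y : E) + p), ⟨hs, hy⟩, ?_⟩
      rw [hΦ]
      exact hpt s y
  -- With the apex at height zero the cone would lie in a hyperplane and be a null set.
  have hh0 : h ≠ 0 := by
    rintro rfl
    apply hpos
    refine measure_mono_null ?_ (Measure.addHaar_affineSubspace volume (AffineSubspace.mk' p V) ?_)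
    · intro x hx
      obtain ⟨⟨z, t⟩, rfl⟩ := Φ.surjective x
      obtain ⟨s, -, y, -, -, ht⟩ := (hmem z t).1 hx
      rw [hΦ]
      simp [AffineSubspace.mem_mk', ht]
    · intro htop
      have : V = ⊤ := by
        have := congrArg AffineSubspace.direction htop
        simpa using this
      rw [this, Submodule.top_orthogonal_eq_bot, finrank_bot] at hV
      exact zero_ne_one hV
  -- The substitution `t = h (1 - s)` contributes the factor `|h|`, and the contraction of the
  -- slices contributes `s ^ n`.
  refine ⟨|h|, abs_pos.2 hh0, fun g hg => ?_⟩
  set G : E → ℝ := S.indicator g with hG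
  have hGint : Integrable G := by
    rw [hG, integrable_indicator_iff hScomp.measurableSet]
    exact hg.continuousOn.integrableOn_compact hScomp
  have hcomp : Integrable (fun q : V × ℝ => G (Φ q)) (volume.prod volume) :=
    (hmp.integrable_comp_emb Φ.measurableEmbedding).2 hGint
  set n := Module.finrank ℝ V with hn
  have hinner : ∀ s : ℝ, s ≠ 0 → ∫ z : V, G (Φ (z, h * (1 - s))) =
      (Ioc (0 : ℝ) 1).indicator (fun s => ∫ y in F, s ^ n * g (a + s • (y - a))
        ∂(μHE[n] : Measure E)) s := by
    intro s hs0
    by_cases hs : s ∈ Ioc (0 : ℝ) 1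
    · rw [indicator_of_mem hs, hn, setIntegral_hyperplane V p F hFV, ← hn]
      have hFm : MeasurableSet {z : V | (z : E) + p ∈ F} :=
        hF.measurableSet.preimage (f := fun z : V => (z : E) + p) (by fun_prop)
      rw [← integral_indicator hFm]
      have h1 := Measure.integral_comp_smul_of_nonneg (volume : Measure V)
        (fun w => G (Φ (w + (1 - s) • a', h * (1 - s)))) s (hR := hs.1.le)
      rw [integral_add_right_eq_self (fun w => G (Φ (w, h * (1 - s))))] at h1
      have h2 : ∫ z : V, G (Φ (z, h * (1 - s))) =
          s ^ n * ∫ x : V, G (Φ (s • x + (1 - s) • a', h * (1 - s))) := by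
        rw [h1, smul_eq_mul, ← mul_assoc, mul_inv_cancel₀ (pow_ne_zero _ hs0), one_mul]
      rw [h2, ← integral_const_mul]
      congr 1
      ext y
      by_cases hy : (y : E) + p ∈ F
      · have : Φ (s • y + (1 - s) • a', h * (1 - s)) ∈ S :=
          (hmem _ _).2 ⟨s, ⟨hs.1.le, hs.2⟩, y, hy, rfl, rfl⟩
        rw [hG, indicator_of_mem this, indicator_of_mem (by exact hy), hpt, hΦ]
      · rw [indicator_of_notMem (by exact hy), hG, indicator_of_notMem, mul_zero]
        intro hm
        obtain ⟨s', -, y', hy', h3, h4⟩ := (hmem _ _).1 hm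
        have : s = s' := by
          have := mul_left_cancel₀ hh0 h4
          linarith
        subst this
        have : y = y' := by
          have := add_right_cancel h3
          exact smul_right_injective V hs0 this
        subst this
        exact hy hy'
    · rw [indicator_of_notMem hs]
      refine integral_eq_zero_of_ae (Filter.Eventually.of_forall fun z => ?_)
      refine indicator_of_notMem (fun hm => hs ?_) _
      obtain ⟨s', hs', y', hy', h3, h4⟩ := (hmem _ _).1 hm
      have : s = s' := by
        have := mul_left_cancel₀ hh0 h4
        linarith
      subst this
      exact ⟨lt_of_le_of_ne hs'.1 hs0.symm, hs'.2⟩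
  calc ∫ x in S, g x = ∫ x, G x := (integral_indicator hScomp.measurableSet).symm
    _ = ∫ q : V × ℝ, G (Φ q) := (hmp.integral_comp Φ.measurableEmbedding G).symm
    _ = ∫ t : ℝ, ∫ z : V, G (Φ (z, t)) := by
        rw [Measure.volume_eq_prod]
        exact integral_prod_symm _ hcomp
    _ = |h| * ∫ s : ℝ, ∫ z : V, G (Φ (z, h * (1 - s))) := by
        have h1 := integral_sub_left_eq_self (fun s => ∫ z : V, G (Φ (z, h * s))) volume 1
        rw [h1, Measure.integral_comp_mul_left (fun t => ∫ z : V, G (Φ (z, t))) h, smul_eq_mul,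
          ← mul_assoc, ← abs_mul, mul_inv_cancel₀ hh0, abs_one, one_mul]
    _ = _ := by
        rw [← integral_indicator measurableSet_Ioc]
        congr 1
        refine integral_congr_ae ?_
        have : ∀ᵐ s : ℝ, s ≠ 0 := by
          rw [ae_iff]
          simp
        filter_upwards [this] with s hs
        exact hinner s hs

/-- Trace inequality on a cone, for functions that are polynomials on the rays from the apex. -/
theorem integral_base_sq_le (V : Submodule ℝ E) (hV : Module.finrank ℝ Vᗮ = 1) (p a : E)
    (F S : Set E) (hF : IsCompact F) (hFV : ∀ y ∈ F, y - p ∈ V)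
    (hS : S = (fun q : ℝ × E => a + q.1 • (q.2 - a)) '' (Icc 0 1 ×ˢ F))
    (hpos : volume S ≠ 0) (k : ℕ) (w : E → ℝ) (hw : Continuous w)
    (hpoly : ∀ y, ∃ Q : Polynomial ℝ, Q.natDegree ≤ k ∧ ∀ s, w (a + s • (y - a)) = Q.eval s) :
    (Module.finrank ℝ V + 1) * volume.real S /
        (μHE[Module.finrank ℝ V] : Measure E).real F *
        ∫ y in F, w y ^ 2 ∂(μHE[Module.finrank ℝ V] : Measure E) ≤
      2 * (2 * k + Module.finrank ℝ V + 1) ^ 2 * ∫ x in S, w x ^ 2 := by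
  obtain ⟨H, hH, hcone⟩ := setIntegral_cone V hV p a F S hF hFV hS hpos
  set n := Module.finrank ℝ V
  set σ : Measure E := μHE[n]
  have hσF : σ F ≠ ⊤ := by
    have hj : Isometry (fun z : V => (z : E) + p) :=
      (isometry_add_right p).comp isometry_subtype_coe
    have h1 := hj.euclideanHausdorffMeasure_preimage (d := n) F
    have h2 : F ∩ range (fun z : V => (z : E) + p) = F :=
      inter_eq_left.2 fun y hy => ⟨⟨y - p, hFV y hy⟩, by simp⟩
    rw [h2, InnerProductSpace.euclideanHausdorffMeasure_eq_volume] at h1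
    rw [show σ F = _ from h1.symm]
    exact (hj.isClosedEmbedding.isCompact_preimage hF).measure_ne_top
  have hfin : IsFiniteMeasure (σ.restrict F) := ⟨by simpa using hσF.lt_top⟩
  -- The case `g = 1` identifies the unspecified factor: the quotient `(n + 1) |S| / |F|` of the
  -- claim is exactly `H`.
  have hvol : volume.real S = H * (σ.real F / (n + 1)) := by
    have h1 := hcone (fun _ => 1) continuous_const
    simp only [mul_one, setIntegral_const, smul_eq_mul] at h1
    rw [h1, ← intervalIntegral.integral_of_le zero_le_one]
    simp [mul_comm, div_eq_mul_inv]
  have hrhs := hcone (fun x => w x ^ 2) (by fun_prop)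
  set J : E → ℝ := fun y => ∫ s in Ioc (0 : ℝ) 1, s ^ n * w (a + s • (y - a)) ^ 2 with hJ
  have hint : Integrable (Function.uncurry fun (s : ℝ) (y : E) => s ^ n * w (a + s • (y - a)) ^ 2)
      ((volume.restrict (Ioc 0 1)).prod (σ.restrict F)) := by
    -- The surface measure is not locally finite on the whole space. Restricting twice puts the
    -- finite measure `σ.restrict F` into the product and still keeps `F` as a compact set of
    -- integration.
    have h1 : (σ.restrict F) = (σ.restrict F).restrict F := by
      rw [Measure.restrict_restrict_of_subset subset_rfl]
    rw [h1, Measure.prod_restrict]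
    have h2 : Continuous
        (Function.uncurry fun (s : ℝ) (y : E) => s ^ n * w (a + s • (y - a)) ^ 2) := by
      unfold Function.uncurry
      fun_prop
    have h3 : IntegrableOn (Function.uncurry fun (s : ℝ) (y : E) => s ^ n * w (a + s • (y - a)) ^ 2)
        (Icc 0 1 ×ˢ F) (volume.prod (σ.restrict F)) :=
      h2.continuousOn.integrableOn_compact (isCompact_Icc.prod hF)
    exact h3.mono_set (prod_mono Ioc_subset_Icc_self subset_rfl)
  have hswap : (∫ s in Ioc (0 : ℝ) 1, (∫ y in F, s ^ n * w (a + s • (y - a)) ^ 2 ∂σ)) =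
      ∫ y in F, J y ∂σ := integral_integral_swap hint
  have hJint : Integrable J (σ.restrict F) := hint.integral_prod_right
  rw [hswap] at hrhs
  have hpt : ∀ y, w y ^ 2 ≤ 2 * (2 * k + n + 1) ^ 2 * J y := by
    intro y
    obtain ⟨Q, hQ, hQw⟩ := hpoly y
    have h1 := endpoint_sq_le_integral n k Q hQ
    have h2 := hQw 1
    rw [one_smul, add_sub_cancel] at h2
    rw [h2, hJ]
    simp only [hQw]
    rwa [intervalIntegral.integral_of_le zero_le_one] at h1
  have hle : ∫ y in F, w y ^ 2 ∂σ ≤ 2 * (2 * k + n + 1) ^ 2 * ∫ y in F, J y ∂σ := by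
    rw [← integral_const_mul]
    refine integral_mono_of_nonneg (Filter.Eventually.of_forall fun y => sq_nonneg _)
      (hJint.const_mul _) (Filter.Eventually.of_forall hpt)
  rw [hvol, hrhs]
  have hX : 0 ≤ ∫ y in F, J y ∂σ := by
    refine integral_nonneg fun y => ?_
    have h1 := (sq_nonneg (w y)).trans (hpt y)
    exact (mul_nonneg_iff_of_pos_left (by positivity)).1 h1
  -- For a null base the quotient is zero by the convention on division, and the right side is
  -- nonnegative.
  by_cases h0 : σ.real F = 0
  · rw [h0]
    simp only [div_zero, zero_mul]
    positivity
  · have : ((n : ℝ) + 1) * (H * (σ.real F / (n + 1))) / σ.real F = H := by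
      field_simp
    rw [this]
    calc H * ∫ y in F, w y ^ 2 ∂σ ≤ H * (2 * (2 * k + n + 1) ^ 2 * ∫ y in F, J y ∂σ) := by
          gcongr
      _ = _ := by ring

end Cone

/-! ### Polynomial functions -/

/-- `f` is a polynomial function of total degree at most `n`. -/
def IsPolyFun {d : ℕ} (n : ℕ) (f : Pt d → ℝ) : Prop :=
  ∃ P : MvPolynomial (Fin d) ℝ, P.totalDegree ≤ n ∧
    ∀ x, f x = MvPolynomial.eval (fun j => x j) P

theorem totalDegree_pderiv_le {σ : Type*} (i : σ) (P : MvPolynomial σ ℝ) :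
    (MvPolynomial.pderiv i P).totalDegree ≤ P.totalDegree := by
  conv_lhs => rw [P.as_sum, map_sum]
  refine MvPolynomial.totalDegree_finsetSum_le fun m hm => ?_
  rw [MvPolynomial.pderiv_monomial]
  refine (MvPolynomial.totalDegree_monomial_le _ _).trans ?_
  refine le_trans ?_ (MvPolynomial.le_totalDegree hm)
  exact Finsupp.degree_mono tsub_le_self

section

variable {d : ℕ} {n : ℕ}

namespace IsPolyFun

variable {f g : Pt d → ℝ}

theorem zero : IsPolyFun n (fun _ : Pt d => (0 : ℝ)) := ⟨0, by simp, by simp⟩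

theorem add (hf : IsPolyFun n f) (hg : IsPolyFun n g) : IsPolyFun n (fun x => f x + g x) := by
  obtain ⟨P, hP, hf⟩ := hf
  obtain ⟨Q, hQ, hg⟩ := hg
  exact ⟨P + Q, (MvPolynomial.totalDegree_add _ _).trans (max_le hP hQ), by simp [hf, hg]⟩

theorem const_mul (c : ℝ) (hf : IsPolyFun n f) : IsPolyFun n (fun x => c * f x) := by
  obtain ⟨P, hP, hf⟩ := hf
  exact ⟨c • P, (MvPolynomial.totalDegree_smul_le _ _).trans hP, by simp [hf]⟩

theorem sum {ι : Type*} (s : Finset ι) {f : ι → Pt d → ℝ} (hf : ∀ i ∈ s, IsPolyFun n (f i)) :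
    IsPolyFun n (fun x => ∑ i ∈ s, f i x) := by
  classical
  induction s using Finset.induction_on with
  | empty => simpa using zero
  | insert a s ha ih =>
    simp only [Finset.sum_insert ha]
    exact (hf a (by simp)).add (ih fun i hi => hf i (by simp [hi]))

theorem continuous (hf : IsPolyFun n f) : Continuous f := by
  obtain ⟨P, -, hf⟩ := hf
  rw [funext hf]
  exact P.continuous_eval.comp (by fun_prop)

/-- The restriction of a polynomial function to a line is a polynomial. -/
theorem exists_polynomial_line (hf : IsPolyFun n f) (a b : Pt d) :
    ∃ Q : Polynomial ℝ, Q.natDegree ≤ n ∧ ∀ s : ℝ, f (a + s • b) = Q.eval s := by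
  obtain ⟨P, hP, hf⟩ := hf
  refine ⟨MvPolynomial.aeval (fun i => Polynomial.C (a i) + Polynomial.X * Polynomial.C (b i)) P,
    ?_, fun s => ?_⟩
  · have := MvPolynomial.aeval_natDegree_le P hP
      (fun i => Polynomial.C (a i) + Polynomial.X * Polynomial.C (b i)) (fun i => show _ ≤ 1 by
        compute_degree)
    simpa using this
  · rw [hf, ← Polynomial.coe_evalRingHom, MvPolynomial.aeval_def, MvPolynomial.eval₂_eq,
      MvPolynomial.eval_eq, map_sum]
    simp only [map_mul, map_prod, map_pow, map_add, Polynomial.coe_evalRingHom, Polynomial.eval_C,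
      Polynomial.eval_X, Polynomial.algebraMap_eq]
    simp

end IsPolyFun

/-- Induction on the polynomial links the analytic derivative with the algebraic `pderiv`; this is
how strains and divergences are recognised as polynomials. -/
theorem hasFDerivAt_eval (P : MvPolynomial (Fin d) ℝ) (x : Pt d) :
    ∃ L : Pt d →L[ℝ] ℝ, HasFDerivAt (fun y : Pt d => MvPolynomial.eval (fun j => y j) P) L x ∧
      ∀ j, L (EuclideanSpace.single j 1) =
        MvPolynomial.eval (fun j => x j) (MvPolynomial.pderiv j P) := by
  induction P using MvPolynomial.induction_on with
  | C a => exact ⟨0, by simpa using hasFDerivAt_const a x, by simp⟩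
  | add p q hp hq =>
    obtain ⟨L, hL, hL'⟩ := hp
    obtain ⟨L₂, hL₂, hL₂'⟩ := hq
    exact ⟨L + L₂, by simpa using hL.fun_add hL₂, by simp [hL', hL₂']⟩
  | mul_X p i hp =>
    obtain ⟨L, hL, hL'⟩ := hp
    have hi : HasFDerivAt (fun y : Pt d => y i) (EuclideanSpace.proj i : Pt d →L[ℝ] ℝ) x :=
      (EuclideanSpace.proj i : Pt d →L[ℝ] ℝ).hasFDerivAt
    have := hL.fun_mul hi
    refine ⟨_, by simpa using this, fun j => ?_⟩
    simp only [_root_.add_apply, _root_.smul_apply, hL', smul_eq_mul,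
      Derivation.leibniz, MvPolynomial.pderiv_X, map_add, map_mul, MvPolynomial.eval_X]
    by_cases h : j = i
    · subst h; simp
    · simp [Ne.symm h]

theorem IsPolyField.differentiableAt_apply {v : Pt d → Pt d} (hv : IsPolyField n v) (x : Pt d) (i : Fin d) :
    DifferentiableAt ℝ (fun y => v y i) x := by
  obtain ⟨P, -, hP⟩ := hv i
  obtain ⟨L, hL, -⟩ := hasFDerivAt_eval P x
  rw [funext hP]
  exact hL.differentiableAt

theorem IsPolyField.differentiable {v : Pt d → Pt d} (hv : IsPolyField n v) :
    Differentiable ℝ v := fun x => differentiableAt_euclidean.2 fun i => hv.differentiableAt_apply x i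

/-- Keeping the bound `n` instead of `n - 1` loses nothing essential and preserves the lower bound 1
on the degree that the trace inequality relies on. -/
theorem IsPolyField.partialD_isPolyFun {v : Pt d → Pt d} (hv : IsPolyField n v) (i j : Fin d) :
    IsPolyFun n (fun x => partialD v x i j) := by
  obtain ⟨P, hP, hvP⟩ := hv i
  refine ⟨MvPolynomial.pderiv j P, (totalDegree_pderiv_le j P).trans hP, fun x => ?_⟩
  obtain ⟨L, hL, hL'⟩ := hasFDerivAt_eval P x
  rw [← hL' j]
  have h1 := (hv.differentiable x).hasFDerivAt
  have h2 := ((EuclideanSpace.proj i : Pt d →L[ℝ] ℝ).hasFDerivAt (x := v x)).comp x h1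
  have h3 : (⇑(EuclideanSpace.proj i : Pt d →L[ℝ] ℝ) ∘ v) = fun y => v y i := rfl
  rw [h3] at h2
  rw [← funext hvP] at hL
  have := h2.unique hL
  rw [← this]
  rfl

theorem IsPolyField.continuous {v : Pt d → Pt d} (hv : IsPolyField n v) : Continuous v :=
  hv.differentiable.continuous

theorem IsPolyField.add {u v : Pt d → Pt d} (hu : IsPolyField n u) (hv : IsPolyField n v) :
    IsPolyField n (fun x => u x + v x) := fun i => IsPolyFun.add (hu i) (hv i)

theorem IsPolyField.smul {v : Pt d → Pt d} (c : ℝ) (hv : IsPolyField n v) :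
    IsPolyField n (fun x => c • v x) := fun i => IsPolyFun.const_mul c (hv i)

theorem IsPolyField.zero : IsPolyField n (0 : Pt d → Pt d) := fun _ => IsPolyFun.zero

theorem partialD_add {u v : Pt d → Pt d} (hu : IsPolyField n u) (hv : IsPolyField n v) (x : Pt d)
    (i j : Fin d) :
    partialD (fun x => u x + v x) x i j =
      partialD u x i j + partialD v x i j := by
  unfold partialD
  rw [fderiv_fun_add (hu.differentiable x) (hv.differentiable x)]
  rfl

theorem partialD_smul {v : Pt d → Pt d} (c : ℝ) (hv : IsPolyField n v) (x : Pt d) (i j : Fin d) :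
    partialD (fun x => c • v x) x i j = c * partialD v x i j := by
  unfold partialD
  rw [fderiv_fun_const_smul (hv.differentiable x)]
  rfl

theorem IsPolyField.strain_isPolyFun {v : Pt d → Pt d} (hv : IsPolyField n v) (i j : Fin d) :
    IsPolyFun n (fun x => strain v x i j) := by
  have := ((hv.partialD_isPolyFun i j).add (hv.partialD_isPolyFun j i)).const_mul (1 / 2)
  refine cast ?_ this
  congr 1
  ext x
  simp [strain]
  ring

theorem IsPolyField.divg_isPolyFun {v : Pt d → Pt d} (hv : IsPolyField n v) :
    IsPolyFun n (fun x => divg v x) := IsPolyFun.sum _ fun i _ => hv.partialD_isPolyFun i i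

theorem trace_strain (v : Pt d → Pt d) (x : Pt d) : (strain v x).trace = divg v x := by
  simp [Matrix.trace, strain, divg]

end

/-! ### Geometry of the mesh and trace inequalities -/

namespace PolytopicMesh

variable {d : ℕ} {Ωe Ωp : Set (Pt d)} (M : PolytopicMesh d Ωe Ωp)

theorem mem_adj {F : M.Face} {κ : M.Cell} : κ ∈ M.adj F ↔ M.face F ⊆ frontier (M.cell κ) := by
  simp [adj]

theorem mem_cellsE {κ : M.Cell} : κ ∈ M.cellsE ↔ M.cell κ ⊆ Ωe := by simp [cellsE]

theorem mem_cellsP {κ : M.Cell} : κ ∈ M.cellsP ↔ M.cell κ ⊆ Ωp := by simp [cellsP]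

theorem isCompact_face (F : M.Face) : IsCompact (M.face F) :=
  (finite_range _).isCompact_convexHull ℝ

theorem finrank_vectorSpan_vertex (hd : 1 ≤ d) (F : M.Face) :
    Module.finrank ℝ (vectorSpan ℝ (range (M.vertex F))) = d - 1 :=
  (M.vertex_indep F).finrank_vectorSpan (by simp; omega)

theorem finrank_vectorSpan_vertex_orthogonal (hd : 1 ≤ d) (F : M.Face) :
    Module.finrank ℝ (vectorSpan ℝ (range (M.vertex F)))ᗮ = 1 := by
  have h1 := (vectorSpan ℝ (range (M.vertex F))).finrank_add_finrank_orthogonal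
  rw [M.finrank_vectorSpan_vertex hd, finrank_euclideanSpace_fin] at h1
  omega

theorem face_subset_affineSpan (F : M.Face) :
    M.face F ⊆ affineSpan ℝ (range (M.vertex F)) := convexHull_subset_affineSpan _

theorem sub_mem_vectorSpan (F : M.Face) (i : Fin d) {y : Pt d} (hy : y ∈ M.face F) :
    y - M.vertex F i ∈ vectorSpan ℝ (range (M.vertex F)) := by
  rw [← direction_affineSpan]
  exact AffineSubspace.vsub_mem_direction (M.face_subset_affineSpan F hy)
    (subset_affineSpan _ _ (mem_range_self i))

theorem volume_face (hd : 1 ≤ d) (F : M.Face) : volume (M.face F) = 0 := by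
  refine measure_mono_null (M.face_subset_affineSpan F)
    (Measure.addHaar_affineSubspace volume _ fun htop => ?_)
  have h1 := M.finrank_vectorSpan_vertex_orthogonal hd F
  rw [← direction_affineSpan, htop, AffineSubspace.direction_top, Submodule.top_orthogonal_eq_bot,
    finrank_bot] at h1
  exact zero_ne_one h1

/-- The boundary is a finite union of flat pieces. Integrals over an element and over its closure
therefore agree, which matters because the simplices of the regularity assumption lie only in the
closure. -/
theorem volume_frontier_cell (hd : 1 ≤ d) (κ : M.Cell) : volume (frontier (M.cell κ)) = 0 := by
  rw [M.frontier_cell κ]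
  exact (measure_biUnion_null_iff (to_countable _)).2 fun F _ => M.volume_face hd F

theorem h_pos (hd : 1 ≤ d) (κ : M.Cell) : 0 < M.h κ := by
  have : Nonempty (Fin d) := ⟨⟨0, hd⟩⟩
  obtain ⟨x, hx⟩ := (M.cell_connected κ).nonempty
  have hnt : (M.cell κ).Nontrivial := by
    exact (infinite_of_mem_nhds x ((M.cell_open κ).mem_nhds hx)).nontrivial
  obtain ⟨y, hy, z, hz, hyz⟩ := hnt
  exact (dist_pos.2 hyz).trans_le (Metric.dist_le_diam_of_mem (M.cell_bounded κ) hy hz)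

theorem cone_eq_image (hd : 1 ≤ d) (F : M.Face) (a : Pt d) :
    M.cone F a = (fun q : ℝ × Pt d => a + q.1 • (q.2 - a)) '' (Icc 0 1 ×ˢ M.face F) := by
  have : Nonempty (Fin d) := ⟨⟨0, hd⟩⟩
  rw [cone, convexHull_insert (range_nonempty _), convexJoin_singleton_left]
  ext x
  simp only [mem_iUnion, segment_eq_image', mem_image, mem_prod, Prod.exists, exists_prop]
  constructor
  · rintro ⟨y, hy, s, hs, rfl⟩
    exact ⟨s, y, ⟨hs, hy⟩, rfl⟩
  · rintro ⟨s, y, ⟨hs, hy⟩, rfl⟩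
    exact ⟨y, hy, s, hs, rfl⟩

theorem surface_face_ne_top (hd : 1 ≤ d) (F : M.Face) : surface d (M.face F) ≠ ⊤ := by
  set V := vectorSpan ℝ (range (M.vertex F))
  have hj : Isometry (fun z : V => (z : Pt d) + M.vertex F ⟨0, hd⟩) :=
    (isometry_add_right _).comp isometry_subtype_coe
  have h1 := hj.euclideanHausdorffMeasure_preimage (d := d - 1) (M.face F)
  have h2 : M.face F ∩ range (fun z : V => (z : Pt d) + M.vertex F ⟨0, hd⟩) = M.face F :=
    inter_eq_left.2 fun y hy => ⟨⟨y - M.vertex F ⟨0, hd⟩, M.sub_mem_vectorSpan F _ hy⟩, by simp⟩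
  have h3 := InnerProductSpace.euclideanHausdorffMeasure_eq_volume (V := V)
  rw [M.finrank_vectorSpan_vertex hd F] at h3
  rw [h2, h3] at h1
  rw [show surface d (M.face F) = _ from h1.symm]
  exact (hj.isClosedEmbedding.isCompact_preimage (M.isCompact_face F)).measure_ne_top

theorem integrableOn_face (hd : 1 ≤ d) (F : M.Face) {G : Type*} [NormedAddCommGroup G]
    {f : Pt d → G} (hf : Continuous f) : IntegrableOn f (M.face F) (surface d) :=
  hf.continuousOn.integrableOn_of_subset_isCompact (M.isCompact_face F)
    (M.isCompact_face F).measurableSet subset_rfl (M.surface_face_ne_top hd F)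

theorem integrableOn_cell (κ : M.Cell) {G : Type*} [NormedAddCommGroup G]
    {f : Pt d → G} (hf : Continuous f) : IntegrableOn f (M.cell κ) volume :=
  (hf.continuousOn.integrableOn_compact
    (M.cell_bounded κ).isCompact_closure).mono_set subset_closure

/-- The constant of the trace inequality on polytopic elements. -/
def traceConst (d : ℕ) (C : ℝ) : ℝ := 2 * (d + 2) ^ 2 * max C 1

theorem traceConst_pos (d : ℕ) (C : ℝ) : 0 < traceConst d C := by
  unfold traceConst; positivity

/-- Trace inequality on one face of an element. -/
theorem integral_face_sq_le (hd : 1 ≤ d) {C : ℝ} (κ : M.Cell) (F : M.Face) (a : Pt d)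
    (hreg : M.h κ ≤ C * (d * volume.real (M.cone F a) / (surface d).real (M.face F)))
    {k : ℕ} (hk : 1 ≤ k) {f : Pt d → ℝ} (hf : IsPolyFun k f) :
    ∫ x in M.face F, f x ^ 2 ∂surface d ≤
      traceConst d C * (k ^ 2 / M.h κ) * ∫ x in M.cone F a, f x ^ 2 := by
  have hh := M.h_pos hd κ
  set r := d * volume.real (M.cone F a) / (surface d).real (M.face F) with hr
  have hr0 : 0 ≤ r := by positivity
  -- A degenerate simplex would force `h_κ ≤ 0`.
  have hvol : volume (M.cone F a) ≠ 0 := by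
    intro h0
    rw [hr, measureReal_def, h0] at hreg
    simp at hreg
    linarith
  have h1 := integral_base_sq_le _ (M.finrank_vectorSpan_vertex_orthogonal hd F)
    (M.vertex F ⟨0, hd⟩) a (M.face F) (M.cone F a) (M.isCompact_face F)
    (fun y hy => M.sub_mem_vectorSpan F _ hy) (M.cone_eq_image hd F a) hvol k f hf.continuous
    (fun y => hf.exists_polynomial_line a (y - a))
  have hcast : ((d - 1 : ℕ) : ℝ) + 1 = d := by
    rw [Nat.cast_sub hd]; simp
  rw [M.finrank_vectorSpan_vertex hd F, add_assoc (2 * (k : ℝ)), hcast] at h1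
  set A := ∫ x in M.face F, f x ^ 2 ∂surface d with hA
  set B := ∫ x in M.cone F a, f x ^ 2
  have hA0 : 0 ≤ A := integral_nonneg fun x => sq_nonneg _
  have hB0 : 0 ≤ B := integral_nonneg fun x => sq_nonneg _
  have h2 : r * A ≤ 2 * (2 * k + d) ^ 2 * B := h1
  have hk' : (1 : ℝ) ≤ k := by exact_mod_cast hk
  -- Since `k ≥ 1`, `2k + d ≤ (d + 2) k`: this is the factor `(d + 2)²` of `traceConst`.
  have h3 : (2 * (k : ℝ) + d) ^ 2 ≤ (d + 2) ^ 2 * k ^ 2 := by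
    rw [← mul_pow]
    gcongr
    nlinarith [Nat.cast_nonneg (α := ℝ) d]
  -- Using `max C 1` keeps `traceConst` positive for every real `C`.
  have h4 : M.h κ * A ≤ max C 1 * (2 * ((d + 2) ^ 2 * k ^ 2) * B) := by
    calc M.h κ * A ≤ (max C 1 * r) * A := by
          gcongr
          exact hreg.trans (by gcongr; exact le_max_left _ _)
      _ = max C 1 * (r * A) := by ring
      _ ≤ max C 1 * (2 * (2 * k + d) ^ 2 * B) := by gcongr
      _ ≤ _ := by gcongr
  rw [traceConst]
  have : A = M.h κ * A / M.h κ := by field_simp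
  rw [this, div_le_iff₀ hh]
  refine h4.trans (le_of_eq ?_)
  field_simp

/-- Trace inequality on all faces of an element. -/
theorem sum_integral_face_sq_le (hd : 1 ≤ d) {C : ℝ} (hreg : M.PolytopicRegular C) (κ : M.Cell)
    (s : Finset M.Face) (hs : ∀ F ∈ s, κ ∈ M.adj F) {k : ℕ} (hk : 1 ≤ k) {f : Pt d → ℝ}
    (hf : IsPolyFun k f) :
    ∑ F ∈ s, ∫ x in M.face F, f x ^ 2 ∂surface d ≤
      traceConst d C * (k ^ 2 / M.h κ) * ∫ x in M.cell κ, f x ^ 2 := by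
  obtain ⟨apex, h1, h2⟩ := hreg κ
  have hcont : Continuous fun x => f x ^ 2 := hf.continuous.pow 2
  have hclos : IntegrableOn (fun x => f x ^ 2) (closure (M.cell κ)) volume :=
    hcont.continuousOn.integrableOn_compact (M.cell_bounded κ).isCompact_closure
  have hcell : ∫ x in M.cell κ, f x ^ 2 = ∫ x in closure (M.cell κ), f x ^ 2 := by
    rw [closure_eq_self_union_frontier]
    exact (setIntegral_congr_set (union_ae_eq_left_of_ae_eq_empty
      (ae_eq_empty.2 (M.volume_frontier_cell hd κ)))).symm
  have hint : ∀ F ∈ s, ∫ x in M.cone F (apex F), f x ^ 2 =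
      ∫ x in interior (M.cone F (apex F)), f x ^ 2 := by
    intro F _
    exact setIntegral_congr_set (interior_ae_eq_of_null_frontier
      ((convex_convexHull ℝ _).addHaar_frontier volume)).symm
  -- Convex sets have null boundaries, and the interiors of the simplices are disjoint parts of the
  -- closed element. Their integrals therefore add up to at most one integral over the element,
  -- however many faces it has.
  have hsum : ∑ F ∈ s, ∫ x in M.cone F (apex F), f x ^ 2 ≤ ∫ x in M.cell κ, f x ^ 2 := by
    rw [Finset.sum_congr rfl hint, hcell, ← integral_biUnion_finset s
      (fun F _ => isOpen_interior.measurableSet)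
      (fun F hF F' hF' hne => h2 F F' (hs F hF) (hs F' hF') hne)]
    · refine setIntegral_mono_set hclos (Filter.Eventually.of_forall fun x => sq_nonneg _)
        (LE.le.eventuallyLE ?_)
      exact iUnion₂_subset fun F hF => interior_subset.trans (h1 F (hs F hF)).1
    · intro F hF
      exact hclos.mono_set (interior_subset.trans (h1 F (hs F hF)).1)
  calc ∑ F ∈ s, ∫ x in M.face F, f x ^ 2 ∂surface d
      ≤ ∑ F ∈ s, traceConst d C * (k ^ 2 / M.h κ) * ∫ x in M.cone F (apex F), f x ^ 2 :=
        Finset.sum_le_sum fun F hF =>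
          M.integral_face_sq_le hd κ F (apex F) (h1 F (hs F hF)).2 hk hf
    _ = traceConst d C * (k ^ 2 / M.h κ) * ∑ F ∈ s, ∫ x in M.cone F (apex F), f x ^ 2 := by
        rw [Finset.mul_sum]
    _ ≤ _ := by
        have := M.h_pos hd κ
        have := traceConst_pos d C
        gcongr

end PolytopicMesh

/-! ### Pointwise inequalities for tensors -/

section Tensors

variable {d : ℕ}

theorem ddot_comm (σ τ : Matrix (Fin d) (Fin d) ℝ) : ddot σ τ = ddot τ σ := by
  simp [ddot, mul_comm]

theorem ddot_self_nonneg (σ : Matrix (Fin d) (Fin d) ℝ) : 0 ≤ ddot σ σ :=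
  Finset.sum_nonneg fun _ _ => Finset.sum_nonneg fun _ _ => mul_self_nonneg _

theorem trace_sq_le (τ : Matrix (Fin d) (Fin d) ℝ) : τ.trace ^ 2 ≤ d * ddot τ τ := by
  have h3 : τ.trace ^ 2 ≤ d * ∑ i, (τ i i) ^ 2 := by
    have := sq_sum_le_card_mul_sum_sq (s := (Finset.univ : Finset (Fin d))) (f := fun i => τ i i)
    simpa [Matrix.trace] using this
  refine h3.trans (mul_le_mul_of_nonneg_left ?_ (Nat.cast_nonneg d))
  refine Finset.sum_le_sum fun i _ => ?_
  have := Finset.single_le_sum (f := fun j => τ i j * τ i j)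
    (fun j _ => mul_self_nonneg _) (Finset.mem_univ i)
  simpa [sq] using this

theorem ddot_elast_left (lam mu : ℝ) (σ τ : Matrix (Fin d) (Fin d) ℝ) :
    ddot (elast lam mu σ) τ = 2 * mu * ddot σ τ + lam * σ.trace * τ.trace := by
  have h1 : ∀ i j : Fin d, elast lam mu σ i j * τ i j =
      2 * mu * (σ i j * τ i j) + lam * σ.trace * (if i = j then τ i j else 0) := by
    intro i j
    by_cases hij : i = j
    · subst hij
      simp [elast]
      ring
    · simp [elast, hij]
      ring
  simp only [ddot, h1, Finset.sum_add_distrib, ← Finset.mul_sum, Finset.sum_ite_eq,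
    Finset.mem_univ, if_true]
  simp only [Matrix.trace, Matrix.diag]

theorem trace_elast (lam mu : ℝ) (σ : Matrix (Fin d) (Fin d) ℝ) :
    (elast lam mu σ).trace = (2 * mu + d * lam) * σ.trace := by
  simp [elast, Matrix.trace_add, Matrix.trace_smul, Matrix.trace_one]
  ring

/-- `|ℂ : τ|² ≤ |ℂ^{1/2}|² |ℂ^{1/2} : τ|²`. -/
theorem ddot_elast_self_le {lam mu : ℝ} (hl : 0 ≤ lam) (hm : 0 ≤ mu)
    (τ : Matrix (Fin d) (Fin d) ℝ) :
    ddot (elast lam mu τ) (elast lam mu τ) ≤ elastNormSq d lam mu * ddot (elast lam mu τ) τ := by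
  rw [ddot_elast_left, ddot_comm τ, ddot_elast_left, trace_elast, elastNormSq]
  have h := mul_le_mul_of_nonneg_left (trace_sq_le τ) (mul_nonneg hl hm)
  nlinarith

theorem ddot_elast_self_nonneg {lam mu : ℝ} (hl : 0 ≤ lam) (hm : 0 ≤ mu)
    (τ : Matrix (Fin d) (Fin d) ℝ) : 0 ≤ ddot (elast lam mu τ) τ := by
  rw [ddot_elast_left, mul_assoc lam]
  have := ddot_self_nonneg τ
  have := mul_self_nonneg τ.trace
  positivity

/-- The difference of the two sides is `2/a (s - a j / 2)²`. With `a` a penalty weight, only half of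
the penalty term is spent and the other half is left for coercivity. -/
theorem young_real {a : ℝ} (ha : 0 < a) (s j : ℝ) :
    2 * (s * j) ≤ 1 / 2 * (a * (j * j)) + 2 / a * (s * s) := by
  have h : 1 / 2 * (a * (j * j)) + 2 / a * (s * s) - 2 * (s * j) =
      2 / a * (s - a * j / 2) ^ 2 := by
    field_simp
    ring
  have : 0 ≤ 2 / a * (s - a * j / 2) ^ 2 := by positivity
  linarith

theorem abs_le_of_le_of_even {A B : ℝ} (h₁ : 2 * A ≤ B) (h₂ : 2 * (-A) ≤ B) : 2 * |A| ≤ B := by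
  rcases abs_cases A with h | h <;> rw [h.1] <;> assumption

theorem young_mul {a : ℝ} (ha : 0 < a) (s j : ℝ) :
    2 * |s * j| ≤ 1 / 2 * (a * (j * j)) + 2 / a * (s * s) := by
  refine abs_le_of_le_of_even (young_real ha s j) ?_
  simpa using young_real ha (-s) j

theorem young_ddot {a : ℝ} (ha : 0 < a) (s j : Matrix (Fin d) (Fin d) ℝ) :
    2 * |ddot s j| ≤ 1 / 2 * (a * ddot j j) + 2 / a * ddot s s := by
  have key : ∀ s : Matrix (Fin d) (Fin d) ℝ,
      2 * ddot s j ≤ 1 / 2 * (a * ddot j j) + 2 / a * ddot s s := by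
    intro s
    simp only [ddot, Finset.mul_sum, ← Finset.sum_add_distrib]
    exact Finset.sum_le_sum fun i _ => Finset.sum_le_sum fun k _ => young_real ha _ _
  refine abs_le_of_le_of_even (key s) ?_
  have := key (-s)
  simpa [ddot] using this

theorem young_inner {E : Type*} [NormedAddCommGroup E] [InnerProductSpace ℝ E] {a : ℝ}
    (ha : 0 < a) (s j : E) :
    2 * |inner ℝ s j| ≤ 1 / 2 * (a * ‖j‖ ^ 2) + 2 / a * ‖s‖ ^ 2 := by
  have h1 := abs_real_inner_le_norm s j
  have h2 := young_real ha ‖s‖ ‖j‖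
  rw [← sq, ← sq] at h2
  linarith

theorem norm_traction_sq_le (σ : Matrix (Fin d) (Fin d) ℝ) (n : Pt d) :
    ‖traction σ n‖ ^ 2 ≤ ddot σ σ * ‖n‖ ^ 2 := by
  rw [EuclideanSpace.norm_sq_eq, EuclideanSpace.norm_sq_eq, ddot, Finset.sum_mul]
  refine Finset.sum_le_sum fun i _ => ?_
  have := Finset.sum_mul_sq_le_sq_mul_sq Finset.univ (fun j => σ i j) (fun j => n j)
  simpa [traction, Matrix.mulVec, dotProduct, sq] using this

/-- Cauchy–Schwarz, after which a factor `1 / card ≤ 1` is given away. Averages on interior and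
boundary faces are thereby treated alike. -/
theorem sq_inv_card_mul_sum_le {ι : Type*} (s : Finset ι) (f : ι → ℝ) :
    ((s.card : ℝ)⁻¹ * ∑ i ∈ s, f i) ^ 2 ≤ ∑ i ∈ s, f i ^ 2 := by
  rcases s.eq_empty_or_nonempty with rfl | hs
  · simp
  have hc : (1 : ℝ) ≤ s.card := by exact_mod_cast hs.card_pos
  have h1 := sq_sum_le_card_mul_sum_sq (s := s) (f := f)
  have h2 : 0 ≤ ∑ i ∈ s, f i ^ 2 := Finset.sum_nonneg fun _ _ => sq_nonneg _
  rw [mul_pow, inv_pow, inv_mul_le_iff₀ (by positivity)]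
  refine h1.trans (mul_le_mul_of_nonneg_right ?_ h2)
  nlinarith

end Tensors

theorem le_maxOver {ι : Type} {s : Finset ι} {f : ι → ℝ} {i : ι} (hi : i ∈ s) :
    f i ≤ maxOver s f := by
  unfold maxOver
  rw [dif_pos ⟨i, hi⟩]
  exact Finset.le_sup' f hi

/-! ### Faces and neighbouring elements -/

namespace PolytopicMesh

variable {d : ℕ} {Ωe Ωp : Set (Pt d)} (M : PolytopicMesh d Ωe Ωp)

theorem mem_adjE {F : M.Face} {κ : M.Cell} : κ ∈ M.adjE F ↔ κ ∈ M.adj F ∧ κ ∈ M.cellsE := by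
  simp [adjE]

theorem mem_adjP {F : M.Face} {κ : M.Cell} : κ ∈ M.adjP F ↔ κ ∈ M.adj F ∧ κ ∈ M.cellsP := by
  simp [adjP]

theorem adj_eq_adjE {F : M.Face} (hF : F ∈ M.facesE) : M.adj F = M.adjE F := by
  ext κ
  rw [mem_adjE, iff_self_and]
  intro hκ
  simp only [facesE, Finset.mem_filter, Finset.not_nonempty_iff_eq_empty] at hF
  rcases M.cell_subset κ with h | h
  · exact M.mem_cellsE.2 h
  · have : κ ∈ M.adjP F := M.mem_adjP.2 ⟨hκ, M.mem_cellsP.2 h⟩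
    rw [hF.2.2] at this
    simp at this

theorem adj_eq_adjP {F : M.Face} (hF : F ∈ M.facesP) : M.adj F = M.adjP F := by
  ext κ
  rw [mem_adjP, iff_self_and]
  intro hκ
  simp only [facesP, Finset.mem_filter, Finset.not_nonempty_iff_eq_empty] at hF
  rcases M.cell_subset κ with h | h
  · have : κ ∈ M.adjE F := M.mem_adjE.2 ⟨hκ, M.mem_cellsE.2 h⟩
    rw [hF.2.1] at this
    simp at this
  · exact M.mem_cellsP.2 h

theorem disjoint_cellsE_cellsP (hdisj : Disjoint Ωe Ωp) : Disjoint M.cellsE M.cellsP := by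
  refine Finset.disjoint_left.2 fun κ h1 h2 => ?_
  obtain ⟨x, hx⟩ := (M.cell_connected κ).nonempty
  exact Set.disjoint_left.1 hdisj (M.mem_cellsE.1 h1 hx) (M.mem_cellsP.1 h2 hx)

/-- A face has at most two elements, and no element is both elastic and poroelastic because the
regions are disjoint. Hence interface traces are single terms and `nP` is a unit vector. -/
theorem exists_adjE_adjP_eq_singleton (hdisj : Disjoint Ωe Ωp) {F : M.Face} (hF : F ∈ M.facesI) :
    (∃ κ, M.adjE F = {κ}) ∧ ∃ κ, M.adjP F = {κ} := by
  classical
  simp only [facesI, Finset.mem_filter] at hF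
  have h1 : Disjoint (M.adjE F) (M.adjP F) := by
    refine Finset.disjoint_left.2 fun κ h1 h2 => ?_
    exact Finset.disjoint_left.1 (M.disjoint_cellsE_cellsP hdisj) (M.mem_adjE.1 h1).2
      (M.mem_adjP.1 h2).2
  have h2 : (M.adjE F ∪ M.adjP F).card ≤ 2 := by
    refine (Finset.card_le_card (t := M.adj F) ?_).trans ?_
    · intro κ hκ
      rcases Finset.mem_union.1 hκ with h | h
      · exact (M.mem_adjE.1 h).1
      · exact (M.mem_adjP.1 h).1
    · have h3 : {κ | convexHull ℝ (range (M.vertex F)) ⊆ frontier (M.cell κ)} =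
          (M.adj F : Set M.Cell) := by
        ext κ; exact M.mem_adj.symm
      have h4 := M.face_cells F
      rw [h3, Set.ncard_coe_finset] at h4
      omega
  rw [Finset.card_union_of_disjoint h1] at h2
  have h3 := hF.2.1.card_pos
  have h4 := hF.2.2.card_pos
  exact ⟨Finset.card_eq_one.1 (by omega), Finset.card_eq_one.1 (by omega)⟩

/-- Exchange of summation over pairs of a face and an elastic element having it. Interface faces and
other faces share one trace inequality per element, so that the coupling does not raise the penalty
threshold. -/
theorem sum_faces_le_sum_cellsE (G : M.Face → M.Cell → ℝ)
    (hG : ∀ F κ, κ ∈ M.adjE F → 0 ≤ G F κ) :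
    (∑ F ∈ M.facesE, ∑ κ ∈ M.adj F, G F κ) + ∑ F ∈ M.facesI, ∑ κ ∈ M.adjE F, G F κ ≤
      open Classical in
      ∑ κ ∈ M.cellsE, ∑ F ∈ Finset.univ.filter (fun F => κ ∈ M.adj F), G F κ := by
  classical
  have h1 : Disjoint M.facesE M.facesI := by
    refine Finset.disjoint_left.2 fun F h1 h2 => ?_
    simp only [facesE, facesI, Finset.mem_filter] at h1 h2
    exact h1.2.2 h2.2.2
  rw [Finset.sum_congr rfl fun F hF => by rw [M.adj_eq_adjE hF], ← Finset.sum_union h1]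
  have h2 : ∑ F, ∑ κ ∈ M.adjE F, G F κ =
      ∑ κ ∈ M.cellsE, ∑ F ∈ Finset.univ.filter (fun F => κ ∈ M.adj F), G F κ := by
    refine Finset.sum_comm' fun F κ => ?_
    simp [M.mem_adjE]
  rw [← h2]
  exact Finset.sum_le_sum_of_subset_of_nonneg (Finset.subset_univ _) fun F _ _ =>
    Finset.sum_nonneg fun κ hκ => hG F κ hκ

theorem sum_faces_le_sum_cellsP (G : M.Face → M.Cell → ℝ)
    (hG : ∀ F κ, κ ∈ M.adjP F → 0 ≤ G F κ) :
    (∑ F ∈ M.facesP, ∑ κ ∈ M.adj F, G F κ) + ∑ F ∈ M.facesI, ∑ κ ∈ M.adjP F, G F κ ≤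
      open Classical in
      ∑ κ ∈ M.cellsP, ∑ F ∈ Finset.univ.filter (fun F => κ ∈ M.adj F), G F κ := by
  classical
  have h1 : Disjoint M.facesP M.facesI := by
    refine Finset.disjoint_left.2 fun F h1 h2 => ?_
    simp only [facesP, facesI, Finset.mem_filter] at h1 h2
    exact h1.2.1 h2.2.1
  rw [Finset.sum_congr rfl fun F hF => by rw [M.adj_eq_adjP hF], ← Finset.sum_union h1]
  have h2 : ∑ F, ∑ κ ∈ M.adjP F, G F κ =
      ∑ κ ∈ M.cellsP, ∑ F ∈ Finset.univ.filter (fun F => κ ∈ M.adj F), G F κ := by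
    refine Finset.sum_comm' fun F κ => ?_
    simp [M.mem_adjP]
  rw [← h2]
  exact Finset.sum_le_sum_of_subset_of_nonneg (Finset.subset_univ _) fun F _ _ =>
    Finset.sum_nonneg fun κ hκ => hG F κ hκ

/-- Trace inequality for weighted sums of squares of polynomials. -/
theorem sum_integral_face_sum_sq_le (hd : 1 ≤ d) {C : ℝ} (hreg : M.PolytopicRegular C) (κ : M.Cell)
    (s : Finset M.Face) (hs : ∀ F ∈ s, κ ∈ M.adj F) {k : ℕ} (hk : 1 ≤ k) {ι : Type*} [Fintype ι]
    (w : ι → ℝ) (hw : ∀ i, 0 ≤ w i) (f : ι → Pt d → ℝ) (hf : ∀ i, IsPolyFun k (f i)) :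
    ∑ F ∈ s, ∫ x in M.face F, ∑ i, w i * f i x ^ 2 ∂surface d ≤
      traceConst d C * (k ^ 2 / M.h κ) * ∫ x in M.cell κ, ∑ i, w i * f i x ^ 2 := by
  have hc : ∀ i, Continuous fun x => w i * f i x ^ 2 := fun i =>
    continuous_const.mul ((hf i).continuous.pow 2)
  rw [integral_finsetSum _ fun i _ => M.integrableOn_cell κ (hc i), Finset.mul_sum,
    Finset.sum_congr rfl fun F _ => integral_finsetSum _ fun i _ => M.integrableOn_face hd F (hc i),
    Finset.sum_comm]
  refine Finset.sum_le_sum fun i _ => ?_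
  simp only [integral_const_mul, ← Finset.mul_sum]
  rw [mul_left_comm]
  exact mul_le_mul_of_nonneg_left (M.sum_integral_face_sq_le hd hreg κ s hs hk (hf i)) (hw i)

end PolytopicMesh

/-! ### Bounds for the face terms -/

section FaceTerms

variable {d : ℕ} {Ωe Ωp : Set (Pt d)} {M : PolytopicMesh d Ωe Ωp}

/-- A broken field that is polynomial on every element. -/
def IsBrokenPoly (deg : M.Cell → ℕ) (v : Broken M) : Prop := ∀ κ, IsPolyField (deg κ) (v κ)

theorem IsPiecewisePoly.isBrokenPoly {deg : M.Cell → ℕ} {R : Finset M.Cell} {v : Broken M}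
    (hv : IsPiecewisePoly M deg R v) : IsBrokenPoly deg v := by
  intro κ
  by_cases hκ : κ ∈ R
  · exact hv.1 κ hκ
  · rw [hv.2 κ hκ]
    exact IsPolyField.zero

theorem IsBrokenPoly.flux {deg : M.Cell → ℕ} (c : Material M) {U : Triple M}
    (hp : IsBrokenPoly deg U.p) (hf : IsBrokenPoly deg U.f) : IsBrokenPoly deg (flux c U) :=
  fun κ => ((hp κ).smul _).add (hf κ)

theorem IsBrokenPoly.fluxI {deg : M.Cell → ℕ} (c : Material M) {U : Triple M}
    (hp : IsBrokenPoly deg U.p) (hf : IsBrokenPoly deg U.f) : IsBrokenPoly deg (fluxI c U) :=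
  fun κ => ((hp κ).smul _).add (hf κ)

variable {c : Material M} {deg : M.Cell → ℕ} {u v : Broken M} {U V : Triple M}

theorem continuous_ddot {X : Type*} [TopologicalSpace X] {σ τ : X → Matrix (Fin d) (Fin d) ℝ}
    (hσ : Continuous σ) (hτ : Continuous τ) : Continuous fun x => ddot (σ x) (τ x) :=
  continuous_finsetSum _ fun i _ => continuous_finsetSum _ fun j _ =>
    (hσ.matrix_elem i j).mul (hτ.matrix_elem i j)

theorem continuous_strain (hu : IsBrokenPoly deg u) (κ : M.Cell) :
    Continuous fun x => strain (u κ) x :=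
  continuous_matrix fun i j => ((hu κ).strain_isPolyFun i j).continuous

theorem continuous_divg (hu : IsBrokenPoly deg u) (κ : M.Cell) : Continuous fun x => divg (u κ) x :=
  (hu κ).divg_isPolyFun.continuous

theorem continuous_stress (hu : IsBrokenPoly deg u) (κ : M.Cell) :
    Continuous fun x => stress c u κ x := by
  have h := continuous_strain hu κ
  have h2 : Continuous fun x => (strain (u κ) x).trace := h.matrix_trace
  unfold stress elast
  exact (h.const_smul (2 * c.mu κ)).add ((continuous_const.mul h2).smul continuous_const)

theorem continuous_jump (hu : IsBrokenPoly deg u) (F : M.Face) : Continuous fun x => jump u F x := by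
  unfold jump
  refine continuous_finsetSum _ fun κ _ => continuous_matrix fun i j => ?_
  have := (hu κ).continuous
  simp only [Matrix.vecMulVec_apply]
  fun_prop

theorem continuous_jumpN (hu : IsBrokenPoly deg u) (F : M.Face) :
    Continuous fun x => jumpN u F x := by
  unfold jumpN
  refine continuous_finsetSum _ fun κ _ => ?_
  have := (hu κ).continuous
  fun_prop

theorem continuous_avg {α : Type} [AddCommMonoid α] [Module ℝ α] [TopologicalSpace α]
    [ContinuousAdd α] [ContinuousConstSMul ℝ α] {w : M.Cell → Pt d → α}
    (hw : ∀ κ, Continuous (w κ)) (F : M.Face) : Continuous fun x => avg (fun κ => w κ x) F :=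
  (continuous_finsetSum _ fun κ _ => hw κ).const_smul _

theorem continuous_trP {α : Type} [AddCommMonoid α] [TopologicalSpace α]
    [ContinuousAdd α] {w : M.Cell → Pt d → α}
    (hw : ∀ κ, Continuous (w κ)) (F : M.Face) : Continuous fun x => trP (fun κ => w κ x) F :=
  continuous_finsetSum _ fun κ _ => hw κ

theorem continuous_trE {α : Type} [AddCommMonoid α] [TopologicalSpace α]
    [ContinuousAdd α] {w : M.Cell → Pt d → α}
    (hw : ∀ κ, Continuous (w κ)) (F : M.Face) : Continuous fun x => trE (fun κ => w κ x) F :=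
  continuous_finsetSum _ fun κ _ => hw κ

theorem continuous_jumpI (he : IsBrokenPoly deg U.e) (hp : IsBrokenPoly deg U.p) (F : M.Face) :
    Continuous fun x => jumpI U F x :=
  (continuous_trP (fun κ => (hp κ).continuous) F).sub
    (continuous_trE (fun κ => (he κ).continuous) F)

theorem continuous_filtI (hp : IsBrokenPoly deg U.p) (hf : IsBrokenPoly deg U.f) (F : M.Face) :
    Continuous fun x => filtI c U F x :=
  (continuous_trP (fun κ => (IsBrokenPoly.fluxI c hp hf κ).continuous) F).inner continuous_const

theorem continuous_tractionI (he : IsBrokenPoly deg U.e) (F : M.Face) :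
    Continuous fun x => tractionI c U F x := by
  have h := continuous_trE (fun κ => continuous_stress (c := c) he κ) F
  unfold tractionI traction
  exact (PiLp.continuous_toLp 2 _).comp (h.matrix_mulVec continuous_const)

theorem continuous_pressI (hp : IsBrokenPoly deg U.p) (hf : IsBrokenPoly deg U.f) (F : M.Face) :
    Continuous fun x => pressI c U F x :=
  continuous_trP (fun κ => continuous_const.mul (continuous_divg (IsBrokenPoly.flux c hp hf) κ)) F

/-- Trace inequality for the elastic energy density. -/
theorem sum_integral_face_energy_le (hd : 1 ≤ d) {C : ℝ} (hreg : M.PolytopicRegular C)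
    (hdeg : ∀ κ, 1 ≤ deg κ) (hl : ∀ κ, 0 ≤ c.lam κ) (hm : ∀ κ, 0 ≤ c.mu κ)
    (hu : IsBrokenPoly deg u) (κ : M.Cell) (s : Finset M.Face) (hs : ∀ F ∈ s, κ ∈ M.adj F) :
    ∑ F ∈ s, ∫ x in M.face F, ddot (stress c u κ x) (strain (u κ) x) ∂surface d ≤
      PolytopicMesh.traceConst d C * (deg κ ^ 2 / M.h κ) *
        ∫ x in M.cell κ, ddot (stress c u κ x) (strain (u κ) x) := by
  have key : ∀ x, ddot (stress c u κ x) (strain (u κ) x) =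
      ∑ i : Option (Fin d × Fin d), (i.elim (c.lam κ) fun _ => 2 * c.mu κ) *
        (i.elim (divg (u κ) x) fun q => strain (u κ) x q.1 q.2) ^ 2 := by
    intro x
    rw [stress, ddot_elast_left, trace_strain, Fintype.sum_option, ddot]
    simp only [Option.elim, Fintype.sum_prod_type, Finset.mul_sum]
    rw [add_comm]
    congr 1
    · ring
    · exact Finset.sum_congr rfl fun i _ => Finset.sum_congr rfl fun j _ => by ring
  simp only [key]
  refine M.sum_integral_face_sum_sq_le hd hreg κ s hs (hdeg κ) _ ?_
    (fun (i : Option (Fin d × Fin d)) x => i.elim (divg (u κ) x) fun q => strain (u κ) x q.1 q.2) ?_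
  · rintro (_ | q)
    · exact hl κ
    · exact mul_nonneg zero_le_two (hm κ)
  · rintro (_ | q)
    · exact (hu κ).divg_isPolyFun
    · exact (hu κ).strain_isPolyFun q.1 q.2

/-- Trace inequality for the divergence. -/
theorem sum_integral_face_divg_le (hd : 1 ≤ d) {C : ℝ} (hreg : M.PolytopicRegular C)
    (hdeg : ∀ κ, 1 ≤ deg κ) (hu : IsBrokenPoly deg u) (κ : M.Cell) (hm : 0 ≤ c.m κ)
    (s : Finset M.Face) (hs : ∀ F ∈ s, κ ∈ M.adj F) :
    ∑ F ∈ s, ∫ x in M.face F, c.m κ * divg (u κ) x ^ 2 ∂surface d ≤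
      PolytopicMesh.traceConst d C * (deg κ ^ 2 / M.h κ) *
        ∫ x in M.cell κ, c.m κ * divg (u κ) x ^ 2 := by
  have := M.sum_integral_face_sum_sq_le hd hreg κ s hs (hdeg κ) (fun _ : Unit => c.m κ)
    (fun _ => hm) (fun _ => divg (u κ)) (fun _ => (hu κ).divg_isPolyFun)
  simpa using this

/-- Integrates a pointwise Young inequality over a face; `A` stands for the penalty density and `e
κ` for the energy density of a neighbouring element. -/
theorem two_abs_integral_face_le (hd : 1 ≤ d) (F : M.Face) {f A : Pt d → ℝ} (s : Finset M.Cell)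
    (w : M.Cell → ℝ) (e : M.Cell → Pt d → ℝ) (hf : Continuous f) (hA : Continuous A)
    (he : ∀ κ, Continuous (e κ)) (h : ∀ x, 2 * |f x| ≤ 1 / 2 * A x + ∑ κ ∈ s, w κ * e κ x) :
    2 * |∫ x in M.face F, f x ∂surface d| ≤
      1 / 2 * (∫ x in M.face F, A x ∂surface d) +
        ∑ κ ∈ s, w κ * ∫ x in M.face F, e κ x ∂surface d := by
  have hc : ∀ κ ∈ s, Continuous fun x => w κ * e κ x := fun κ _ => continuous_const.mul (he κ)
  calc 2 * |∫ x in M.face F, f x ∂surface d| ≤ 2 * ∫ x in M.face F, |f x| ∂surface d := by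
        gcongr; exact abs_integral_le_integral_abs
    _ = ∫ x in M.face F, 2 * |f x| ∂surface d := (integral_const_mul _ _).symm
    _ ≤ ∫ x in M.face F, (1 / 2 * A x + ∑ κ ∈ s, w κ * e κ x) ∂surface d := by
        refine integral_mono (M.integrableOn_face hd F (by fun_prop)) (M.integrableOn_face hd F ?_) h
        exact (continuous_const.mul hA).add (continuous_finsetSum _ hc)
    _ = _ := by
        rw [integral_add (M.integrableOn_face hd F (by fun_prop))
          (M.integrableOn_face hd F (continuous_finsetSum _ hc)),
          integral_finsetSum _ fun κ hκ => M.integrableOn_face hd F (hc κ hκ)]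
        simp only [integral_const_mul]

variable {c₁ c₂ : ℝ}

theorem elastNormSq_pos {lam mu : ℝ} (hl : 0 ≤ lam) (hm : 0 < mu) : 0 < elastNormSq d lam mu := by
  unfold elastNormSq; positivity

/-- The maximum in the penalty makes it dominate the weight of each neighbouring element separately.
-/
theorem le_alpha (hc₁ : 0 < c₁) {F : M.Face} {κ : M.Cell} (hκ : κ ∈ M.adj F) :
    c₁ * (elastNormSq d (c.lam κ) (c.mu κ) * (deg κ : ℝ) ^ 2 / M.h κ) ≤ alpha c deg c₁ F :=
  mul_le_mul_of_nonneg_left (le_maxOver (f := fun κ =>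
    elastNormSq d (c.lam κ) (c.mu κ) * (deg κ : ℝ) ^ 2 / M.h κ) hκ) hc₁.le

theorem le_gamma (hc₂ : 0 < c₂) {F : M.Face} {κ : M.Cell} (hκ : κ ∈ M.adjP F) :
    c₂ * (c.m κ * (deg κ : ℝ) ^ 2 / M.h κ) ≤ gamma c deg c₂ F :=
  mul_le_mul_of_nonneg_left (le_maxOver (f := fun κ =>
    c.m κ * (deg κ : ℝ) ^ 2 / M.h κ) hκ) hc₂.le

/-- The material coefficient `b` contained in the penalty cancels against the one in front of the
trace. What is left, `h / k²`, is the inverse of the factor in the trace inequality, so the penalty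
thresholds do not depend on `K`. -/
theorem two_div_mul_le {a b c k h e : ℝ} (hc : 0 < c) (hb : 0 < b) (hk : 0 < k) (hh : 0 < h)
    (he : 0 ≤ e) (ha : c * (b * k ^ 2 / h) ≤ a) : 2 / a * (b * e) ≤ 2 / c * (h / k ^ 2) * e := by
  have h1 : 0 < c * (b * k ^ 2 / h) := by positivity
  calc 2 / a * (b * e) ≤ 2 / (c * (b * k ^ 2 / h)) * (b * e) := by gcongr
    _ = _ := by field_simp

theorem ddot_avg_self_le (σ : M.Cell → Matrix (Fin d) (Fin d) ℝ) (F : M.Face) :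
    ddot (avg σ F) (avg σ F) ≤ ∑ κ ∈ M.adj F, ddot (σ κ) (σ κ) := by
  have h : ∀ i j, avg σ F i j = ((M.adj F).card : ℝ)⁻¹ * ∑ κ ∈ M.adj F, σ κ i j := by
    intro i j
    simp [avg, Matrix.sum_apply]
  simp only [ddot, h]
  rw [Finset.sum_comm]
  simp only [Finset.sum_comm (s := M.adj F)]
  rw [Finset.sum_comm]
  refine Finset.sum_le_sum fun i _ => Finset.sum_le_sum fun j _ => ?_
  have := sq_inv_card_mul_sum_le (M.adj F) (fun κ => σ κ i j)
  simpa [sq] using this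

/-- Young's inequality weighted by the penalty, then `ddot_elast_self_le` to pass from the squared
stress to the energy density, then `two_div_mul_le` on each neighbour. The other three estimates of
cross terms follow this pattern. -/
theorem two_abs_integral_stress_jump_le (hd : 1 ≤ d) (hdeg : ∀ κ, 1 ≤ deg κ)
    (hl : ∀ κ, 0 ≤ c.lam κ) (hm : ∀ κ, 0 < c.mu κ) (hc₁ : 0 < c₁) (hu : IsBrokenPoly deg u)
    {F : M.Face} (hF : (M.adj F).Nonempty) :
    2 * |∫ x in M.face F, ddot (avg (fun κ => stress c u κ x) F) (jump u F x) ∂surface d| ≤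
      1 / 2 * (∫ x in M.face F, alpha c deg c₁ F * ddot (jump u F x) (jump u F x) ∂surface d) +
      ∑ κ ∈ M.adj F, 2 / c₁ * (M.h κ / deg κ ^ 2) *
        ∫ x in M.face F, ddot (stress c u κ x) (strain (u κ) x) ∂surface d := by
  have hj := continuous_jump hu F
  have hs := fun κ => continuous_stress (c := c) hu κ
  have hk : ∀ κ, (0 : ℝ) < deg κ := fun κ => by exact_mod_cast hdeg κ
  refine two_abs_integral_face_le hd F _ _ (fun κ x => ddot (stress c u κ x) (strain (u κ) x))
    (continuous_ddot (continuous_avg hs F) hj)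
    (continuous_const.mul (continuous_ddot hj hj))
    (fun κ => continuous_ddot (hs κ) (continuous_strain hu κ)) fun x => ?_
  have hα : 0 < alpha c deg c₁ F := by
    obtain ⟨κ, hκ⟩ := hF
    refine lt_of_lt_of_le ?_ (le_alpha hc₁ hκ)
    have := M.h_pos hd κ
    have := elastNormSq_pos (d := d) (hl κ) (hm κ)
    have := hk κ
    positivity
  refine (young_ddot hα _ _).trans (add_le_add le_rfl ?_)
  calc 2 / alpha c deg c₁ F * ddot (avg (fun κ => stress c u κ x) F)
        (avg (fun κ => stress c u κ x) F)
      ≤ 2 / alpha c deg c₁ F * ∑ κ ∈ M.adj F, elastNormSq d (c.lam κ) (c.mu κ) *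
          ddot (stress c u κ x) (strain (u κ) x) := by
        gcongr
        exact (ddot_avg_self_le _ F).trans (Finset.sum_le_sum fun κ _ =>
          ddot_elast_self_le (hl κ) (hm κ).le _)
    _ ≤ _ := by
        rw [Finset.mul_sum]
        exact Finset.sum_le_sum fun κ hκ => two_div_mul_le hc₁ (elastNormSq_pos (hl κ) (hm κ))
          (hk κ) (M.h_pos hd κ) (ddot_elast_self_nonneg (hl κ) (hm κ).le _) (le_alpha hc₁ hκ)

/-- The traction is one-sided, so only the elastic neighbour appears in the remainder;
multiplication by the unit normal does not increase the norm of the stress. -/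
theorem two_abs_integral_traction_jump_le (hdisj : Disjoint Ωe Ωp) (hd : 1 ≤ d)
    (hdeg : ∀ κ, 1 ≤ deg κ)
    (hl : ∀ κ, 0 ≤ c.lam κ) (hm : ∀ κ, 0 < c.mu κ) (hc₁ : 0 < c₁) (he : IsBrokenPoly deg U.e)
    (hp : IsBrokenPoly deg U.p) {F : M.Face} (hF : F ∈ M.facesI) :
    2 * |∫ x in M.face F, inner ℝ (tractionI c U F x) (jumpI U F x) ∂surface d| ≤
      1 / 2 * (∫ x in M.face F, alpha c deg c₁ F * ‖jumpI U F x‖ ^ 2 ∂surface d) +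
      ∑ κ ∈ M.adjE F, 2 / c₁ * (M.h κ / deg κ ^ 2) *
        ∫ x in M.face F, ddot (stress c U.e κ x) (strain (U.e κ) x) ∂surface d := by
  have hj := continuous_jumpI he hp F
  have ht := continuous_tractionI (c := c) he F
  have hk : ∀ κ, (0 : ℝ) < deg κ := fun κ => by exact_mod_cast hdeg κ
  refine two_abs_integral_face_le hd F _ _
    (fun κ x => ddot (stress c U.e κ x) (strain (U.e κ) x))
    (ht.inner hj) (continuous_const.mul (hj.norm.pow 2))
    (fun κ => continuous_ddot (continuous_stress he κ) (continuous_strain he κ)) fun x => ?_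
  obtain ⟨⟨κ, hκ⟩, κ', hκ'⟩ := M.exists_adjE_adjP_eq_singleton hdisj hF
  have hκF : κ ∈ M.adj F := (M.mem_adjE.1 (by rw [hκ]; simp)).1
  have hκ'F : κ' ∈ M.adj F := (M.mem_adjP.1 (by rw [hκ']; simp)).1
  have hα : 0 < alpha c deg c₁ F := by
    refine lt_of_lt_of_le ?_ (le_alpha hc₁ hκF)
    have := M.h_pos hd κ
    have := elastNormSq_pos (d := d) (hl κ) (hm κ)
    have := hk κ
    positivity
  have hn : ‖nP (M := M) F‖ = 1 := by
    rw [nP, trP, hκ', Finset.sum_singleton]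
    exact (M.normal_outward κ' F (M.mem_adj.1 hκ'F)).1
  refine (young_inner hα _ _).trans (add_le_add le_rfl ?_)
  rw [hκ, Finset.sum_singleton]
  calc 2 / alpha c deg c₁ F * ‖tractionI c U F x‖ ^ 2
      ≤ 2 / alpha c deg c₁ F * (elastNormSq d (c.lam κ) (c.mu κ) *
          ddot (stress c U.e κ x) (strain (U.e κ) x)) := by
        gcongr
        refine (norm_traction_sq_le _ _).trans ?_
        rw [hn, one_pow, mul_one, trE, hκ, Finset.sum_singleton]
        exact ddot_elast_self_le (hl κ) (hm κ).le _
    _ ≤ _ := two_div_mul_le hc₁ (elastNormSq_pos (hl κ) (hm κ))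
          (hk κ) (M.h_pos hd κ) (ddot_elast_self_nonneg (hl κ) (hm κ).le _) (le_alpha hc₁ hκF)

theorem gamma_pos (hd : 1 ≤ d) (hdeg : ∀ κ, 1 ≤ deg κ) (hm : ∀ κ ∈ M.cellsP, 0 < c.m κ)
    (hc₂ : 0 < c₂) {F : M.Face} (hF : (M.adjP F).Nonempty) : 0 < gamma c deg c₂ F := by
  obtain ⟨κ, hκ⟩ := hF
  refine lt_of_lt_of_le ?_ (le_gamma hc₂ hκ)
  have := M.h_pos hd κ
  have := hm κ (M.mem_adjP.1 hκ).2
  have : (0 : ℝ) < deg κ := by exact_mod_cast hdeg κ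
  positivity

theorem two_abs_integral_divg_jump_le (hd : 1 ≤ d) (hdeg : ∀ κ, 1 ≤ deg κ)
    (hm : ∀ κ ∈ M.cellsP, 0 < c.m κ) (hc₂ : 0 < c₂) (hu : IsBrokenPoly deg u)
    {F : M.Face} (hF : F ∈ M.facesP) :
    2 * |∫ x in M.face F, avg (fun κ => c.m κ * divg (u κ) x) F * jumpN u F x ∂surface d| ≤
      1 / 2 * (∫ x in M.face F, gamma c deg c₂ F * jumpN u F x ^ 2 ∂surface d) +
      ∑ κ ∈ M.adj F, 2 / c₂ * (M.h κ / deg κ ^ 2) *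
        ∫ x in M.face F, c.m κ * divg (u κ) x ^ 2 ∂surface d := by
  have hj := continuous_jumpN hu F
  have hs : ∀ κ, Continuous fun x => c.m κ * divg (u κ) x := fun κ =>
    continuous_const.mul (continuous_divg hu κ)
  have hk : ∀ κ, (0 : ℝ) < deg κ := fun κ => by exact_mod_cast hdeg κ
  refine two_abs_integral_face_le hd F _ _ (fun κ x => c.m κ * divg (u κ) x ^ 2)
    ((continuous_avg hs F).mul hj)
    (continuous_const.mul (hj.pow 2))
    (fun κ => continuous_const.mul ((continuous_divg hu κ).pow 2)) fun x => ?_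
  have hFP : (M.adjP F).Nonempty := by
    simp only [PolytopicMesh.facesP, Finset.mem_filter] at hF
    exact hF.2.2
  have hγ := gamma_pos (c := c) hd hdeg hm hc₂ hFP
  refine (young_mul hγ _ _).trans (add_le_add (by rw [sq]) ?_)
  calc 2 / gamma c deg c₂ F * (avg (fun κ => c.m κ * divg (u κ) x) F *
        avg (fun κ => c.m κ * divg (u κ) x) F)
      ≤ 2 / gamma c deg c₂ F * ∑ κ ∈ M.adj F, c.m κ * (c.m κ * divg (u κ) x ^ 2) := by
        gcongr
        have := sq_inv_card_mul_sum_le (M.adj F) (fun κ => c.m κ * divg (u κ) x)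
        rw [← sq, avg, smul_eq_mul]
        refine this.trans (le_of_eq (Finset.sum_congr rfl fun κ _ => by ring))
    _ ≤ _ := by
        rw [Finset.mul_sum]
        refine Finset.sum_le_sum fun κ hκ => ?_
        rw [M.adj_eq_adjP hF] at hκ
        have hmκ := hm κ (M.mem_adjP.1 hκ).2
        exact two_div_mul_le hc₂ hmκ (hk κ) (M.h_pos hd κ)
          (mul_nonneg hmκ.le (sq_nonneg _)) (le_gamma hc₂ hκ)

/-- The pressure belongs to `flux` while the jump is that of `fluxI`, which differs by the factor `1
- δ`. The mismatch is harmless: Young's inequality only needs the penalty on the very quantity that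
multiplies the pressure. -/
theorem two_abs_integral_press_filt_le (hdisj : Disjoint Ωe Ωp) (hd : 1 ≤ d)
    (hdeg : ∀ κ, 1 ≤ deg κ) (hm : ∀ κ ∈ M.cellsP, 0 < c.m κ) (hc₂ : 0 < c₂)
    (hp : IsBrokenPoly deg U.p) (hf : IsBrokenPoly deg U.f) {F : M.Face} (hF : F ∈ M.facesI) :
    2 * |∫ x in M.face F, pressI c U F x * filtI c U F x ∂surface d| ≤
      1 / 2 * (∫ x in M.face F, gamma c deg c₂ F * filtI c U F x ^ 2 ∂surface d) +
      ∑ κ ∈ M.adjP F, 2 / c₂ * (M.h κ / deg κ ^ 2) *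
        ∫ x in M.face F, c.m κ * divg (flux c U κ) x ^ 2 ∂surface d := by
  have hj := continuous_filtI (c := c) hp hf F
  have hk : ∀ κ, (0 : ℝ) < deg κ := fun κ => by exact_mod_cast hdeg κ
  refine two_abs_integral_face_le hd F _ _ (fun κ x => c.m κ * divg (flux c U κ) x ^ 2)
    ((continuous_pressI hp hf F).mul hj)
    (continuous_const.mul (hj.pow 2))
    (fun κ => continuous_const.mul ((continuous_divg (IsBrokenPoly.flux c hp hf) κ).pow 2))
    fun x => ?_
  obtain ⟨-, κ, hκ⟩ := M.exists_adjE_adjP_eq_singleton hdisj hF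
  have hκF : κ ∈ M.adjP F := by rw [hκ]; simp
  have hγ := gamma_pos (c := c) hd hdeg hm hc₂ ⟨κ, hκF⟩
  refine (young_mul hγ _ _).trans (add_le_add (by rw [sq]) ?_)
  have hmκ := hm κ (M.mem_adjP.1 hκF).2
  rw [hκ, Finset.sum_singleton, pressI, trP, hκ, Finset.sum_singleton]
  calc 2 / gamma c deg c₂ F * (c.m κ * divg (flux c U κ) x * (c.m κ * divg (flux c U κ) x))
      = 2 / gamma c deg c₂ F * (c.m κ * (c.m κ * divg (flux c U κ) x ^ 2)) := by ring
    _ ≤ _ := two_div_mul_le hc₂ hmκ (hk κ) (M.h_pos hd κ)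
          (mul_nonneg hmκ.le (sq_nonneg _)) (le_gamma hc₂ hκF)

end FaceTerms

/-! ### Coercivity and boundedness of the stiffness form -/

section Coercivity

variable {d : ℕ} {Ωe Ωp : Set (Pt d)} {M : PolytopicMesh d Ωe Ωp}
variable {c : Material M} {deg : M.Cell → ℕ} {c₁ c₂ : ℝ} {u v : Broken M} {U V : Triple M}

/-- The zero-order part of the form `𝓐_h`. -/
def zeroOrder (c : Material M) (U : Triple M) : ℝ :=
  (∑ κ ∈ M.cellsE, ∫ x in M.cell κ, c.rhoE x * c.zeta x ^ 2 * inner ℝ (U.e κ x) (U.e κ x)) +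
  ∑ κ ∈ M.cellsP, ∫ x in M.cell κ, c.rhoP x * c.zeta x ^ 2 * inner ℝ (U.p κ x) (U.p κ x)

/-- On the diagonal the two consistency terms coincide; twice one of them is the only part of the
form that lacks a sign. -/
theorem elasticForm_self (c : Material M) (deg : M.Cell → ℕ) (c₁ : ℝ) (R : Finset M.Cell)
    (Fs : Finset M.Face) (ρ : Pt d → ℝ) (u : Broken M) :
    elasticForm c deg c₁ R Fs ρ u u = normDGSq c deg c₁ R Fs u +
      (∑ κ ∈ R, ∫ x in M.cell κ, ρ x * c.zeta x ^ 2 * inner ℝ (u κ x) (u κ x)) -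
      ∑ F ∈ Fs, 2 * ∫ x in M.face F,
        ddot (avg (fun κ => stress c u κ x) F) (jump u F x) ∂surface d := by
  simp only [elasticForm, normDGSq, ddot_comm (jump u _ _) (avg _ _), ← Finset.mul_sum]
  ring

theorem pressureForm_self (c : Material M) (deg : M.Cell → ℕ) (c₂ : ℝ) (u : Broken M) :
    pressureForm c deg c₂ u u = seminormDivSq c deg c₂ u -
      ∑ F ∈ M.facesP, 2 * ∫ x in M.face F,
        avg (fun κ => c.m κ * divg (u κ) x) F * jumpN u F x ∂surface d := by
  simp only [pressureForm, seminormDivSq, mul_comm (jumpN u _ _) (avg _ _), ← Finset.mul_sum,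
    mul_assoc, ← sq]
  ring

theorem Ch_self (hd : 1 ≤ d) (he : IsBrokenPoly deg U.e) (hp : IsBrokenPoly deg U.p)
    (hf : IsBrokenPoly deg U.f) :
    Ch c deg c₁ c₂ U U = seminormISq c deg c₁ c₂ U -
      (∑ F ∈ M.facesI, 2 * ∫ x in M.face F,
        inner ℝ (tractionI c U F x) (jumpI U F x) ∂surface d) -
      ∑ F ∈ M.facesI, 2 * ∫ x in M.face F, pressI c U F x * filtI c U F x ∂surface d := by
  rw [Ch, seminormISq, ← Finset.sum_add_distrib, ← Finset.sum_sub_distrib,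
    ← Finset.sum_sub_distrib]
  refine Finset.sum_congr rfl fun F _ => ?_
  have hj := continuous_jumpI he hp F
  have ht := continuous_tractionI (c := c) he F
  have hq := continuous_pressI (c := c) hp hf F
  have hw := continuous_filtI (c := c) hp hf F
  rw [← integral_const_mul, ← integral_const_mul,
    ← integral_add (M.integrableOn_face hd F (by fun_prop)) (M.integrableOn_face hd F (by fun_prop)),
    ← integral_sub (M.integrableOn_face hd F (by fun_prop)) (M.integrableOn_face hd F (by fun_prop)),
    ← integral_sub (M.integrableOn_face hd F (by fun_prop)) (M.integrableOn_face hd F (by fun_prop))]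
  congr 1
  ext x
  rw [real_inner_self_eq_norm_sq]
  ring

/-- The powers of `h` and `k` cancel and the coefficient `2 Ctr / c` remains, which is at most 1/2
once `c ≥ 4 Ctr`. This determines the thresholds of the theorem. -/
theorem trace_remainder_le {Ctr c k h S I : ℝ} (hc : 0 < c) (hcC : 4 * Ctr ≤ c) (hk : 0 < k)
    (hh : 0 < h) (hI : 0 ≤ I) (hS : S ≤ Ctr * (k ^ 2 / h) * I) :
    2 / c * (h / k ^ 2) * S ≤ 1 / 2 * I := by
  calc 2 / c * (h / k ^ 2) * S ≤ 2 / c * (h / k ^ 2) * (Ctr * (k ^ 2 / h) * I) := by gcongr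
    _ = 2 * Ctr / c * I := by field_simp
    _ ≤ 1 / 2 * I := by
        refine mul_le_mul_of_nonneg_right ?_ hI
        rw [div_le_iff₀ hc]
        linarith

theorem abs_two_mul_sum_le {ι : Type*} (s : Finset ι) (f : ι → ℝ) :
    |∑ i ∈ s, 2 * f i| ≤ ∑ i ∈ s, 2 * |f i| := by
  refine (Finset.abs_sum_le_sum_abs _ _).trans (le_of_eq (Finset.sum_congr rfl fun i _ => ?_))
  rw [abs_mul, abs_two]

theorem integral_energy_nonneg (hl : ∀ κ, 0 ≤ c.lam κ) (hm : ∀ κ, 0 < c.mu κ) (u : Broken M)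
    (κ : M.Cell) (μ : Measure (Pt d)) :
    0 ≤ ∫ x, ddot (stress c u κ x) (strain (u κ) x) ∂μ :=
  integral_nonneg fun _ => ddot_elast_self_nonneg (hl κ) (hm κ).le _

/-- The two sums are estimated together because an elastic element pays for all its faces, interface
faces included, out of one half of its own energy. -/
theorem elastic_cross_le {C : ℝ} (hdisj : Disjoint Ωe Ωp) (hd : 1 ≤ d)
    (hreg : M.PolytopicRegular C) (hdeg : ∀ κ, 1 ≤ deg κ)
    (hl : ∀ κ, 0 ≤ c.lam κ) (hm : ∀ κ, 0 < c.mu κ)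
    (hc₁ : 4 * PolytopicMesh.traceConst d C ≤ c₁) (he : IsBrokenPoly deg U.e)
    (hp : IsBrokenPoly deg U.p) :
    |∑ F ∈ M.facesE, 2 * ∫ x in M.face F,
        ddot (avg (fun κ => stress c U.e κ x) F) (jump U.e F x) ∂surface d| +
      |∑ F ∈ M.facesI, 2 * ∫ x in M.face F,
        inner ℝ (tractionI c U F x) (jumpI U F x) ∂surface d| ≤
      1 / 2 * normDGSq c deg c₁ M.cellsE M.facesE U.e +
      1 / 2 * ∑ F ∈ M.facesI, ∫ x in M.face F,
        alpha c deg c₁ F * ‖jumpI U F x‖ ^ 2 ∂surface d := by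
  classical
  have hC := PolytopicMesh.traceConst_pos d C
  have hc₁' : 0 < c₁ := by linarith
  have h1 := Finset.sum_le_sum fun F (hF : F ∈ M.facesE) =>
    two_abs_integral_stress_jump_le (c₁ := c₁) hd hdeg hl hm hc₁' he (F := F) (by
      rw [M.adj_eq_adjE hF]
      simp only [PolytopicMesh.facesE, Finset.mem_filter] at hF
      exact hF.2.1)
  have h2 := Finset.sum_le_sum fun F (hF : F ∈ M.facesI) =>
    two_abs_integral_traction_jump_le (c₁ := c₁) hdisj hd hdeg hl hm hc₁' he hp hF
  have h3 := M.sum_faces_le_sum_cellsE (fun F κ => 2 / c₁ * (M.h κ / deg κ ^ 2) *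
        ∫ x in M.face F, ddot (stress c U.e κ x) (strain (U.e κ) x) ∂surface d) fun F κ _ => by
    have := M.h_pos hd κ
    exact mul_nonneg (by positivity) (integral_energy_nonneg hl hm _ _ _)
  have h4 : ∑ κ ∈ M.cellsE, ∑ F ∈ Finset.univ.filter (fun F => κ ∈ M.adj F),
      2 / c₁ * (M.h κ / deg κ ^ 2) *
        ∫ x in M.face F, ddot (stress c U.e κ x) (strain (U.e κ) x) ∂surface d ≤
      1 / 2 * ∑ κ ∈ M.cellsE, ∫ x in M.cell κ, ddot (stress c U.e κ x) (strain (U.e κ) x) := by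
    rw [Finset.mul_sum]
    refine Finset.sum_le_sum fun κ _ => ?_
    rw [← Finset.mul_sum]
    exact trace_remainder_le hc₁' hc₁ (by exact_mod_cast hdeg κ) (M.h_pos hd κ)
      (integral_energy_nonneg hl hm _ _ _)
      (sum_integral_face_energy_le hd hreg hdeg hl (fun κ => (hm κ).le) he κ _ (by simp))
  simp only [Finset.sum_add_distrib, ← Finset.mul_sum (a := (1 / 2 : ℝ))] at h1 h2
  have h5 := abs_two_mul_sum_le M.facesE fun F => ∫ x in M.face F,
        ddot (avg (fun κ => stress c U.e κ x) F) (jump U.e F x) ∂surface d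
  have h6 := abs_two_mul_sum_le M.facesI fun F => ∫ x in M.face F,
        inner ℝ (tractionI c U F x) (jumpI U F x) ∂surface d
  rw [normDGSq]
  linarith

/-- The traction on the interface comes from the elastic side, so a poroelastic element pays only
for its other faces; the interface part of the exchanged sum is nonnegative and is discarded. -/
theorem elastic_cross_le_poro {C : ℝ} (hd : 1 ≤ d)
    (hreg : M.PolytopicRegular C) (hdeg : ∀ κ, 1 ≤ deg κ)
    (hl : ∀ κ, 0 ≤ c.lam κ) (hm : ∀ κ, 0 < c.mu κ)
    (hc₁ : 4 * PolytopicMesh.traceConst d C ≤ c₁) (hu : IsBrokenPoly deg u) :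
    |∑ F ∈ M.facesP, 2 * ∫ x in M.face F,
        ddot (avg (fun κ => stress c u κ x) F) (jump u F x) ∂surface d| ≤
      1 / 2 * normDGSq c deg c₁ M.cellsP M.facesP u := by
  classical
  have hC := PolytopicMesh.traceConst_pos d C
  have hc₁' : 0 < c₁ := by linarith
  have h1 := Finset.sum_le_sum fun F (hF : F ∈ M.facesP) =>
    two_abs_integral_stress_jump_le (c₁ := c₁) hd hdeg hl hm hc₁' hu (F := F) (by
      rw [M.adj_eq_adjP hF]
      simp only [PolytopicMesh.facesP, Finset.mem_filter] at hF
      exact hF.2.2)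
  have hnn : ∀ F κ, 0 ≤ 2 / c₁ * (M.h κ / deg κ ^ 2) *
        ∫ x in M.face F, ddot (stress c u κ x) (strain (u κ) x) ∂surface d := fun F κ => by
    have := M.h_pos hd κ
    exact mul_nonneg (by positivity) (integral_energy_nonneg hl hm _ _ _)
  have h3 := M.sum_faces_le_sum_cellsP (fun F κ => 2 / c₁ * (M.h κ / deg κ ^ 2) *
        ∫ x in M.face F, ddot (stress c u κ x) (strain (u κ) x) ∂surface d) fun F κ _ => hnn F κ
  have h3' : 0 ≤ ∑ F ∈ M.facesI, ∑ κ ∈ M.adjP F, 2 / c₁ * (M.h κ / deg κ ^ 2) *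
        ∫ x in M.face F, ddot (stress c u κ x) (strain (u κ) x) ∂surface d :=
    Finset.sum_nonneg fun F _ => Finset.sum_nonneg fun κ _ => hnn F κ
  have h4 : ∑ κ ∈ M.cellsP, ∑ F ∈ Finset.univ.filter (fun F => κ ∈ M.adj F),
      2 / c₁ * (M.h κ / deg κ ^ 2) *
        ∫ x in M.face F, ddot (stress c u κ x) (strain (u κ) x) ∂surface d ≤
      1 / 2 * ∑ κ ∈ M.cellsP, ∫ x in M.cell κ, ddot (stress c u κ x) (strain (u κ) x) := by
    rw [Finset.mul_sum]
    refine Finset.sum_le_sum fun κ _ => ?_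
    rw [← Finset.mul_sum]
    exact trace_remainder_le hc₁' hc₁ (by exact_mod_cast hdeg κ) (M.h_pos hd κ)
      (integral_energy_nonneg hl hm _ _ _)
      (sum_integral_face_energy_le hd hreg hdeg hl (fun κ => (hm κ).le) hu κ _ (by simp))
  simp only [Finset.sum_add_distrib, ← Finset.mul_sum (a := (1 / 2 : ℝ))] at h1
  have h5 := abs_two_mul_sum_le M.facesP fun F => ∫ x in M.face F,
        ddot (avg (fun κ => stress c u κ x) F) (jump u F x) ∂surface d
  rw [normDGSq]
  linarith

/-- The argument of `elastic_cross_le` with the roles of the regions exchanged: the pressure on the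
interface is taken from the poroelastic side. -/
theorem pressure_cross_le {C : ℝ} (hdisj : Disjoint Ωe Ωp) (hd : 1 ≤ d)
    (hreg : M.PolytopicRegular C) (hdeg : ∀ κ, 1 ≤ deg κ) (hm : ∀ κ ∈ M.cellsP, 0 < c.m κ)
    (hc₂ : 4 * PolytopicMesh.traceConst d C ≤ c₂) (hp : IsBrokenPoly deg U.p)
    (hf : IsBrokenPoly deg U.f) :
    |∑ F ∈ M.facesP, 2 * ∫ x in M.face F,
        avg (fun κ => c.m κ * divg (flux c U κ) x) F * jumpN (flux c U) F x ∂surface d| +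
      |∑ F ∈ M.facesI, 2 * ∫ x in M.face F, pressI c U F x * filtI c U F x ∂surface d| ≤
      1 / 2 * seminormDivSq c deg c₂ (flux c U) +
      1 / 2 * ∑ F ∈ M.facesI, ∫ x in M.face F,
        gamma c deg c₂ F * filtI c U F x ^ 2 ∂surface d := by
  classical
  have hC := PolytopicMesh.traceConst_pos d C
  have hc₂' : 0 < c₂ := by linarith
  have hfl := IsBrokenPoly.flux c hp hf
  have h1 := Finset.sum_le_sum fun F (hF : F ∈ M.facesP) =>
    two_abs_integral_divg_jump_le (c₂ := c₂) hd hdeg hm hc₂' hfl hF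
  have h2 := Finset.sum_le_sum fun F (hF : F ∈ M.facesI) =>
    two_abs_integral_press_filt_le (c₂ := c₂) hdisj hd hdeg hm hc₂' hp hf hF
  have h3 := M.sum_faces_le_sum_cellsP (fun F κ => 2 / c₂ * (M.h κ / deg κ ^ 2) *
        ∫ x in M.face F, c.m κ * divg (flux c U κ) x ^ 2 ∂surface d) fun F κ hκ => by
    have := M.h_pos hd κ
    have := hm κ (M.mem_adjP.1 hκ).2
    exact mul_nonneg (by positivity) (integral_nonneg fun x => by positivity)
  have h4 : ∑ κ ∈ M.cellsP, ∑ F ∈ Finset.univ.filter (fun F => κ ∈ M.adj F),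
      2 / c₂ * (M.h κ / deg κ ^ 2) *
        ∫ x in M.face F, c.m κ * divg (flux c U κ) x ^ 2 ∂surface d ≤
      1 / 2 * ∑ κ ∈ M.cellsP, ∫ x in M.cell κ, c.m κ * divg (flux c U κ) x ^ 2 := by
    rw [Finset.mul_sum]
    refine Finset.sum_le_sum fun κ hκ => ?_
    rw [← Finset.mul_sum]
    have := hm κ hκ
    exact trace_remainder_le hc₂' hc₂ (by exact_mod_cast hdeg κ) (M.h_pos hd κ)
      (integral_nonneg fun x => by positivity)
      (sum_integral_face_divg_le hd hreg hdeg hfl κ this.le _ (by simp))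
  simp only [Finset.sum_add_distrib, ← Finset.mul_sum (a := (1 / 2 : ℝ))] at h1 h2
  have h5 := abs_two_mul_sum_le M.facesP fun F => ∫ x in M.face F,
        avg (fun κ => c.m κ * divg (flux c U κ) x) F * jumpN (flux c U) F x ∂surface d
  have h6 := abs_two_mul_sum_le M.facesI fun F => ∫ x in M.face F,
        pressI c U F x * filtI c U F x ∂surface d
  rw [seminormDivSq]
  linarith

/-- For large penalty parameters the stiffness form is equivalent to the energy seminorms. -/
theorem abs_stiffness_sub_le {C : ℝ} (hdisj : Disjoint Ωe Ωp) (hd : 1 ≤ d)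
    (hreg : M.PolytopicRegular C) (hdeg : ∀ κ, 1 ≤ deg κ)
    (hl : ∀ κ, 0 ≤ c.lam κ) (hmu : ∀ κ, 0 < c.mu κ) (hm : ∀ κ ∈ M.cellsP, 0 < c.m κ)
    (hc₁ : 4 * PolytopicMesh.traceConst d C ≤ c₁) (hc₂ : 4 * PolytopicMesh.traceConst d C ≤ c₂)
    (he : IsBrokenPoly deg U.e) (hp : IsBrokenPoly deg U.p) (hf : IsBrokenPoly deg U.f) :
    |Ah c deg c₁ c₂ U U + Ch c deg c₁ c₂ U U -
      (seminormDGSq c deg c₁ c₂ U + seminormISq c deg c₁ c₂ U + zeroOrder c U)| ≤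
      1 / 2 * (seminormDGSq c deg c₁ c₂ U + seminormISq c deg c₁ c₂ U) := by
  have h1 := elastic_cross_le hdisj hd hreg hdeg hl hmu hc₁ he hp
  have h2 := elastic_cross_le_poro hd hreg hdeg hl hmu hc₁ hp
  have h3 := pressure_cross_le hdisj hd hreg hdeg hm hc₂ hp hf
  rw [Ah, elasticForm_self, elasticForm_self, pressureForm_self, Ch_self hd he hp hf, seminormDGSq,
    seminormISq, zeroOrder]
  rw [abs_le]
  set a₁ := ∑ F ∈ M.facesE, 2 * ∫ x in M.face F,
        ddot (avg (fun κ => stress c U.e κ x) F) (jump U.e F x) ∂surface d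
  set a₂ := ∑ F ∈ M.facesI, 2 * ∫ x in M.face F,
        inner ℝ (tractionI c U F x) (jumpI U F x) ∂surface d
  set a₃ := ∑ F ∈ M.facesP, 2 * ∫ x in M.face F,
        ddot (avg (fun κ => stress c U.p κ x) F) (jump U.p F x) ∂surface d
  set a₄ := ∑ F ∈ M.facesP, 2 * ∫ x in M.face F,
        avg (fun κ => c.m κ * divg (flux c U κ) x) F * jumpN (flux c U) F x ∂surface d
  set a₅ := ∑ F ∈ M.facesI, 2 * ∫ x in M.face F, pressI c U F x * filtI c U F x ∂surface d
  -- Each cross term lies between `-|aᵢ|` and `|aᵢ|`; everything else is linear. The lower bound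
  -- serves at time t, the upper one at time 0.
  have := abs_le.1 (le_refl |a₁|)
  have := abs_le.1 (le_refl |a₂|)
  have := abs_le.1 (le_refl |a₃|)
  have := abs_le.1 (le_refl |a₄|)
  have := abs_le.1 (le_refl |a₅|)
  constructor <;> linarith

end Coercivity

/-! ### Bilinear forms along absolutely continuous curves -/

section Bilinear

/-- A function of two vector arguments that is linear in each of them. -/
structure IsBilin {W : Type*} [AddCommGroup W] [Module ℝ W] (B : W → W → ℝ) : Prop where
  left : ∀ v, IsLinearMap ℝ fun u => B u v
  right : ∀ u, IsLinearMap ℝ fun v => B u v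

variable {W : Type*} [AddCommGroup W] [Module ℝ W]

theorem isLinearMap_sum {ι : Type*} (s : Finset ι) {f : ι → W → ℝ}
    (hf : ∀ i ∈ s, IsLinearMap ℝ (f i)) : IsLinearMap ℝ fun w => ∑ i ∈ s, f i w := by
  constructor
  · intro x y
    rw [← Finset.sum_add_distrib]
    exact Finset.sum_congr rfl fun i hi => (hf i hi).map_add x y
  · intro a x
    rw [Finset.smul_sum]
    exact Finset.sum_congr rfl fun i hi => (hf i hi).map_smul a x

theorem isLinearMap_add {f g : W → ℝ} (hf : IsLinearMap ℝ f) (hg : IsLinearMap ℝ g) :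
    IsLinearMap ℝ fun w => f w + g w := by
  constructor
  · intro x y
    rw [hf.map_add, hg.map_add]; ring
  · intro a x
    rw [hf.map_smul, hg.map_smul]; simp only [smul_eq_mul]; ring

theorem isLinearMap_const_mul (a : ℝ) {f : W → ℝ} (hf : IsLinearMap ℝ f) :
    IsLinearMap ℝ fun w => a * f w := by
  constructor
  · intro x y
    rw [hf.map_add]; ring
  · intro b x
    rw [hf.map_smul]; simp only [smul_eq_mul]; ring

theorem isLinearMap_mul_const (a : ℝ) {f : W → ℝ} (hf : IsLinearMap ℝ f) :
    IsLinearMap ℝ fun w => f w * a := by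
  simpa only [mul_comm] using isLinearMap_const_mul a hf

theorem isLinearMap_sub {f g : W → ℝ} (hf : IsLinearMap ℝ f) (hg : IsLinearMap ℝ g) :
    IsLinearMap ℝ fun w => f w - g w := by
  simpa [sub_eq_add_neg] using isLinearMap_add hf (isLinearMap_const_mul (-1) hg)

theorem isLinearMap_integral {X : Type*} [MeasurableSpace X] {μ : Measure X} {f : X → W → ℝ}
    (hf : ∀ x, IsLinearMap ℝ (f x)) (hint : ∀ w, Integrable (fun x => f x w) μ) :
    IsLinearMap ℝ fun w => ∫ x, f x w ∂μ := by
  constructor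
  · intro u v
    rw [← integral_add (hint u) (hint v)]
    exact integral_congr_ae (Filter.Eventually.of_forall fun x => (hf x).map_add u v)
  · intro a u
    rw [smul_eq_mul, ← integral_const_mul]
    exact integral_congr_ae (Filter.Eventually.of_forall fun x => (hf x).map_smul a u)

namespace IsBilin

variable {B B' : W → W → ℝ}

theorem mul {f g : W → ℝ} (hf : IsLinearMap ℝ f) (hg : IsLinearMap ℝ g) :
    IsBilin fun u v => f u * g v :=
  ⟨fun _ => isLinearMap_mul_const _ hf, fun _ => isLinearMap_const_mul _ hg⟩

theorem add (hB : IsBilin B) (hB' : IsBilin B') : IsBilin fun u v => B u v + B' u v :=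
  ⟨fun v => isLinearMap_add (hB.left v) (hB'.left v),
    fun u => isLinearMap_add (hB.right u) (hB'.right u)⟩

theorem sub (hB : IsBilin B) (hB' : IsBilin B') : IsBilin fun u v => B u v - B' u v :=
  ⟨fun v => isLinearMap_sub (hB.left v) (hB'.left v),
    fun u => isLinearMap_sub (hB.right u) (hB'.right u)⟩

theorem const_mul (a : ℝ) (hB : IsBilin B) : IsBilin fun u v => a * B u v :=
  ⟨fun v => isLinearMap_const_mul a (hB.left v), fun u => isLinearMap_const_mul a (hB.right u)⟩

theorem neg (hB : IsBilin B) : IsBilin fun u v => -B u v := by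
  simpa using hB.const_mul (-1)

theorem swap (hB : IsBilin B) : IsBilin fun u v => B v u := ⟨hB.right, hB.left⟩

theorem sum {ι : Type*} (s : Finset ι) {B : ι → W → W → ℝ} (hB : ∀ i ∈ s, IsBilin (B i)) :
    IsBilin fun u v => ∑ i ∈ s, B i u v :=
  ⟨fun v => isLinearMap_sum s fun i hi => (hB i hi).left v,
    fun u => isLinearMap_sum s fun i hi => (hB i hi).right u⟩

theorem integral {X : Type*} [MeasurableSpace X] {μ : Measure X} {b : X → W → W → ℝ}
    (hb : ∀ x, IsBilin (b x)) (hint : ∀ u v, Integrable (fun x => b x u v) μ) :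
    IsBilin fun u v => ∫ x, b x u v ∂μ :=
  ⟨fun v => isLinearMap_integral (fun x => (hb x).left v) fun u => hint u v,
    fun u => isLinearMap_integral (fun x => (hb x).right u) fun v => hint u v⟩

theorem sum_smul (hB : IsBilin B) {ι : Type*} (s : Finset ι) (a b : ι → ℝ) (φ : ι → W) :
    B (∑ i ∈ s, a i • φ i) (∑ j ∈ s, b j • φ j) =
      ∑ i ∈ s, ∑ j ∈ s, a i * b j * B (φ i) (φ j) := by
  have h1 : ∀ v, B (∑ i ∈ s, a i • φ i) v = ∑ i ∈ s, a i * B (φ i) v := by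
    intro v
    have := map_sum (IsLinearMap.mk' _ (hB.left v)) (fun i => a i • φ i) s
    simpa only [map_smul, IsLinearMap.mk'_apply, smul_eq_mul] using this
  have h2 : ∀ u, B u (∑ j ∈ s, b j • φ j) = ∑ j ∈ s, b j * B u (φ j) := by
    intro u
    have := map_sum (IsLinearMap.mk' _ (hB.right u)) (fun i => b i • φ i) s
    simpa only [map_smul, IsLinearMap.mk'_apply, smul_eq_mul] using this
  rw [h1]
  refine Finset.sum_congr rfl fun i _ => ?_
  rw [h2, Finset.mul_sum]
  exact Finset.sum_congr rfl fun j _ => by ring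

end IsBilin

/-- The elements of a finite-dimensional space of functions are determined linearly by their values
at finitely many points. -/
theorem exists_sampling {ι : Type*} (W : Submodule ℝ (ι → ℝ)) [FiniteDimensional ℝ W] :
    ∃ (s : Finset ι) (φ : ι → W), ∀ w : W, w = ∑ i ∈ s, (w : ι → ℝ) i • φ i := by
  classical
  -- The point evaluations live in a finite-dimensional dual, so an independent family with the same
  -- span is finite. An element vanishing at its points vanishes everywhere, hence restriction `R`
  -- to these points is injective, and a left inverse applied to the unit vectors yields the `φ i`.
  let ev : ι → Module.Dual ℝ W := fun i => (LinearMap.proj i).comp W.subtype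
  obtain ⟨b, hb, hspan, hli⟩ := exists_linearIndependent ℝ (range ev)
  have hfin : b.Finite := hli.setFinite
  choose g hg using fun x : b => hb x.2
  have : Fintype b := hfin.fintype
  let s : Finset ι := Finset.univ.image g
  let R : W →ₗ[ℝ] (s → ℝ) := LinearMap.pi fun i => ev i
  have hinj : LinearMap.ker R = ⊥ := by
    rw [LinearMap.ker_eq_bot']
    intro w hw
    have h1 : ∀ x ∈ b, x w = 0 := by
      intro x hx
      have h2 := congrFun hw ⟨g ⟨x, hx⟩, Finset.mem_image_of_mem _ (Finset.mem_univ _)⟩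
      have h3 : ev (g ⟨x, hx⟩) = x := hg ⟨x, hx⟩
      rw [← h3]
      exact h2
    have h4 : ∀ x ∈ Submodule.span ℝ b, x w = 0 := by
      intro x hx
      induction hx using Submodule.span_induction with
      | mem x hx => exact h1 x hx
      | zero => rfl
      | add x y _ _ hx hy => simp [hx, hy]
      | smul a x _ hx => simp [hx]
    ext i
    have h5 : ev i ∈ Submodule.span ℝ b := by
      rw [hspan]
      exact Submodule.subset_span (mem_range_self i)
    exact h4 _ h5
  obtain ⟨L, hL⟩ := R.exists_leftInverse_of_injective hinj
  refine ⟨s, fun i => if hi : i ∈ s then L (Pi.single ⟨i, hi⟩ 1) else 0, fun w => ?_⟩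
  have h1 : w = L (R w) := by
    have := LinearMap.congr_fun hL w
    exact this.symm
  conv_lhs => rw [h1, LinearMap.pi_apply_eq_sum_univ L (R w)]
  rw [← Finset.sum_coe_sort s]
  refine Finset.sum_congr rfl fun i _ => ?_
  simp only [Finset.coe_mem, dif_pos]
  have h6 : R w i = (w : ι → ℝ) i := rfl
  rw [h6]
  congr 2
  ext j
  by_cases h : j = i
  · subst h; simp
  · simp [h, Ne.symm h]

/-- Product rule for absolutely continuous functions given by their derivatives. -/
theorem integral_product_rule {T : ℝ} {f g f' g' : ℝ → ℝ} (hf' : IntervalIntegrable f' volume 0 T)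
    (hg' : IntervalIntegrable g' volume 0 T)
    (hf : ∀ t ∈ Icc 0 T, f t = f 0 + ∫ s in (0 : ℝ)..t, f' s)
    (hg : ∀ t ∈ Icc 0 T, g t = g 0 + ∫ s in (0 : ℝ)..t, g' s) {t : ℝ} (ht : t ∈ Icc 0 T) :
    IntervalIntegrable (fun s => f' s * g s + f s * g' s) volume 0 t ∧
      f t * g t = f 0 * g 0 + ∫ s in (0 : ℝ)..t, (f' s * g s + f s * g' s) := by
  have hsub : uIcc 0 t ⊆ uIcc 0 T := by
    rw [uIcc_of_le ht.1, uIcc_of_le (ht.1.trans ht.2)]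
    exact Icc_subset_Icc_right ht.2
  have hmem : ∀ s ∈ uIcc 0 t, s ∈ Icc 0 T := fun s hs => by
    have := hsub hs
    rwa [uIcc_of_le (ht.1.trans ht.2)] at this
  have hf1 := hf'.mono_set hsub
  have hg1 := hg'.mono_set hsub
  -- `f` and `g` are controlled only on `[0, T]`. The primitives `F` and `G` agree with them on `[0,
  -- t]`, are absolutely continuous there, and have derivatives `f'` and `g'` almost everywhere.
  set F : ℝ → ℝ := fun t => f 0 + ∫ s in (0 : ℝ)..t, f' s
  set G : ℝ → ℝ := fun t => g 0 + ∫ s in (0 : ℝ)..t, g' s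
  have hconst : ∀ a : ℝ, AbsolutelyContinuousOnInterval (fun _ => a) 0 t := fun a =>
    (contDiff_const (c := a)).contDiffOn.absolutelyContinuousOnInterval
  have hF : AbsolutelyContinuousOnInterval F 0 t :=
    (hconst (f 0)).fun_add (hf1.absolutelyContinuousOnInterval_intervalIntegral left_mem_uIcc)
  have hG : AbsolutelyContinuousOnInterval G 0 t :=
    (hconst (g 0)).fun_add (hg1.absolutelyContinuousOnInterval_intervalIntegral left_mem_uIcc)
  have hFf : ∀ s ∈ uIcc 0 t, F s = f s := fun s hs => (hf s (hmem s hs)).symm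
  have hGg : ∀ s ∈ uIcc 0 t, G s = g s := fun s hs => (hg s (hmem s hs)).symm
  have hint : IntervalIntegrable (fun s => f' s * g s + f s * g' s) volume 0 t := by
    have h1 := (hf1.mul_continuousOn hG.continuousOn).add (hg1.continuousOn_mul hF.continuousOn)
    refine h1.congr fun s hs => ?_
    have hs' := uIoc_subset_uIcc hs
    simp only [hFf s hs', hGg s hs']
  refine ⟨hint, ?_⟩
  have h1 := hF.integral_deriv_mul_eq_sub hG
  rw [hFf t right_mem_uIcc, hGg t right_mem_uIcc, hFf 0 left_mem_uIcc, hGg 0 left_mem_uIcc] at h1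
  have h2 : ∫ x in (0 : ℝ)..t, deriv F x * G x + F x * deriv G x =
      ∫ s in (0 : ℝ)..t, (f' s * g s + f s * g' s) := by
    refine intervalIntegral.integral_congr_ae ?_
    filter_upwards [hf1.ae_hasDerivAt_integral, hg1.ae_hasDerivAt_integral] with s h3 h4 hs
    have hs' := uIoc_subset_uIcc hs
    have h5 := ((h3 hs') 0 left_mem_uIcc).const_add (f 0)
    have h6 := ((h4 hs') 0 left_mem_uIcc).const_add (g 0)
    rw [hFf s hs', hGg s hs', h5.deriv, h6.deriv]
  rw [← h2, h1]
  ring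

/-- Energy identity for a symmetric bilinear form along an absolutely continuous curve in a
finite-dimensional space of functions. -/
theorem IsBilin.energy_identity {ι : Type*} {W : Submodule ℝ (ι → ℝ)} [FiniteDimensional ℝ W]
    {B : W → W → ℝ} (hB : IsBilin B) (hsymm : ∀ u v, B u v = B v u) {T : ℝ} {f f' : ℝ → W}
    (hf' : ∀ i, IntervalIntegrable (fun t => (f' t : ι → ℝ) i) volume 0 T)
    (hf : ∀ i, ∀ t ∈ Icc 0 T,
      (f t : ι → ℝ) i = (f 0 : ι → ℝ) i + ∫ s in (0 : ℝ)..t, (f' s : ι → ℝ) i)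
    {t : ℝ} (ht : t ∈ Icc 0 T) :
    IntervalIntegrable (fun s => B (f' s) (f s)) volume 0 t ∧
      B (f t) (f t) = B (f 0) (f 0) + 2 * ∫ s in (0 : ℝ)..t, B (f' s) (f s) := by
  -- After sampling, `B (f t) (f t)` is a fixed quadratic polynomial in finitely many absolutely
  -- continuous scalar functions; symmetry of `B` turns its derivative into `2 B(f', f)`.
  obtain ⟨s, φ, hφ⟩ := exists_sampling W
  have hexp : ∀ u v : W, B u v = ∑ i ∈ s, ∑ j ∈ s,
      (u : ι → ℝ) i * (v : ι → ℝ) j * B (φ i) (φ j) := by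
    intro u v
    conv_lhs => rw [hφ u, hφ v]
    exact hB.sum_smul s _ _ φ
  have hpr := fun i j => integral_product_rule (hf' i) (hf' j) (hf i) (hf j) ht
  have h2 : ∀ r, 2 * B (f' r) (f r) = ∑ i ∈ s, ∑ j ∈ s,
      ((f' r : ι → ℝ) i * (f r : ι → ℝ) j + (f r : ι → ℝ) i * (f' r : ι → ℝ) j) *
        B (φ i) (φ j) := by
    intro r
    rw [two_mul]
    conv_lhs => rw [hexp]; arg 2; rw [← hexp, hsymm, hexp]
    rw [← Finset.sum_add_distrib]
    refine Finset.sum_congr rfl fun i _ => ?_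
    rw [← Finset.sum_add_distrib]
    exact Finset.sum_congr rfl fun j _ => by ring
  have hi : ∀ i ∈ s, ∀ j ∈ s, IntervalIntegrable (fun r =>
      ((f' r : ι → ℝ) i * (f r : ι → ℝ) j + (f r : ι → ℝ) i * (f' r : ι → ℝ) j) *
        B (φ i) (φ j)) volume 0 t := fun i _ j _ => (hpr i j).1.mul_const _
  have hsum : IntervalIntegrable (fun r => 2 * B (f' r) (f r)) volume 0 t := by
    simp only [h2]
    have := IntervalIntegrable.sum s fun i hi' => IntervalIntegrable.sum s fun j hj => hi i hi' j hj
    refine this.congr fun r _ => ?_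
    simp only [Finset.sum_apply]
  constructor
  · have := hsum.const_mul (1 / 2)
    refine this.congr fun r _ => ?_
    ring
  · rw [← intervalIntegral.integral_const_mul]
    simp only [h2]
    rw [intervalIntegral.integral_finsetSum fun i hi' => by
      have := IntervalIntegrable.sum s fun j hj => hi i hi' j hj
      refine this.congr fun r _ => ?_
      simp only [Finset.sum_apply]]
    rw [hexp (f t), hexp (f 0), ← Finset.sum_add_distrib]
    refine Finset.sum_congr rfl fun i hi' => ?_
    rw [intervalIntegral.integral_finsetSum fun j hj => hi i hi' j hj, ← Finset.sum_add_distrib]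
    refine Finset.sum_congr rfl fun j _ => ?_
    rw [intervalIntegral.integral_mul_const, (hpr i j).2]
    ring

/-- The same expansion in point values; it provides the time integrability of the damping along the
velocity. -/
theorem IsBilin.continuousOn {ι : Type*} {W : Submodule ℝ (ι → ℝ)} [FiniteDimensional ℝ W]
    {B : W → W → ℝ} (hB : IsBilin B) {s : Set ℝ} {f : ℝ → W}
    (hf : ∀ i, ContinuousOn (fun t => (f t : ι → ℝ) i) s) :
    ContinuousOn (fun t => B (f t) (f t)) s := by
  obtain ⟨r, φ, hφ⟩ := exists_sampling W
  have hexp : ∀ u v : W, B u v = ∑ i ∈ r, ∑ j ∈ r,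
      (u : ι → ℝ) i * (v : ι → ℝ) j * B (φ i) (φ j) := by
    intro u v
    conv_lhs => rw [hφ u, hφ v]
    exact hB.sum_smul r _ _ φ
  rw [show (fun t => B (f t) (f t)) = _ from funext fun t => hexp (f t) (f t)]
  exact continuousOn_finsetSum _ fun i _ => continuousOn_finsetSum _ fun j _ =>
    ((hf i).mul (hf j)).mul continuousOn_const

end Bilinear

/-! ### Bounded coefficients -/

/-- A measurable function that is bounded on `s`. -/
structure BddMeas {X : Type*} [MeasurableSpace X] (s : Set X) (w : X → ℝ) : Prop where
  meas : Measurable w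
  bdd : ∃ B, ∀ x ∈ s, |w x| ≤ B

namespace BddMeas

variable {X : Type*} [MeasurableSpace X] {s t : Set X} {w w' : X → ℝ}

theorem mono (hw : BddMeas s w) (h : t ⊆ s) : BddMeas t w :=
  ⟨hw.meas, hw.bdd.imp fun _ hB x hx => hB x (h hx)⟩

theorem const (a : ℝ) : BddMeas s fun _ => a := ⟨measurable_const, |a|, fun _ _ => le_rfl⟩

theorem mul (hw : BddMeas s w) (hw' : BddMeas s w') : BddMeas s fun x => w x * w' x := by
  obtain ⟨B, hB⟩ := hw.bdd
  obtain ⟨B', hB'⟩ := hw'.bdd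
  refine ⟨hw.meas.mul hw'.meas, B * B', fun x hx => ?_⟩
  rw [abs_mul]
  exact mul_le_mul (hB x hx) (hB' x hx) (abs_nonneg _) ((abs_nonneg _).trans (hB x hx))

theorem add (hw : BddMeas s w) (hw' : BddMeas s w') : BddMeas s fun x => w x + w' x := by
  obtain ⟨B, hB⟩ := hw.bdd
  obtain ⟨B', hB'⟩ := hw'.bdd
  exact ⟨hw.meas.add hw'.meas, B + B', fun x hx =>
    (abs_add_le _ _).trans (add_le_add (hB x hx) (hB' x hx))⟩

theorem one_sub (hw : BddMeas s w) : BddMeas s fun x => 1 - w x := by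
  have := (const (s := s) 1).add ((const (-1)).mul hw)
  simpa [sub_eq_add_neg] using this

theorem inv (hw : Measurable w) {a : ℝ} (ha : 0 < a) (h : ∀ x ∈ s, a ≤ w x) :
    BddMeas s fun x => (w x)⁻¹ := by
  refine ⟨hw.inv, a⁻¹, fun x hx => ?_⟩
  rw [abs_of_pos (inv_pos.2 (ha.trans_le (h x hx)))]
  exact inv_anti₀ ha (h x hx)

theorem of_mem_Icc (hw : Measurable w) {a b : ℝ} (h : ∀ x ∈ s, w x ∈ Icc a b) : BddMeas s w :=
  ⟨hw, max |a| |b|, fun x hx => abs_le_max_abs_abs (h x hx).1 (h x hx).2⟩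

theorem integrableOn_mul {μ : Measure X} (hs : MeasurableSet s) (hw : BddMeas s w) {g : X → ℝ}
    (hg : IntegrableOn g s μ) : IntegrableOn (fun x => w x * g x) s μ := by
  obtain ⟨B, hB⟩ := hw.bdd
  refine Integrable.bdd_mul (c := B) hg hw.meas.aestronglyMeasurable ?_
  filter_upwards [ae_restrict_mem hs] with x hx using hB x hx

end BddMeas

namespace Material.Admissible

variable {d : ℕ} {Ωe Ωp : Set (Pt d)} {M : PolytopicMesh d Ωe Ωp} {c : Material M} {K : ℝ}
  (h : c.Admissible K)

include h

theorem K_pos : 0 < K := zero_lt_one.trans_le h.one_le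

theorem zeta_memE {x : Pt d} (hx : x ∈ Ωe) : c.zeta x ∈ Icc K⁻¹ K := h.zeta_mem x (Or.inl hx)

theorem zeta_memP {x : Pt d} (hx : x ∈ Ωp) : c.zeta x ∈ Icc K⁻¹ K := h.zeta_mem x (Or.inr hx)

theorem rhoE_pos {x : Pt d} (hx : x ∈ Ωe) : 0 < c.rhoE x :=
  (inv_pos.2 h.K_pos).trans_le (h.rhoE_mem x hx).1

theorem rhoF_pos {x : Pt d} (hx : x ∈ Ωp) : 0 < c.rhoF x :=
  (inv_pos.2 h.K_pos).trans_le (h.rhoF_mem x hx).1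

theorem rhoS_pos {x : Pt d} (hx : x ∈ Ωp) : 0 < c.rhoS x :=
  (inv_pos.2 h.K_pos).trans_le (h.rhoS_mem x hx).1

theorem phi_pos {x : Pt d} (hx : x ∈ Ωp) : 0 < c.phi x :=
  (inv_pos.2 h.K_pos).trans_le (h.phi_mem x hx).1

theorem one_sub_phi_ge {x : Pt d} (hx : x ∈ Ωp) : K⁻¹ ≤ 1 - c.phi x := by
  have := (h.phi_mem x hx).2
  linarith

theorem rhoP_ge {x : Pt d} (hx : x ∈ Ωp) : K⁻¹ * K⁻¹ ≤ c.rhoP x := by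
  have hK := inv_pos.2 h.K_pos
  have h1 : K⁻¹ * K⁻¹ ≤ c.phi x * c.rhoF x :=
    mul_le_mul (h.phi_mem x hx).1 (h.rhoF_mem x hx).1 hK.le (h.phi_pos hx).le
  have h2 : 0 ≤ (1 - c.phi x) * c.rhoS x :=
    mul_nonneg (hK.le.trans (h.one_sub_phi_ge hx)) (h.rhoS_pos hx).le
  unfold Material.rhoP
  linarith

theorem rhoP_pos {x : Pt d} (hx : x ∈ Ωp) : 0 < c.rhoP x := by
  have hK := inv_pos.2 h.K_pos
  exact (mul_pos hK hK).trans_le (h.rhoP_ge hx)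

theorem bdd_rhoE : BddMeas Ωe c.rhoE := .of_mem_Icc h.meas_rhoE h.rhoE_mem

theorem bdd_zetaE : BddMeas Ωe c.zeta := .of_mem_Icc h.meas_zeta fun _ hx => h.zeta_memE hx

theorem bdd_zetaP : BddMeas Ωp c.zeta := .of_mem_Icc h.meas_zeta fun _ hx => h.zeta_memP hx

theorem bdd_rhoF : BddMeas Ωp c.rhoF := .of_mem_Icc h.meas_rhoF h.rhoF_mem

theorem bdd_rhoS : BddMeas Ωp c.rhoS := .of_mem_Icc h.meas_rhoS h.rhoS_mem

theorem bdd_phi : BddMeas Ωp c.phi := .of_mem_Icc h.meas_phi h.phi_mem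

theorem bdd_phi_inv : BddMeas Ωp fun x => (c.phi x)⁻¹ :=
  .inv h.meas_phi (inv_pos.2 h.K_pos) fun x hx => (h.phi_mem x hx).1

theorem bdd_a : BddMeas Ωp c.a :=
  .of_mem_Icc h.meas_a fun x hx => Ioc_subset_Icc_self (h.a_mem x hx)

theorem bdd_rhoP : BddMeas Ωp c.rhoP :=
  (h.bdd_phi.mul h.bdd_rhoF).add (h.bdd_phi.one_sub.mul h.bdd_rhoS)

theorem bdd_rhoW : BddMeas Ωp c.rhoW := (h.bdd_a.mul h.bdd_phi_inv).mul h.bdd_rhoF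

theorem bdd_rhoU : BddMeas Ωp c.rhoU := by
  have := (h.bdd_phi.one_sub.mul h.bdd_rhoS).mul (.const 2⁻¹)
  exact this

theorem bdd_eta_div_k : BddMeas Ωp fun x => c.eta x / c.k x :=
  (BddMeas.of_mem_Icc h.meas_eta h.eta_mem).mul
    (.inv h.meas_k (inv_pos.2 h.K_pos) fun x hx => (h.k_mem x hx).1)

theorem bdd_k_div_eta : BddMeas Ωp fun x => c.k x / c.eta x :=
  (BddMeas.of_mem_Icc h.meas_k h.k_mem).mul
    (.inv h.meas_eta (inv_pos.2 h.K_pos) fun x hx => (h.eta_mem x hx).1)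

theorem bdd_inv_rhoE_zeta : BddMeas Ωe fun x => (2 * c.rhoE x * c.zeta x)⁻¹ := by
  have hK := inv_pos.2 h.K_pos
  refine .inv ((measurable_const.mul h.meas_rhoE).mul h.meas_zeta)
    (a := 2 * K⁻¹ * K⁻¹) (by positivity) fun x hx => ?_
  have := (h.rhoE_mem x hx).1
  have := (h.zeta_memE hx).1
  have := h.rhoE_pos hx
  gcongr

theorem bdd_inv_rhoP_zeta : BddMeas Ωp fun x => (2 * c.rhoP x * c.zeta x)⁻¹ := by
  have hK := inv_pos.2 h.K_pos
  refine .inv ((measurable_const.mul h.bdd_rhoP.meas).mul h.meas_zeta)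
    (a := 2 * (K⁻¹ * K⁻¹) * K⁻¹) (by positivity) fun x hx => ?_
  have := h.rhoP_ge hx
  have := (h.zeta_memP hx).1
  have := h.rhoP_pos hx
  gcongr

end Material.Admissible

/-! ### Bilinearity of the forms on the discrete space -/

section LinearFields

variable {d : ℕ} {Ωe Ωp : Set (Pt d)} {M : PolytopicMesh d Ωe Ωp}
variable {W : Type*} [AddCommGroup W] [Module ℝ W]

/-- A broken polynomial field depending linearly on a parameter. -/
structure IsLinearField (deg : M.Cell → ℕ) (v : W → Broken M) : Prop where
  poly : ∀ w, IsBrokenPoly deg (v w)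
  lin : ∀ κ x i, IsLinearMap ℝ fun w => v w κ x i

theorem isBilin_ddot {A B : W → Matrix (Fin d) (Fin d) ℝ} (hA : ∀ i j, IsLinearMap ℝ fun w => A w i j)
    (hB : ∀ i j, IsLinearMap ℝ fun w => B w i j) : IsBilin fun u w => ddot (A u) (B w) :=
  .sum _ fun i _ => .sum _ fun j _ => .mul (hA i j) (hB i j)

theorem isBilin_inner {a b : W → Pt d} (ha : ∀ i, IsLinearMap ℝ fun w => a w i)
    (hb : ∀ i, IsLinearMap ℝ fun w => b w i) : IsBilin fun u w => inner ℝ (a u) (b w) := by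
  have h : ∀ u w, inner ℝ (a u) (b w) = ∑ i, a u i * b w i := by
    intro u w
    simp [PiLp.inner_apply, mul_comm]
  simp only [h]
  exact .sum _ fun i _ => .mul (ha i) (hb i)

theorem isLinearMap_inner_const {a : W → Pt d} (ha : ∀ i, IsLinearMap ℝ fun w => a w i) (n : Pt d) :
    IsLinearMap ℝ fun w => inner ℝ (a w) n := by
  have h : ∀ w, inner ℝ (a w) n = ∑ i, a w i * n i := by
    intro w
    simp [PiLp.inner_apply, mul_comm]
  simp only [h]
  exact isLinearMap_sum _ fun i _ => isLinearMap_mul_const _ (ha i)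

namespace IsLinearField

variable {deg : M.Cell → ℕ} {v : W → Broken M} (hv : IsLinearField deg v) {c : Material M}
  {U : W → Triple M}

include hv

theorem map_add (u w : W) (κ : M.Cell) : v (u + w) κ = fun x => v u κ x + v w κ x := by
  ext x i
  exact (hv.lin κ x i).map_add u w

theorem map_smul (a : ℝ) (w : W) (κ : M.Cell) : v (a • w) κ = fun x => a • v w κ x := by
  ext x i
  exact (hv.lin κ x i).map_smul a w

theorem partialD (κ : M.Cell) (x : Pt d) (i j : Fin d) :
    IsLinearMap ℝ fun w => PoroDG.partialD (v w κ) x i j := by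
  constructor
  · intro u w
    rw [hv.map_add, partialD_add (hv.poly u κ) (hv.poly w κ)]
  · intro a w
    rw [hv.map_smul, partialD_smul a (hv.poly w κ), smul_eq_mul]

theorem strain (κ : M.Cell) (x : Pt d) (i j : Fin d) :
    IsLinearMap ℝ fun w => PoroDG.strain (v w κ) x i j :=
  isLinearMap_mul_const _ (isLinearMap_add (hv.partialD κ x i j) (hv.partialD κ x j i))

theorem divg (κ : M.Cell) (x : Pt d) : IsLinearMap ℝ fun w => PoroDG.divg (v w κ) x :=
  isLinearMap_sum _ fun i _ => hv.partialD κ x i i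

theorem stress (κ : M.Cell) (x : Pt d) (i j : Fin d) :
    IsLinearMap ℝ fun w => PoroDG.stress c (v w) κ x i j := by
  have h : ∀ w, PoroDG.stress c (v w) κ x i j = 2 * c.mu κ * PoroDG.strain (v w κ) x i j +
      PoroDG.divg (v w κ) x * (c.lam κ * (1 : Matrix (Fin d) (Fin d) ℝ) i j) := by
    intro w
    simp [PoroDG.stress, elast, trace_strain]
    ring
  simp only [h]
  exact isLinearMap_add (isLinearMap_const_mul _ (hv.strain κ x i j))
    (isLinearMap_mul_const _ (hv.divg κ x))

theorem jump (F : M.Face) (x : Pt d) (i j : Fin d) :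
    IsLinearMap ℝ fun w => PoroDG.jump (v w) F x i j := by
  have h : ∀ w, PoroDG.jump (v w) F x i j = ∑ κ ∈ M.adj F, v w κ x i * M.normal κ F j := by
    intro w
    simp [PoroDG.jump, Matrix.sum_apply, Matrix.vecMulVec_apply]
  simp only [h]
  exact isLinearMap_sum _ fun κ _ => isLinearMap_mul_const _ (hv.lin κ x i)

theorem jumpN (F : M.Face) (x : Pt d) : IsLinearMap ℝ fun w => PoroDG.jumpN (v w) F x :=
  isLinearMap_sum _ fun κ _ => isLinearMap_inner_const (hv.lin κ x) _

theorem avg_stress (F : M.Face) (x : Pt d) (i j : Fin d) :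
    IsLinearMap ℝ fun w => avg (fun κ => PoroDG.stress c (v w) κ x) F i j := by
  have h : ∀ w, avg (fun κ => PoroDG.stress c (v w) κ x) F i j =
      ((M.adj F).card : ℝ)⁻¹ * ∑ κ ∈ M.adj F, PoroDG.stress c (v w) κ x i j := by
    intro w
    simp [avg, Matrix.sum_apply]
  simp only [h]
  exact isLinearMap_const_mul _ (isLinearMap_sum _ fun κ _ => hv.stress κ x i j)

theorem avg_divg (F : M.Face) (x : Pt d) :
    IsLinearMap ℝ fun w => avg (fun κ => c.m κ * PoroDG.divg (v w κ) x) F :=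
  isLinearMap_const_mul _ (isLinearMap_sum _ fun κ _ => isLinearMap_const_mul _ (hv.divg κ x))

omit hv in
theorem flux (hp : IsLinearField deg fun w => (U w).p) (hf : IsLinearField deg fun w => (U w).f) :
    IsLinearField deg fun w => PoroDG.flux c (U w) :=
  ⟨fun w => .flux c (hp.poly w) (hf.poly w), fun κ x i =>
    isLinearMap_add (isLinearMap_const_mul _ (hp.lin κ x i)) (hf.lin κ x i)⟩

omit hv in
theorem fluxI (hp : IsLinearField deg fun w => (U w).p) (hf : IsLinearField deg fun w => (U w).f) :
    IsLinearField deg fun w => PoroDG.fluxI c (U w) :=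
  ⟨fun w => .fluxI c (hp.poly w) (hf.poly w), fun κ x i =>
    isLinearMap_add (isLinearMap_const_mul _ (hp.lin κ x i)) (hf.lin κ x i)⟩

theorem isBilin_integral_inner {v' : W → Broken M} (hv' : IsLinearField deg v') (κ : M.Cell)
    {w : Pt d → ℝ} (hw : BddMeas (M.cell κ) w) :
    IsBilin fun u u' => ∫ x in M.cell κ, w x * inner ℝ (v u κ x) (v' u' κ x) :=
  .integral (fun x => (isBilin_inner (hv.lin κ x) (hv'.lin κ x)).const_mul _) fun u u' =>
    hw.integrableOn_mul (M.cell_open κ).measurableSet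
      (M.integrableOn_cell κ ((hv.poly u κ).continuous.inner (hv'.poly u' κ).continuous))

theorem isBilin_elasticForm (hd : 1 ≤ d) (c₁ : ℝ) (R : Finset M.Cell) (Fs : Finset M.Face)
    {ρ : Pt d → ℝ} (hρ : ∀ κ ∈ R, BddMeas (M.cell κ) fun x => ρ x * c.zeta x ^ 2) :
    IsBilin fun u w => elasticForm c deg c₁ R Fs ρ (v u) (v w) := by
  have hstress := fun u κ => continuous_stress (c := c) (hv.poly u) κ
  have hjump := fun u F => continuous_jump (hv.poly u) F
  refine .add (.sub (.sub (.add ?_ ?_) ?_) ?_) ?_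
  · exact .sum _ fun κ _ => .integral
      (fun x => isBilin_ddot (hv.stress κ x) (hv.strain κ x)) fun u w =>
      M.integrableOn_cell κ (continuous_ddot (hstress u κ) (continuous_strain (hv.poly w) κ))
  · exact .sum _ fun κ hκ => hv.isBilin_integral_inner hv κ (hρ κ hκ)
  · exact .sum _ fun F _ => .integral
      (fun x => isBilin_ddot (hv.avg_stress F x) (hv.jump F x)) fun u w =>
      M.integrableOn_face hd F (continuous_ddot (continuous_avg (hstress u) F) (hjump w F))
  · exact .sum _ fun F _ => .integral
      (fun x => isBilin_ddot (hv.jump F x) (hv.avg_stress F x)) fun u w =>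
      M.integrableOn_face hd F (continuous_ddot (hjump u F) (continuous_avg (hstress w) F))
  · exact .sum _ fun F _ => .integral
      (fun x => (isBilin_ddot (hv.jump F x) (hv.jump F x)).const_mul _) fun u w =>
      M.integrableOn_face hd F (continuous_const.mul (continuous_ddot (hjump u F) (hjump w F)))

theorem isBilin_pressureForm (hd : 1 ≤ d) (c₂ : ℝ) :
    IsBilin fun u w => pressureForm c deg c₂ (v u) (v w) := by
  have hdiv := fun u κ => continuous_divg (hv.poly u) κ
  have hmdiv : ∀ u κ, Continuous fun x => c.m κ * PoroDG.divg (v u κ) x := fun u κ =>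
    continuous_const.mul (hdiv u κ)
  have hjump := fun u F => continuous_jumpN (hv.poly u) F
  refine .add (.sub (.sub ?_ ?_) ?_) ?_
  · exact .sum _ fun κ _ => .integral
      (fun x => .mul (isLinearMap_const_mul _ (hv.divg κ x)) (hv.divg κ x)) fun u w =>
      M.integrableOn_cell κ ((hmdiv u κ).mul (hdiv w κ))
  · exact .sum _ fun F _ => .integral (fun x => .mul (hv.avg_divg F x) (hv.jumpN F x)) fun u w =>
      M.integrableOn_face hd F ((continuous_avg (hmdiv u) F).mul (hjump w F))
  · exact .sum _ fun F _ => .integral (fun x => .mul (hv.jumpN F x) (hv.avg_divg F x)) fun u w =>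
      M.integrableOn_face hd F ((hjump u F).mul (continuous_avg (hmdiv w) F))
  · exact .sum _ fun F _ => .integral
      (fun x => (IsBilin.mul (hv.jumpN F x) (hv.jumpN F x)).const_mul _) fun u w =>
      M.integrableOn_face hd F (continuous_const.mul ((hjump u F).mul (hjump w F)))

end IsLinearField

/-- A triple of broken polynomial fields depending linearly on a parameter. -/
structure IsLinearTriple (deg : M.Cell → ℕ) (U : W → Triple M) : Prop where
  e : IsLinearField deg fun w => (U w).e
  p : IsLinearField deg fun w => (U w).p
  f : IsLinearField deg fun w => (U w).f

namespace IsLinearTriple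

variable {deg : M.Cell → ℕ} {U : W → Triple M} (hU : IsLinearTriple deg U) {c : Material M}

include hU

theorem jumpI (F : M.Face) (x : Pt d) (i : Fin d) :
    IsLinearMap ℝ fun w => PoroDG.jumpI (U w) F x i := by
  have h : ∀ w, PoroDG.jumpI (U w) F x i =
      (∑ κ ∈ M.adjP F, (U w).p κ x i) - ∑ κ ∈ M.adjE F, (U w).e κ x i := by
    intro w
    simp [PoroDG.jumpI, trP, trE]
  simp only [h]
  exact isLinearMap_sub (isLinearMap_sum _ fun κ _ => hU.p.lin κ x i)
    (isLinearMap_sum _ fun κ _ => hU.e.lin κ x i)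

theorem filtI (F : M.Face) (x : Pt d) : IsLinearMap ℝ fun w => PoroDG.filtI c (U w) F x := by
  refine isLinearMap_inner_const (fun i => ?_) _
  have h : ∀ w, trP (fun κ => PoroDG.fluxI c (U w) κ x) F i =
      ∑ κ ∈ M.adjP F, PoroDG.fluxI c (U w) κ x i := by
    intro w
    simp [trP]
  simp only [h]
  exact isLinearMap_sum _ fun κ _ => (IsLinearField.fluxI hU.p hU.f).lin κ x i

theorem tractionI (F : M.Face) (x : Pt d) (i : Fin d) :
    IsLinearMap ℝ fun w => PoroDG.tractionI c (U w) F x i := by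
  have h : ∀ w, PoroDG.tractionI c (U w) F x i =
      ∑ j, (∑ κ ∈ M.adjE F, stress c (U w).e κ x i j) * nP F j := by
    intro w
    simp [PoroDG.tractionI, traction, trE, Matrix.mulVec, dotProduct, Matrix.sum_apply]
  simp only [h]
  exact isLinearMap_sum _ fun j _ => isLinearMap_mul_const _
    (isLinearMap_sum _ fun κ _ => hU.e.stress κ x i j)

theorem pressI (F : M.Face) (x : Pt d) : IsLinearMap ℝ fun w => PoroDG.pressI c (U w) F x :=
  isLinearMap_sum _ fun κ _ => isLinearMap_const_mul _ ((IsLinearField.flux hU.p hU.f).divg κ x)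

theorem isBilin_Ch (hd : 1 ≤ d) (c₁ c₂ : ℝ) :
    IsBilin fun u w => Ch c deg c₁ c₂ (U u) (U w) := by
  refine .sum _ fun F _ => .integral (fun x => ?_) fun u w => M.integrableOn_face hd F ?_
  · exact .add (.sub (.sub (.add (.sub (.neg (isBilin_inner (hU.tractionI F x) (hU.jumpI F x)))
      (isBilin_inner (hU.tractionI F x) (hU.jumpI F x)).swap)
      ((isBilin_inner (hU.jumpI F x) (hU.jumpI F x)).const_mul _))
      (.mul (hU.pressI F x) (hU.filtI F x))) (IsBilin.mul (hU.pressI F x) (hU.filtI F x)).swap)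
      ((IsBilin.mul (hU.filtI F x) (hU.filtI F x)).const_mul _)
  · have h1 := fun w => continuous_jumpI (hU.e.poly w) (hU.p.poly w) F
    have h2 := fun w => continuous_tractionI (c := c) (hU.e.poly w) F
    have h3 := fun w => continuous_pressI (c := c) (hU.p.poly w) (hU.f.poly w) F
    have h4 := fun w => continuous_filtI (c := c) (hU.p.poly w) (hU.f.poly w) F
    have := h1 u; have := h1 w; have := h2 u; have := h2 w
    have := h3 u; have := h3 w; have := h4 u; have := h4 w
    fun_prop

variable {K : ℝ} (hc : c.Admissible K)

include hc

theorem isBilin_Ah (hd : 1 ≤ d) (c₁ c₂ : ℝ) :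
    IsBilin fun u w => Ah c deg c₁ c₂ (U u) (U w) := by
  refine .add (.add (hU.e.isBilin_elasticForm hd c₁ _ _ fun κ hκ => ?_)
    (hU.p.isBilin_elasticForm hd c₁ _ _ fun κ hκ => ?_))
    ((IsLinearField.flux hU.p hU.f).isBilin_pressureForm hd c₂)
  · simp only [sq]
    exact (hc.bdd_rhoE.mul (hc.bdd_zetaE.mul hc.bdd_zetaE)).mono (M.mem_cellsE.1 hκ)
  · simp only [sq]
    exact (hc.bdd_rhoP.mul (hc.bdd_zetaP.mul hc.bdd_zetaP)).mono (M.mem_cellsP.1 hκ)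

theorem isBilin_dampForm : IsBilin fun u w => dampForm c (U u) (U w) := by
  refine .add (.add (.sum _ fun κ hκ => hU.e.isBilin_integral_inner hU.e κ ?_)
    (.sum _ fun κ hκ => hU.p.isBilin_integral_inner hU.p κ ?_))
    (.sum _ fun κ hκ => hU.f.isBilin_integral_inner hU.f κ ?_)
  · exact (((BddMeas.const 2).mul hc.bdd_rhoE).mul hc.bdd_zetaE).mono (M.mem_cellsE.1 hκ)
  · exact (((BddMeas.const 2).mul hc.bdd_rhoP).mul hc.bdd_zetaP).mono (M.mem_cellsP.1 hκ)
  · exact hc.bdd_eta_div_k.mono (M.mem_cellsP.1 hκ)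

/-- Bounded densities make each summand integrable, so the integrals may be split. Symmetry is then
visible: both off-diagonal terms carry the coefficient `ρ_f`. -/
theorem massForm_eq (u w : W) : massForm c (U u) (U w) =
    (∑ κ ∈ M.cellsE, ∫ x in M.cell κ, c.rhoE x * inner ℝ ((U u).e κ x) ((U w).e κ x)) +
    (∑ κ ∈ M.cellsP, ((∫ x in M.cell κ, c.rhoP x * inner ℝ ((U u).p κ x) ((U w).p κ x)) +
      ∫ x in M.cell κ, c.rhoF x * inner ℝ ((U u).f κ x) ((U w).p κ x))) +
    ∑ κ ∈ M.cellsP, ((∫ x in M.cell κ, c.rhoF x * inner ℝ ((U u).p κ x) ((U w).f κ x)) +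
      ∫ x in M.cell κ, c.rhoW x * inner ℝ ((U u).f κ x) ((U w).f κ x)) := by
  have hint : ∀ κ ∈ M.cellsP, ∀ {ρ : Pt d → ℝ}, BddMeas Ωp ρ → ∀ {g g' : Pt d → Pt d},
      Continuous g → Continuous g' →
      Integrable (fun x => ρ x * inner ℝ (g x) (g' x)) (volume.restrict (M.cell κ)) := by
    intro κ hκ ρ hρ g g' hg hg'
    exact (hρ.mono (M.mem_cellsP.1 hκ)).integrableOn_mul (M.cell_open κ).measurableSet
      (M.integrableOn_cell κ (hg.inner hg'))
  have hp := fun w κ => (hU.p.poly w κ).continuous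
  have hf := fun w κ => (hU.f.poly w κ).continuous
  rw [massForm]
  congr 1
  · congr 1
    refine Finset.sum_congr rfl fun κ hκ => ?_
    rw [← integral_add (hint κ hκ hc.bdd_rhoP (hp u κ) (hp w κ))
      (hint κ hκ hc.bdd_rhoF (hf u κ) (hp w κ))]
    simp only [inner_add_left, inner_smul_left, RCLike.conj_to_real]
  · refine Finset.sum_congr rfl fun κ hκ => ?_
    rw [← integral_add (hint κ hκ hc.bdd_rhoF (hp u κ) (hf w κ))
      (hint κ hκ hc.bdd_rhoW (hf u κ) (hf w κ))]
    simp only [inner_add_left, inner_smul_left, RCLike.conj_to_real]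

theorem isBilin_massForm : IsBilin fun u w => massForm c (U u) (U w) := by
  simp only [hU.massForm_eq hc]
  refine .add (.add (.sum _ fun κ hκ => hU.e.isBilin_integral_inner hU.e κ ?_)
    (.sum _ fun κ hκ => .add (hU.p.isBilin_integral_inner hU.p κ ?_)
      (hU.f.isBilin_integral_inner hU.p κ ?_)))
    (.sum _ fun κ hκ => .add (hU.p.isBilin_integral_inner hU.f κ ?_)
      (hU.f.isBilin_integral_inner hU.f κ ?_))
  · exact hc.bdd_rhoE.mono (M.mem_cellsE.1 hκ)
  · exact hc.bdd_rhoP.mono (M.mem_cellsP.1 hκ)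
  · exact hc.bdd_rhoF.mono (M.mem_cellsP.1 hκ)
  · exact hc.bdd_rhoF.mono (M.mem_cellsP.1 hκ)
  · exact hc.bdd_rhoW.mono (M.mem_cellsP.1 hκ)

theorem massForm_comm (u w : W) : massForm c (U u) (U w) = massForm c (U w) (U u) := by
  rw [hU.massForm_eq hc, hU.massForm_eq hc]
  simp only [Finset.sum_add_distrib, real_inner_comm ((U w).e _ _), real_inner_comm ((U w).p _ _),
    real_inner_comm ((U w).f _ _)]
  ring

end IsLinearTriple

theorem elasticForm_comm (c : Material M) (deg : M.Cell → ℕ) (c₁ : ℝ) (R : Finset M.Cell)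
    (Fs : Finset M.Face) (ρ : Pt d → ℝ) (u v : Broken M) :
    elasticForm c deg c₁ R Fs ρ u v = elasticForm c deg c₁ R Fs ρ v u := by
  have h : ∀ κ x, ddot (stress c u κ x) (strain (v κ) x) =
      ddot (stress c v κ x) (strain (u κ) x) := by
    intro κ x
    rw [stress, stress, ddot_elast_left, ddot_elast_left, ddot_comm (strain (u κ) x)]
    ring
  simp only [elasticForm, h, real_inner_comm (v _ _), ddot_comm (jump u _ _),
    ddot_comm (jump v _ _) (avg _ _)]
  ring

theorem pressureForm_comm (c : Material M) (deg : M.Cell → ℕ) (c₂ : ℝ) (u v : Broken M) :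
    pressureForm c deg c₂ u v = pressureForm c deg c₂ v u := by
  simp only [pressureForm, mul_assoc, mul_comm (divg (u _) _) (divg (v _) _),
    mul_comm (jumpN u _ _), mul_comm (jumpN v _ _) (avg _ _)]
  ring

theorem Ah_comm (c : Material M) (deg : M.Cell → ℕ) (c₁ c₂ : ℝ) (U V : Triple M) :
    Ah c deg c₁ c₂ U V = Ah c deg c₁ c₂ V U := by
  rw [Ah, Ah, elasticForm_comm c deg c₁ _ _ _ U.e, elasticForm_comm c deg c₁ _ _ _ U.p,
    pressureForm_comm]

theorem Ch_comm (c : Material M) (deg : M.Cell → ℕ) (c₁ c₂ : ℝ) (U V : Triple M) :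
    Ch c deg c₁ c₂ U V = Ch c deg c₁ c₂ V U := by
  refine Finset.sum_congr rfl fun F _ => ?_
  congr 1
  ext x
  rw [real_inner_comm (jumpI U F x) (jumpI V F x)]
  ring

end LinearFields

/-! ### The discrete space as a finite-dimensional space of functions -/

section DiscreteSpace

variable {d : ℕ} {Ωe Ωp : Set (Pt d)} (M : PolytopicMesh d Ωe Ωp)

/-- Labels of the point values of the components of a triple of fields. -/
abbrev ValueIndex : Type := Fin 3 × M.Cell × Pt d × Fin d

variable {M}

/-- The triple of fields with given point values. -/
def tripleOf (w : ValueIndex M → ℝ) : Triple M where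
  e κ x := WithLp.toLp 2 fun i => w (0, κ, x, i)
  p κ x := WithLp.toLp 2 fun i => w (1, κ, x, i)
  f κ x := WithLp.toLp 2 fun i => w (2, κ, x, i)

/-- The point values of a triple of fields. -/
def pointValues (U : Triple M) : ValueIndex M → ℝ :=
  fun q => ![U.e, U.p, U.f] q.1 q.2.1 q.2.2.1 q.2.2.2

theorem tripleOf_pointValues (U : Triple M) : tripleOf (pointValues U) = U := rfl

theorem IsPiecewisePoly.add {deg : M.Cell → ℕ} {R : Finset M.Cell} {u v : Broken M}
    (hu : IsPiecewisePoly M deg R u) (hv : IsPiecewisePoly M deg R v) :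
    IsPiecewisePoly M deg R (fun κ x => u κ x + v κ x) := by
  refine ⟨fun κ hκ => (hu.1 κ hκ).add (hv.1 κ hκ), fun κ hκ => ?_⟩
  ext x
  simp [hu.2 κ hκ, hv.2 κ hκ]

theorem IsPiecewisePoly.smul {deg : M.Cell → ℕ} {R : Finset M.Cell} {u : Broken M} (a : ℝ)
    (hu : IsPiecewisePoly M deg R u) : IsPiecewisePoly M deg R (fun κ x => a • u κ x) := by
  refine ⟨fun κ hκ => (hu.1 κ hκ).smul a, fun κ hκ => ?_⟩
  ext x
  simp [hu.2 κ hκ]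

theorem IsPiecewisePoly.zero {deg : M.Cell → ℕ} {R : Finset M.Cell} :
    IsPiecewisePoly M deg R (0 : Broken M) := ⟨fun _ _ => IsPolyField.zero, fun _ _ => rfl⟩

/-- The discrete space, as a space of point values. -/
def discreteSpace (deg : M.Cell → ℕ) : Submodule ℝ (ValueIndex M → ℝ) where
  carrier := {w | tripleOf w ∈ Vh M deg}
  add_mem' hu hv := ⟨hu.1.add hv.1, hu.2.1.add hv.2.1, hu.2.2.add hv.2.2⟩
  zero_mem' := ⟨.zero, .zero, .zero⟩
  smul_mem' a _ hu := ⟨hu.1.smul a, hu.2.1.smul a, hu.2.2.smul a⟩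

theorem mem_discreteSpace {deg : M.Cell → ℕ} {w : ValueIndex M → ℝ} :
    w ∈ discreteSpace deg ↔ tripleOf w ∈ Vh M deg := Iff.rfl

theorem isLinearTriple_tripleOf (deg : M.Cell → ℕ) :
    IsLinearTriple deg fun w : discreteSpace (M := M) deg => tripleOf (w : ValueIndex M → ℝ) :=
  ⟨⟨fun w => (mem_discreteSpace.1 w.2).1.isBrokenPoly, fun _ _ _ => ⟨fun _ _ => rfl, fun _ _ => rfl⟩⟩,
    ⟨fun w => (mem_discreteSpace.1 w.2).2.1.isBrokenPoly,
      fun _ _ _ => ⟨fun _ _ => rfl, fun _ _ => rfl⟩⟩,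
    ⟨fun w => (mem_discreteSpace.1 w.2).2.2.isBrokenPoly,
      fun _ _ _ => ⟨fun _ _ => rfl, fun _ _ => rfl⟩⟩⟩

/-- There are finitely many elements and components, and each is given by a polynomial of total
degree at most the largest degree `N`; the space lies in the image of finitely many copies of such a
polynomial space. -/
instance finiteDimensional_discreteSpace (deg : M.Cell → ℕ) :
    FiniteDimensional ℝ (discreteSpace (M := M) deg) := by
  let N := Finset.univ.sup deg
  let Ψ : (Fin 3 × M.Cell × Fin d → MvPolynomial.restrictTotalDegree (Fin d) ℝ N) →ₗ[ℝ]
      (ValueIndex M → ℝ) :=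
    { toFun := fun P q => MvPolynomial.eval (fun j => q.2.2.1 j)
        (P (q.1, q.2.1, q.2.2.2) : MvPolynomial (Fin d) ℝ)
      map_add' := fun P Q => by ext q; simp
      map_smul' := fun a P => by ext q; simp }
  have hle : discreteSpace (M := M) deg ≤ LinearMap.range Ψ := by
    intro w hw
    have hU := isLinearTriple_tripleOf (M := M) deg
    have key : ∀ (a : Fin 3) (κ : M.Cell) (i : Fin d), ∃ P : MvPolynomial (Fin d) ℝ,
        P.totalDegree ≤ N ∧ ∀ x : Pt d, w (a, κ, x, i) = MvPolynomial.eval (fun j => x j) P := by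
      intro a κ i
      have hN : deg κ ≤ N := Finset.le_sup (Finset.mem_univ κ)
      fin_cases a
      · obtain ⟨P, hP, h⟩ := hU.e.poly ⟨w, hw⟩ κ i
        exact ⟨P, hP.trans hN, h⟩
      · obtain ⟨P, hP, h⟩ := hU.p.poly ⟨w, hw⟩ κ i
        exact ⟨P, hP.trans hN, h⟩
      · obtain ⟨P, hP, h⟩ := hU.f.poly ⟨w, hw⟩ κ i
        exact ⟨P, hP.trans hN, h⟩
    choose P hP hPw using key
    refine ⟨fun q => ⟨P q.1 q.2.1 q.2.2, (MvPolynomial.mem_restrictTotalDegree _ _ _).2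
      (hP q.1 q.2.1 q.2.2)⟩, ?_⟩
    ext q
    exact (hPw q.1 q.2.1 q.2.2.2 q.2.2.1).symm
  exact Submodule.finiteDimensional_of_le hle

end DiscreteSpace

/-! ### Time dependence -/

section Time

variable {d : ℕ} {Ωe Ωp : Set (Pt d)} {M : PolytopicMesh d Ωe Ωp}

/-- Scalar version of `HasTimeDerivs`. -/
structure HasScalarTimeDerivs (T : ℝ) (g g' g'' : ℝ → ℝ) : Prop where
  integrable₂ : IntervalIntegrable g'' volume 0 T
  eq₁ : ∀ t ∈ Icc 0 T, g' t = g' 0 + ∫ s in (0 : ℝ)..t, g'' s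
  continuousOn₁ : ContinuousOn g' (Icc 0 T)
  integrable₁ : IntervalIntegrable g' volume 0 T
  eq₀ : ∀ t ∈ Icc 0 T, g t = g 0 + ∫ s in (0 : ℝ)..t, g' s

/-- Coordinate projections commute with derivatives and integrals. Being a primitive, `u'` is
continuous, so `u` is itself recovered by integration; both orders then have the integral form that
`IsBilin.energy_identity` takes. -/
theorem HasTimeDerivs.scalar {T : ℝ} (hT : 0 ≤ T) {u u' u'' : ℝ → Broken M}
    (h : HasTimeDerivs T u u' u'') (κ : M.Cell) (x : Pt d) (i : Fin d) :
    HasScalarTimeDerivs T (fun t => u t κ x i) (fun t => u' t κ x i) fun t => u'' t κ x i := by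
  obtain ⟨h1, h2, h3⟩ := h κ x
  let π : Pt d →L[ℝ] ℝ := EuclideanSpace.proj i
  have hint : IntervalIntegrable (fun t => u'' t κ x i) volume 0 T :=
    ⟨π.integrable_comp h2.1, π.integrable_comp h2.2⟩
  have heq : ∀ t ∈ Icc 0 T, u' t κ x i = u' 0 κ x i + ∫ s in (0 : ℝ)..t, u'' s κ x i := by
    intro t ht
    have hsub : uIcc 0 t ⊆ uIcc 0 T := by
      rw [uIcc_of_le ht.1, uIcc_of_le hT]
      exact Icc_subset_Icc_right ht.2
    have h4 := congrArg π (h3 t ht)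
    rw [map_add, ← π.intervalIntegral_comp_comm (h2.mono_set hsub)] at h4
    exact h4
  have hcont : ContinuousOn (fun t => u' t κ x i) (Icc 0 T) := by
    have h5 : ContinuousOn (fun t => u' 0 κ x i + ∫ s in (0 : ℝ)..t, u'' s κ x i) (Icc 0 T) := by
      refine continuousOn_const.add ?_
      rw [← uIcc_of_le hT]
      exact intervalIntegral.continuousOn_primitive_interval' hint left_mem_uIcc
    exact h5.congr heq
  have hint1 : IntervalIntegrable (fun t => u' t κ x i) volume 0 T := by
    refine ContinuousOn.intervalIntegrable ?_
    rwa [uIcc_of_le hT]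
  have hd : ∀ t ∈ Icc 0 T, HasDerivWithinAt (fun t => u t κ x i) (u' t κ x i) (Icc 0 T) t :=
    fun t ht => by
      have h6 := (π.hasFDerivAt (x := u t κ x)).comp_hasDerivWithinAt t (h1 t ht)
      exact h6
  refine ⟨hint, heq, hcont, hint1, fun t ht => ?_⟩
  have hsub : Icc 0 t ⊆ Icc 0 T := Icc_subset_Icc_right ht.2
  have h6 := intervalIntegral.integral_eq_sub_of_hasDerivAt_of_le ht.1
    (f := fun t => u t κ x i) (f' := fun t => u' t κ x i)
    (fun s hs => ((hd s (hsub hs)).continuousWithinAt).mono hsub)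
    (fun s hs => (hd s (hsub (Ioo_subset_Icc_self hs))).hasDerivAt
      (Icc_mem_nhds hs.1 (hs.2.trans_le ht.2)))
    (hint1.mono_set (by rw [uIcc_of_le ht.1, uIcc_of_le hT]; exact hsub))
  rw [h6]
  ring

variable {c : Material M} {deg : M.Cell → ℕ} {c₁ c₂ T : ℝ} {fe fp gp : ℝ → Pt d → Pt d}
  {U U' U'' : ℝ → Triple M}

/-- A curve of triples, restricted to a time interval and read as a curve in the discrete space. -/
def discreteCurve {s : Set ℝ} {V : ℝ → Triple M} (hV : ∀ t ∈ s, V t ∈ Vh M deg) (t : ℝ) :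
    discreteSpace (M := M) deg :=
  open Classical in if ht : t ∈ s then ⟨pointValues (V t), hV t ht⟩ else 0

theorem discreteCurve_apply {s : Set ℝ} {V : ℝ → Triple M} (hV : ∀ t ∈ s, V t ∈ Vh M deg) {t : ℝ}
    (ht : t ∈ s) : (discreteCurve hV t : ValueIndex M → ℝ) = pointValues (V t) := by
  simp [discreteCurve, ht]

theorem tripleOf_discreteCurve {s : Set ℝ} {V : ℝ → Triple M} (hV : ∀ t ∈ s, V t ∈ Vh M deg)
    {t : ℝ} (ht : t ∈ s) : tripleOf (discreteCurve hV t : ValueIndex M → ℝ) = V t := by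
  rw [discreteCurve_apply hV ht, tripleOf_pointValues]

theorem IsSemidiscreteSolution.pointValues_timeDerivs (hT : 0 ≤ T)
    (h : IsSemidiscreteSolution c deg c₁ c₂ T fe fp gp U U' U'') (q : ValueIndex M) :
    HasScalarTimeDerivs T (fun t => pointValues (U t) q) (fun t => pointValues (U' t) q)
      fun t => pointValues (U'' t) q := by
  obtain ⟨a, κ, x, i⟩ := q
  fin_cases a
  · exact h.deriv_e.scalar hT κ x i
  · exact h.deriv_p.scalar hT κ x i
  · exact h.deriv_f.scalar hT κ x i

/-- Energy identity for the mass and stiffness forms, before use of the equation. -/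
theorem IsSemidiscreteSolution.energy_identity (hd : 1 ≤ d) (hT : 0 ≤ T) {K : ℝ}
    (hc : c.Admissible K) (h : IsSemidiscreteSolution c deg c₁ c₂ T fe fp gp U U' U'')
    {t : ℝ} (ht : t ∈ Icc 0 T) :
    IntervalIntegrable (fun s => massForm c (U'' s) (U' s) + (Ah c deg c₁ c₂ (U s) (U' s) +
      Ch c deg c₁ c₂ (U s) (U' s))) volume 0 t ∧
    massForm c (U' t) (U' t) + (Ah c deg c₁ c₂ (U t) (U t) + Ch c deg c₁ c₂ (U t) (U t)) =
      massForm c (U' 0) (U' 0) + (Ah c deg c₁ c₂ (U 0) (U 0) + Ch c deg c₁ c₂ (U 0) (U 0)) +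
      2 * ∫ s in (0 : ℝ)..t, (massForm c (U'' s) (U' s) + (Ah c deg c₁ c₂ (U s) (U' s) +
        Ch c deg c₁ c₂ (U s) (U' s))) := by
  have hL := isLinearTriple_tripleOf (M := M) deg
  have hm0 := fun t ht => (h.mem t ht).1
  have hm1 := fun t ht => (h.mem t ht).2.1
  have hm2 := fun t ht => (h.mem t ht).2.2
  have h0 : (0 : ℝ) ∈ Icc 0 T := left_mem_Icc.2 hT
  have hsub : ∀ s ∈ uIoc (0 : ℝ) t, s ∈ Icc 0 T := by
    intro s hs
    rw [uIoc_of_le ht.1] at hs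
    exact ⟨hs.1.le, hs.2.trans ht.2⟩
  have hsubT : ∀ s ∈ uIoc (0 : ℝ) T, s ∈ Icc 0 T := by
    intro s hs
    rw [uIoc_of_le hT] at hs
    exact ⟨hs.1.le, hs.2⟩
  have hder := h.pointValues_timeDerivs hT
  have hint2 : ∀ q, IntervalIntegrable
      (fun t => (discreteCurve hm2 t : ValueIndex M → ℝ) q) volume 0 T := fun q =>
    (hder q).integrable₂.congr fun s hs => by
      simp only [discreteCurve_apply hm2 (hsubT s hs)]
  have hint1 : ∀ q, IntervalIntegrable
      (fun t => (discreteCurve hm1 t : ValueIndex M → ℝ) q) volume 0 T := fun q =>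
    (hder q).integrable₁.congr fun s hs => by
      simp only [discreteCurve_apply hm1 (hsubT s hs)]
  have hcongr : ∀ (V : ℝ → Triple M) (hV : ∀ t ∈ Icc 0 T, V t ∈ Vh M deg) (q : ValueIndex M),
      ∀ t ∈ Icc 0 T, ∫ s in (0 : ℝ)..t, (discreteCurve hV s : ValueIndex M → ℝ) q =
        ∫ s in (0 : ℝ)..t, pointValues (V s) q := by
    intro V hV q t ht
    refine intervalIntegral.integral_congr fun s hs => ?_
    rw [uIcc_of_le ht.1] at hs
    simp only [discreteCurve_apply hV ⟨hs.1, hs.2.trans ht.2⟩]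
  -- The mass form is followed along the velocity and the stiffness form along the displacement; the
  -- two integrands add up to the equation tested with `U'`.
  have hM := (hL.isBilin_massForm hc).energy_identity (hL.massForm_comm hc)
    (f := discreteCurve hm1) (f' := discreteCurve hm2) hint2 (fun q t ht => by
      rw [discreteCurve_apply hm1 ht, discreteCurve_apply hm1 h0, hcongr _ hm2 q t ht]
      exact (hder q).eq₁ t ht) ht
  have hS := ((hL.isBilin_Ah hc hd c₁ c₂).add (hL.isBilin_Ch (c := c) hd c₁ c₂)).energy_identity
    (fun u v => by rw [Ah_comm, Ch_comm])
    (f := discreteCurve hm0) (f' := discreteCurve hm1) hint1 (fun q t ht => by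
      rw [discreteCurve_apply hm0 ht, discreteCurve_apply hm0 h0, hcongr _ hm1 q t ht]
      exact (hder q).eq₀ t ht) ht
  simp only [tripleOf_discreteCurve hm1 ht, tripleOf_discreteCurve hm1 h0] at hM
  simp only [tripleOf_discreteCurve hm0 ht, tripleOf_discreteCurve hm0 h0] at hS
  have hM1 : IntervalIntegrable (fun s => massForm c (U'' s) (U' s)) volume 0 t :=
    hM.1.congr fun s hs => by
      simp only [tripleOf_discreteCurve hm1 (hsub s hs), tripleOf_discreteCurve hm2 (hsub s hs)]
  have hS1 : IntervalIntegrable (fun s => Ah c deg c₁ c₂ (U s) (U' s) +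
      Ch c deg c₁ c₂ (U s) (U' s)) volume 0 t :=
    hS.1.congr fun s hs => by
      simp only [tripleOf_discreteCurve hm1 (hsub s hs), tripleOf_discreteCurve hm0 (hsub s hs)]
      rw [Ah_comm, Ch_comm]
  have hMi : ∫ s in (0 : ℝ)..t, massForm c (tripleOf (discreteCurve hm2 s : ValueIndex M → ℝ))
      (tripleOf (discreteCurve hm1 s : ValueIndex M → ℝ)) =
      ∫ s in (0 : ℝ)..t, massForm c (U'' s) (U' s) := by
    refine intervalIntegral.integral_congr_ae (Filter.Eventually.of_forall fun s hs => ?_)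
    simp only [tripleOf_discreteCurve hm1 (hsub s hs), tripleOf_discreteCurve hm2 (hsub s hs)]
  have hSi : ∫ s in (0 : ℝ)..t,
      (Ah c deg c₁ c₂ (tripleOf (discreteCurve hm1 s : ValueIndex M → ℝ))
        (tripleOf (discreteCurve hm0 s : ValueIndex M → ℝ)) +
      Ch c deg c₁ c₂ (tripleOf (discreteCurve hm1 s : ValueIndex M → ℝ))
        (tripleOf (discreteCurve hm0 s : ValueIndex M → ℝ))) =
      ∫ s in (0 : ℝ)..t, (Ah c deg c₁ c₂ (U s) (U' s) + Ch c deg c₁ c₂ (U s) (U' s)) := by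
    refine intervalIntegral.integral_congr_ae (Filter.Eventually.of_forall fun s hs => ?_)
    simp only [tripleOf_discreteCurve hm1 (hsub s hs), tripleOf_discreteCurve hm0 (hsub s hs)]
    rw [Ah_comm, Ch_comm]
  refine ⟨hM1.add hS1, ?_⟩
  rw [intervalIntegral.integral_add hM1 hS1, hM.2, hS.2, hMi, hSi]
  ring

theorem IsSemidiscreteSolution.intervalIntegrable_dampForm (hT : 0 ≤ T) {K : ℝ}
    (hc : c.Admissible K) (h : IsSemidiscreteSolution c deg c₁ c₂ T fe fp gp U U' U'') :
    IntervalIntegrable (fun s => dampForm c (U' s) (U' s)) volume 0 T := by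
  have hL := isLinearTriple_tripleOf (M := M) deg
  have hm1 := fun t ht => (h.mem t ht).2.1
  have hder := h.pointValues_timeDerivs hT
  have h1 := (hL.isBilin_dampForm hc).continuousOn (s := Icc 0 T) (f := discreteCurve hm1)
    fun q => (hder q).continuousOn₁.congr fun s hs => by
      simp only [discreteCurve_apply hm1 hs]
  have h2 : ContinuousOn (fun s => dampForm c (U' s) (U' s)) (Icc 0 T) :=
    h1.congr fun s hs => by simp only [tripleOf_discreteCurve hm1 hs]
  refine ContinuousOn.intervalIntegrable ?_
  rwa [uIcc_of_le hT]

end Time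

/-! ### Bounds for the mass, damping and load forms -/

section Pointwise

variable {E : Type*} [NormedAddCommGroup E] [InnerProductSpace ℝ E]

/-- Completing the square: `ρf φ |p + φ⁻¹ f|²` uses up the whole coupling term. It leaves `(1 - φ)
ρs |p|²`, split into halves of which one is the `ρ_u` term, and `(a - 1) ρf / φ |f|²`. -/
theorem mass_density_eq {φ ρf : ℝ} (hφ : φ ≠ 0) (ρs a : ℝ) (p f : E) :
    inner ℝ ((φ * ρf + (1 - φ) * ρs) • p + ρf • f) p + inner ℝ (ρf • p + (a / φ * ρf) • f) f =
      (1 - φ) * ρs / 2 * ‖p‖ ^ 2 + ρf * φ * ‖p + φ⁻¹ • f‖ ^ 2 +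
        ((1 - φ) * ρs / 2 * ‖p‖ ^ 2 + (a - 1) * ρf / φ * ‖f‖ ^ 2) := by
  have h : ‖p + φ⁻¹ • f‖ ^ 2 = ‖p‖ ^ 2 + 2 * (φ⁻¹ * inner ℝ p f) + φ⁻¹ ^ 2 * ‖f‖ ^ 2 := by
    rw [norm_add_sq_real, inner_smul_right, norm_smul, mul_pow, Real.norm_eq_abs, sq_abs]
  rw [h]
  simp only [inner_add_left, inner_smul_left, RCLike.conj_to_real, real_inner_self_eq_norm_sq,
    real_inner_comm p f]
  field_simp
  ring

/-- Write `f = φ ((p + φ⁻¹ f) - p)`. This recovers the filtration velocity, which `normZeroSq` sees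
only through the sum with `p`. -/
theorem norm_sq_le_of_add_inv_smul {φ : ℝ} (hφ : φ ≠ 0) (p f : E) :
    ‖f‖ ^ 2 ≤ 2 * φ ^ 2 * (‖p + φ⁻¹ • f‖ ^ 2 + ‖p‖ ^ 2) := by
  have h : f = φ • ((p + φ⁻¹ • f) - p) := by
    rw [add_sub_cancel_left, smul_smul, mul_inv_cancel₀ hφ, one_smul]
  have h1 : ‖f‖ ^ 2 = φ ^ 2 * ‖(p + φ⁻¹ • f) - p‖ ^ 2 := by
    conv_lhs => rw [h, norm_smul, mul_pow, Real.norm_eq_abs, sq_abs]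
  have h2 : ‖(p + φ⁻¹ • f) - p‖ ^ 2 ≤ 2 * (‖p + φ⁻¹ • f‖ ^ 2 + ‖p‖ ^ 2) := by
    have := parallelogram_law_with_norm ℝ (p + φ⁻¹ • f) p
    nlinarith [sq_nonneg ‖(p + φ⁻¹ • f) + p‖]
  rw [h1]
  nlinarith [sq_nonneg φ]

/-- Weighted Young inequality. -/
theorem inner_le_half_weighted {w : ℝ} (hw : 0 < w) (f v : E) :
    inner ℝ f v ≤ 1 / 2 * (w * inner ℝ v v) + 1 / 2 * (w⁻¹ * ‖f‖ ^ 2) := by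
  have h1 := real_inner_le_norm f v
  have h2 : 0 ≤ w * (‖v‖ - w⁻¹ * ‖f‖) ^ 2 := by positivity
  have h3 : w * (‖v‖ - w⁻¹ * ‖f‖) ^ 2 = w * ‖v‖ ^ 2 - 2 * (‖f‖ * ‖v‖) + w⁻¹ * ‖f‖ ^ 2 := by
    field_simp
    ring
  rw [real_inner_self_eq_norm_sq]
  linarith

end Pointwise

section Bounds

variable {d : ℕ} {Ωe Ωp : Set (Pt d)} {M : PolytopicMesh d Ωe Ωp} {c : Material M} {K : ℝ}
  {deg : M.Cell → ℕ}

theorem IsBrokenPoly.integrableOn_weighted {u v : Broken M} (hu : IsBrokenPoly deg u)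
    (hv : IsBrokenPoly deg v) {Ω : Set (Pt d)} {κ : M.Cell} (hκ : M.cell κ ⊆ Ω) {w : Pt d → ℝ}
    (hw : BddMeas Ω w) : IntegrableOn (fun x => w x * inner ℝ (u κ x) (v κ x)) (M.cell κ) :=
  (hw.mono hκ).integrableOn_mul (M.cell_open κ).measurableSet
    (M.integrableOn_cell κ ((hu κ).continuous.inner (hv κ).continuous))

theorem sum_integral_cell_le {R : Finset M.Cell} {Ω : Set (Pt d)} (hR : ∀ κ ∈ R, M.cell κ ⊆ Ω)
    (hΩ : MeasurableSet Ω) {g : Pt d → ℝ} (hg : IntegrableOn g Ω) (h0 : ∀ x ∈ Ω, 0 ≤ g x) :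
    ∑ κ ∈ R, ∫ x in M.cell κ, g x ≤ ∫ x in Ω, g x := by
  rw [← integral_biUnion_finset R (fun κ _ => (M.cell_open κ).measurableSet)
    (fun κ _ κ' _ h => M.cell_disjoint κ κ' h) (fun κ hκ => hg.mono_set (hR κ hκ))]
  refine setIntegral_mono_set hg ?_ (Filter.Eventually.of_forall (iUnion₂_subset hR))
  filter_upwards [ae_restrict_mem hΩ] with x hx using h0 x hx

/-- Young's inequality for a load on the elements `R ⊆ Ω`. -/
theorem sum_integral_load_le {R : Finset M.Cell} {Ω : Set (Pt d)} (hR : ∀ κ ∈ R, M.cell κ ⊆ Ω)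
    (hΩ : MeasurableSet Ω) {w : Pt d → ℝ} (hw0 : ∀ x ∈ Ω, 0 < w x) (hw : BddMeas Ω w)
    (hw' : BddMeas Ω fun x => (w x)⁻¹) {f : Pt d → Pt d} (hf : IntegrableOn (fun x => ‖f x‖ ^ 2) Ω)
    {v : Broken M} (hv : IsBrokenPoly deg v) :
    ∑ κ ∈ R, ∫ x in M.cell κ, inner ℝ (f x) (v κ x) ≤
      1 / 2 * (∑ κ ∈ R, ∫ x in M.cell κ, w x * inner ℝ (v κ x) (v κ x)) +
      1 / 2 * ∫ x in Ω, (w x)⁻¹ * ‖f x‖ ^ 2 := by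
  have hg : IntegrableOn (fun x => (w x)⁻¹ * ‖f x‖ ^ 2) Ω := hw'.integrableOn_mul hΩ hf
  have h0 : ∀ x ∈ Ω, 0 ≤ (w x)⁻¹ * ‖f x‖ ^ 2 := fun x hx =>
    mul_nonneg (inv_nonneg.2 (hw0 x hx).le) (sq_nonneg _)
  have h1 := sum_integral_cell_le hR hΩ hg h0
  have h2 : ∀ κ ∈ R, ∫ x in M.cell κ, inner ℝ (f x) (v κ x) ≤
      1 / 2 * (∫ x in M.cell κ, w x * inner ℝ (v κ x) (v κ x)) +
      1 / 2 * ∫ x in M.cell κ, (w x)⁻¹ * ‖f x‖ ^ 2 := by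
    intro κ hκ
    have hms := (M.cell_open κ).measurableSet
    have hi1 := hv.integrableOn_weighted hv (hR κ hκ) hw
    have hi2 := hg.mono_set (hR κ hκ)
    rw [← integral_const_mul, ← integral_const_mul, ← integral_add (hi1.const_mul _)
      (hi2.const_mul _)]
    -- A nonintegrable product has integral zero by convention, and the right side is nonnegative.
    by_cases hi : IntegrableOn (fun x => inner ℝ (f x) (v κ x)) (M.cell κ)
    · exact setIntegral_mono_on hi ((hi1.const_mul _).add (hi2.const_mul _)) hms fun x hx =>
        inner_le_half_weighted (hw0 x (hR κ hκ hx)) _ _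
    · rw [integral_undef hi]
      refine setIntegral_nonneg hms fun x hx => ?_
      have := h0 x (hR κ hκ hx)
      have := mul_nonneg (hw0 x (hR κ hκ hx)).le (real_inner_self_nonneg (x := v κ x))
      positivity
  have h3 := Finset.sum_le_sum h2
  rw [Finset.sum_add_distrib, ← Finset.mul_sum, ← Finset.mul_sum] at h3
  linarith

/-- The weights of `loadNormSq` are the reciprocals of those of `dampForm`, so each component of the
load costs exactly half of its damping. -/
theorem loadForm_le (hc : c.Admissible K) (hΩe : IsOpen Ωe) (hΩp : IsOpen Ωp)
    {fe fp gp : Pt d → Pt d} (hfe : IntegrableOn (fun x => ‖fe x‖ ^ 2) Ωe)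
    (hfp : IntegrableOn (fun x => ‖fp x‖ ^ 2) Ωp) (hgp : IntegrableOn (fun x => ‖gp x‖ ^ 2) Ωp)
    {V : Triple M} (he : IsBrokenPoly deg V.e) (hp : IsBrokenPoly deg V.p)
    (hf : IsBrokenPoly deg V.f) :
    loadForm fe fp gp V ≤ 1 / 2 * dampForm c V V + 1 / 2 * loadNormSq c fe fp gp := by
  have hK := inv_pos.2 hc.K_pos
  have h1 := sum_integral_load_le (fun κ hκ => M.mem_cellsE.1 hκ) hΩe.measurableSet
    (w := fun x => 2 * c.rhoE x * c.zeta x)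
    (fun x hx => mul_pos (mul_pos two_pos (hc.rhoE_pos hx)) (hK.trans_le (hc.zeta_memE hx).1))
    (((BddMeas.const 2).mul hc.bdd_rhoE).mul hc.bdd_zetaE) hc.bdd_inv_rhoE_zeta hfe he
  have h2 := sum_integral_load_le (fun κ hκ => M.mem_cellsP.1 hκ) hΩp.measurableSet
    (w := fun x => 2 * c.rhoP x * c.zeta x)
    (fun x hx => mul_pos (mul_pos two_pos (hc.rhoP_pos hx)) (hK.trans_le (hc.zeta_memP hx).1))
    (((BddMeas.const 2).mul hc.bdd_rhoP).mul hc.bdd_zetaP) hc.bdd_inv_rhoP_zeta hfp hp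
  have h3 := sum_integral_load_le (fun κ hκ => M.mem_cellsP.1 hκ) hΩp.measurableSet
    (w := fun x => c.eta x / c.k x)
    (fun x hx => div_pos (hK.trans_le (hc.eta_mem x hx).1) (hK.trans_le (hc.k_mem x hx).1))
    hc.bdd_eta_div_k (by simpa only [inv_div] using hc.bdd_k_div_eta) hgp hf
  simp only [inv_div] at h3
  rw [loadForm, dampForm, loadNormSq]
  linarith

theorem loadNormSq_nonneg (hc : c.Admissible K) (hΩe : IsOpen Ωe) (hΩp : IsOpen Ωp)
    (fe fp gp : Pt d → Pt d) : 0 ≤ loadNormSq c fe fp gp := by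
  have hK := inv_pos.2 hc.K_pos
  refine add_nonneg (add_nonneg ?_ ?_) ?_
  · refine setIntegral_nonneg hΩe.measurableSet fun x hx => ?_
    have := hc.rhoE_pos hx
    have := hK.trans_le (hc.zeta_memE hx).1
    positivity
  · refine setIntegral_nonneg hΩp.measurableSet fun x hx => ?_
    have := hc.rhoP_pos hx
    have := hK.trans_le (hc.zeta_memP hx).1
    positivity
  · refine setIntegral_nonneg hΩp.measurableSet fun x hx => ?_
    have := hK.trans_le (hc.eta_mem x hx).1
    have := hK.trans_le (hc.k_mem x hx).1
    positivity

theorem IsLoad.integrable {T : ℝ} {Ω : Set (Pt d)} {f : ℝ → Pt d → Pt d} (hf : IsLoad T Ω f) :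
    Integrable (fun z : ℝ × Pt d => ‖f z.1 z.2‖ ^ 2)
      ((volume.restrict (Ioc 0 T)).prod (volume.restrict Ω)) :=
  MemLp.integrable_norm_pow hf two_ne_zero

theorem IsLoad.ae_integrableOn {T : ℝ} {Ω : Set (Pt d)} {f : ℝ → Pt d → Pt d}
    (hf : IsLoad T Ω f) :
    ∀ᵐ t ∂(volume.restrict (Ioc 0 T)), IntegrableOn (fun x => ‖f t x‖ ^ 2) Ω :=
  hf.integrable.prod_right_ae

theorem IsLoad.integrableOn_weighted {T : ℝ} {Ω : Set (Pt d)} (hΩ : MeasurableSet Ω)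
    {f : ℝ → Pt d → Pt d} (hf : IsLoad T Ω f) {w : Pt d → ℝ} (hw : BddMeas Ω w) :
    IntegrableOn (fun t => ∫ x in Ω, w x * ‖f t x‖ ^ 2) (Ioc 0 T) := by
  obtain ⟨B, hB⟩ := hw.bdd
  have h : Integrable (fun z : ℝ × Pt d => w z.2 * ‖f z.1 z.2‖ ^ 2)
      ((volume.restrict (Ioc 0 T)).prod (volume.restrict Ω)) := by
    refine Integrable.bdd_mul (c := B) hf.integrable
      (hw.meas.comp measurable_snd).aestronglyMeasurable ?_
    rw [Measure.prod_restrict]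
    filter_upwards [ae_restrict_mem (measurableSet_Ioc.prod hΩ)] with z hz using hB z.2 hz.2
  exact h.integral_prod_left

theorem intervalIntegrable_loadNormSq (hc : c.Admissible K) (hΩe : IsOpen Ωe) (hΩp : IsOpen Ωp)
    {T : ℝ} (hT : 0 ≤ T) {fe fp gp : ℝ → Pt d → Pt d} (hfe : IsLoad T Ωe fe) (hfp : IsLoad T Ωp fp)
    (hgp : IsLoad T Ωp gp) :
    IntervalIntegrable (fun s => loadNormSq c (fe s) (fp s) (gp s)) volume 0 T := by
  rw [intervalIntegrable_iff_integrableOn_Ioc_of_le hT]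
  exact ((hfe.integrableOn_weighted hΩe.measurableSet hc.bdd_inv_rhoE_zeta).add
    (hfp.integrableOn_weighted hΩp.measurableSet hc.bdd_inv_rhoP_zeta)).add
    (hgp.integrableOn_weighted hΩp.measurableSet hc.bdd_k_div_eta)

theorem dampForm_self_nonneg (hc : c.Admissible K) (V : Triple M) : 0 ≤ dampForm c V V := by
  have hK := inv_pos.2 hc.K_pos
  refine add_nonneg (add_nonneg ?_ ?_) ?_ <;>
    refine Finset.sum_nonneg fun κ hκ => setIntegral_nonneg (M.cell_open κ).measurableSet
      fun x hx => mul_nonneg ?_ real_inner_self_nonneg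
  · have hx' := M.mem_cellsE.1 hκ hx
    exact (mul_pos (mul_pos two_pos (hc.rhoE_pos hx')) (hK.trans_le (hc.zeta_memE hx').1)).le
  · have hx' := M.mem_cellsP.1 hκ hx
    exact (mul_pos (mul_pos two_pos (hc.rhoP_pos hx')) (hK.trans_le (hc.zeta_memP hx').1)).le
  · have hx' := M.mem_cellsP.1 hκ hx
    exact (div_pos (hK.trans_le (hc.eta_mem x hx').1) (hK.trans_le (hc.k_mem x hx').1)).le

theorem normZeroSq_nonneg (hc : c.Admissible K) (V : Triple M) : 0 ≤ normZeroSq c V := by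
  have hK := inv_pos.2 hc.K_pos
  refine add_nonneg (add_nonneg ?_ ?_) ?_ <;>
    refine Finset.sum_nonneg fun κ hκ => setIntegral_nonneg (M.cell_open κ).measurableSet
      fun x hx => mul_nonneg ?_ (sq_nonneg _)
  · exact (hc.rhoE_pos (M.mem_cellsE.1 hκ hx)).le
  · have hx' := M.mem_cellsP.1 hκ hx
    exact div_nonneg (mul_nonneg (hK.le.trans (hc.one_sub_phi_ge hx')) (hc.rhoS_pos hx').le)
      two_pos.le
  · have hx' := M.mem_cellsP.1 hκ hx
    exact (mul_pos (hc.rhoF_pos hx') (hc.phi_pos hx')).le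

theorem zeroOrder_nonneg (hc : c.Admissible K) (V : Triple M) : 0 ≤ zeroOrder c V := by
  refine add_nonneg ?_ ?_ <;>
    refine Finset.sum_nonneg fun κ hκ => setIntegral_nonneg (M.cell_open κ).measurableSet
      fun x hx => mul_nonneg (mul_nonneg ?_ (sq_nonneg _)) real_inner_self_nonneg
  · exact (hc.rhoE_pos (M.mem_cellsE.1 hκ hx)).le
  · exact (hc.rhoP_pos (M.mem_cellsP.1 hκ hx)).le

/-- From `ζ ≤ K` follows `ρ ζ² ≤ (K / 2) (2 ρ ζ)` pointwise. -/
theorem sum_integral_zeta_sq_le {R : Finset M.Cell} {Ω : Set (Pt d)}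
    (hR : ∀ κ ∈ R, M.cell κ ⊆ Ω) {ρ ζ : Pt d → ℝ} (hρ : BddMeas Ω ρ) (hζ : BddMeas Ω ζ)
    (hρ0 : ∀ x ∈ Ω, 0 ≤ ρ x) (hζ0 : ∀ x ∈ Ω, ζ x ∈ Icc 0 K) {v : Broken M}
    (hv : IsBrokenPoly deg v) :
    ∑ κ ∈ R, ∫ x in M.cell κ, ρ x * ζ x ^ 2 * inner ℝ (v κ x) (v κ x) ≤
      K / 2 * ∑ κ ∈ R, ∫ x in M.cell κ, 2 * ρ x * ζ x * inner ℝ (v κ x) (v κ x) := by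
  rw [Finset.mul_sum]
  refine Finset.sum_le_sum fun κ hκ => ?_
  rw [← integral_const_mul]
  refine setIntegral_mono_on (hv.integrableOn_weighted hv (hR κ hκ)
      (w := fun x => ρ x * ζ x ^ 2) (by simpa only [sq] using hρ.mul (hζ.mul hζ)))
    ((hv.integrableOn_weighted hv (hR κ hκ) (w := fun x => 2 * ρ x * ζ x)
      (((BddMeas.const 2).mul hρ).mul hζ)).const_mul _) (M.cell_open κ).measurableSet
    fun x hx => ?_
  have hx' := hR κ hκ hx
  have h1 : ρ x * ζ x ^ 2 ≤ K / 2 * (2 * ρ x * ζ x) := by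
    have := mul_le_mul_of_nonneg_right (hζ0 x hx').2 (mul_nonneg (hρ0 x hx') (hζ0 x hx').1)
    linarith
  have := mul_le_mul_of_nonneg_right h1 (real_inner_self_nonneg (x := v κ x))
  linarith

/-- The solid dampings dominate the zero-order terms, and the filtration damping is nonnegative.
Used at time 0, where the norm provides the damping of the initial displacement. -/
theorem zeroOrder_le (hc : c.Admissible K) {V : Triple M} (he : IsBrokenPoly deg V.e)
    (hp : IsBrokenPoly deg V.p) : zeroOrder c V ≤ K / 2 * dampForm c V V := by
  have hK := inv_pos.2 hc.K_pos
  have h1 := sum_integral_zeta_sq_le (fun κ hκ => M.mem_cellsE.1 hκ) hc.bdd_rhoE hc.bdd_zetaE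
    (fun x hx => (hc.rhoE_pos hx).le)
    (fun x hx => ⟨hK.le.trans (hc.zeta_memE hx).1, (hc.zeta_memE hx).2⟩) he
  have h2 := sum_integral_zeta_sq_le (fun κ hκ => M.mem_cellsP.1 hκ) hc.bdd_rhoP hc.bdd_zetaP
    (fun x hx => (hc.rhoP_pos hx).le)
    (fun x hx => ⟨hK.le.trans (hc.zeta_memP hx).1, (hc.zeta_memP hx).2⟩) hp
  have h3 : 0 ≤ ∑ κ ∈ M.cellsP, ∫ x in M.cell κ,
      c.eta x / c.k x * inner ℝ (V.f κ x) (V.f κ x) := by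
    refine Finset.sum_nonneg fun κ hκ => setIntegral_nonneg (M.cell_open κ).measurableSet
      fun x hx => mul_nonneg ?_ real_inner_self_nonneg
    have hx' := M.mem_cellsP.1 hκ hx
    exact (div_pos (hK.trans_le (hc.eta_mem x hx').1) (hK.trans_le (hc.k_mem x hx').1)).le
  have h4 := mul_nonneg (half_pos hc.K_pos).le h3
  rw [zeroOrder, dampForm, mul_add, mul_add]
  linarith

/-- The remainder in `mass_density_eq` is nonnegative because `φ < 1` and `a > 1`. -/
theorem normZero_density_le (hc : c.Admissible K) {x : Pt d} (hx : x ∈ Ωp) (p f : Pt d) :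
    c.rhoU x * ‖p‖ ^ 2 + c.rhoF x * c.phi x * ‖p + (c.phi x)⁻¹ • f‖ ^ 2 ≤
      inner ℝ (c.rhoP x • p + c.rhoF x • f) p + inner ℝ (c.rhoF x • p + c.rhoW x • f) f := by
  have h := mass_density_eq (hc.phi_pos hx).ne' (ρf := c.rhoF x) (c.rhoS x) (c.a x) p f
  rw [Material.rhoU, Material.rhoP, Material.rhoW, h]
  have h1 := hc.rhoS_pos hx
  have h2 := hc.rhoF_pos hx
  have h3 := hc.phi_pos hx
  have h4 := (inv_pos.2 hc.K_pos).trans_le (hc.one_sub_phi_ge hx)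
  have h5 := sub_pos.2 (hc.a_mem x hx).1
  have : 0 ≤ (1 - c.phi x) * c.rhoS x / 2 * ‖p‖ ^ 2 +
    (c.a x - 1) * c.rhoF x / c.phi x * ‖f‖ ^ 2 := by positivity
  linarith

theorem mass_density_le (hc : c.Admissible K) {x : Pt d} (hx : x ∈ Ωp) (p f : Pt d) :
    inner ℝ (c.rhoP x • p + c.rhoF x • f) p + inner ℝ (c.rhoF x • p + c.rhoW x • f) f ≤
      (2 + 4 * K ^ 4) *
        (c.rhoU x * ‖p‖ ^ 2 + c.rhoF x * c.phi x * ‖p + (c.phi x)⁻¹ • f‖ ^ 2) := by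
  have h := mass_density_eq (hc.phi_pos hx).ne' (ρf := c.rhoF x) (c.rhoS x) (c.a x) p f
  have hF := norm_sq_le_of_add_inv_smul (hc.phi_pos hx).ne' p f
  rw [Material.rhoU, Material.rhoP, Material.rhoW, h]
  have hK := hc.K_pos
  have hK1 := hc.one_le
  have h2 := hc.rhoF_pos hx
  have h3 := hc.phi_pos hx
  have h5 := sub_pos.2 (hc.a_mem x hx).1
  have h6 : c.a x - 1 ≤ K := by linarith [(hc.a_mem x hx).2]
  have hφ1 : c.phi x ≤ 1 := by linarith [(hc.phi_mem x hx).2, inv_pos.2 hK]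
  set ρu := (1 - c.phi x) * c.rhoS x / 2 with hρu
  set P := ‖p‖ ^ 2
  set Q := ‖p + (c.phi x)⁻¹ • f‖ ^ 2
  have hP : 0 ≤ P := sq_nonneg _
  have hQ : 0 ≤ Q := sq_nonneg _
  have hu : K⁻¹ * K⁻¹ ≤ 2 * ρu := by
    have := mul_le_mul (hc.one_sub_phi_ge hx) (hc.rhoS_mem x hx).1 (inv_pos.2 hK).le
      ((inv_pos.2 hK).le.trans (hc.one_sub_phi_ge hx))
    linarith
  have hu0 : 0 < ρu := by nlinarith [inv_pos.2 hK]
  -- Since `ρu` is at least `1 / (2 K²)`, bounded multiples of `P` can be absorbed into `ρu P`; this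
  -- brings in the fourth power of `K`.
  have hu1 : 1 ≤ 2 * K ^ 2 * ρu := by
    have := mul_le_mul_of_nonneg_left hu (sq_nonneg K)
    have h' : K ^ 2 * (K⁻¹ * K⁻¹) = 1 := by field_simp
    linarith
  have hfφ : c.rhoF x * c.phi x ≤ K :=
    (mul_le_of_le_one_right h2.le hφ1).trans (hc.rhoF_mem x hx).2
  have hfφ0 : 0 ≤ c.rhoF x * c.phi x := by positivity
  have e1 : (c.a x - 1) * c.rhoF x / c.phi x * ‖f‖ ^ 2 ≤
      2 * K * (c.rhoF x * c.phi x) * (Q + P) := by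
    have e2 : 0 ≤ (c.a x - 1) * c.rhoF x / c.phi x := by positivity
    calc (c.a x - 1) * c.rhoF x / c.phi x * ‖f‖ ^ 2
        ≤ (c.a x - 1) * c.rhoF x / c.phi x * (2 * c.phi x ^ 2 * (Q + P)) :=
          mul_le_mul_of_nonneg_left hF e2
      _ = 2 * (c.a x - 1) * (c.rhoF x * c.phi x) * (Q + P) := by
          field_simp
      _ ≤ 2 * K * (c.rhoF x * c.phi x) * (Q + P) := by gcongr
  have e3 : 2 * K * (c.rhoF x * c.phi x) * P ≤ 4 * K ^ 4 * (ρu * P) := by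
    calc 2 * K * (c.rhoF x * c.phi x) * P ≤ 2 * K * K * P * 1 := by
          rw [mul_one]
          gcongr
      _ ≤ 2 * K * K * P * (2 * K ^ 2 * ρu) := by gcongr
      _ = 4 * K ^ 4 * (ρu * P) := by ring
  -- The term `ρu P` has collected the factor `2 + 4 K⁴` and the completed square the factor `1 + 2
  -- K`, which is smaller because `K ≥ 1`.
  have e4 : 2 * K ≤ 1 + 4 * K ^ 4 := by
    have : K ^ 1 ≤ K ^ 4 := pow_le_pow_right₀ hK1 (by norm_num)
    linarith
  have e5 := mul_le_mul_of_nonneg_right e4 (mul_nonneg hfφ0 hQ)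
  linarith

/-- The elastic parts coincide and the poroelastic densities compare pointwise; the rest checks the
integrability that allows the pointwise bounds to be integrated. -/
theorem mass_sandwich (hc : c.Admissible K) {V : Triple M} (hp : IsBrokenPoly deg V.p)
    (hf : IsBrokenPoly deg V.f) :
    normZeroSq c V ≤ massForm c V V ∧ massForm c V V ≤ (2 + 4 * K ^ 4) * normZeroSq c V := by
  have hE : ∑ κ ∈ M.cellsE, ∫ x in M.cell κ, c.rhoE x * inner ℝ (V.e κ x) (V.e κ x) =
      ∑ κ ∈ M.cellsE, ∫ x in M.cell κ, c.rhoE x * ‖V.e κ x‖ ^ 2 := by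
    simp only [real_inner_self_eq_norm_sq]
  have hE0 : 0 ≤ ∑ κ ∈ M.cellsE, ∫ x in M.cell κ, c.rhoE x * ‖V.e κ x‖ ^ 2 :=
    Finset.sum_nonneg fun κ hκ => setIntegral_nonneg (M.cell_open κ).measurableSet
      fun x hx => mul_nonneg (hc.rhoE_pos (M.mem_cellsE.1 hκ hx)).le (sq_nonneg _)
  have hsub := fun κ (hκ : κ ∈ M.cellsP) => M.mem_cellsP.1 hκ
  have i1 : ∀ κ ∈ M.cellsP, IntegrableOn
      (fun x => inner ℝ (c.rhoP x • V.p κ x + c.rhoF x • V.f κ x) (V.p κ x)) (M.cell κ) := by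
    intro κ hκ
    simp only [inner_add_left, inner_smul_left, RCLike.conj_to_real]
    exact (hp.integrableOn_weighted hp (hsub κ hκ) hc.bdd_rhoP).add
      (hf.integrableOn_weighted hp (hsub κ hκ) hc.bdd_rhoF)
  have i2 : ∀ κ ∈ M.cellsP, IntegrableOn
      (fun x => inner ℝ (c.rhoF x • V.p κ x + c.rhoW x • V.f κ x) (V.f κ x)) (M.cell κ) := by
    intro κ hκ
    simp only [inner_add_left, inner_smul_left, RCLike.conj_to_real]
    exact (hp.integrableOn_weighted hf (hsub κ hκ) hc.bdd_rhoF).add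
      (hf.integrableOn_weighted hf (hsub κ hκ) hc.bdd_rhoW)
  have i3 : ∀ κ ∈ M.cellsP, IntegrableOn (fun x => c.rhoU x * ‖V.p κ x‖ ^ 2) (M.cell κ) := by
    intro κ hκ
    simp only [← real_inner_self_eq_norm_sq]
    exact hp.integrableOn_weighted hp (hsub κ hκ) hc.bdd_rhoU
  have i4 : ∀ κ ∈ M.cellsP, IntegrableOn
      (fun x => c.rhoF x * c.phi x * ‖V.p κ x + (c.phi x)⁻¹ • V.f κ x‖ ^ 2) (M.cell κ) := by
    intro κ hκ
    have hw := hc.bdd_rhoF.mul hc.bdd_phi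
    have h := ((hp.integrableOn_weighted hp (hsub κ hκ) hw).add
      ((hp.integrableOn_weighted hf (hsub κ hκ) (hw.mul hc.bdd_phi_inv)).const_mul 2)).add
      (hf.integrableOn_weighted hf (hsub κ hκ) ((hw.mul hc.bdd_phi_inv).mul hc.bdd_phi_inv))
    refine h.congr (Filter.Eventually.of_forall fun x => ?_)
    simp only [Pi.add_apply]
    rw [← real_inner_self_eq_norm_sq, inner_add_left, inner_add_right, inner_add_right]
    simp only [inner_smul_left, inner_smul_right, RCLike.conj_to_real,
      real_inner_comm (V.p κ x) (V.f κ x)]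
    ring
  have hP := Finset.sum_le_sum fun κ hκ => setIntegral_mono_on ((i3 κ hκ).add (i4 κ hκ))
    ((i1 κ hκ).add (i2 κ hκ)) (M.cell_open κ).measurableSet
    fun x hx => normZero_density_le hc (hsub κ hκ hx) (V.p κ x) (V.f κ x)
  have hP' := Finset.sum_le_sum fun κ hκ => setIntegral_mono_on ((i1 κ hκ).add (i2 κ hκ))
    (((i3 κ hκ).add (i4 κ hκ)).const_mul (2 + 4 * K ^ 4)) (M.cell_open κ).measurableSet
    fun x hx => mass_density_le hc (hsub κ hκ hx) (V.p κ x) (V.f κ x)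
  simp only [Pi.add_apply, integral_const_mul] at hP hP'
  have s12 : ∑ κ ∈ M.cellsP, ∫ x in M.cell κ,
        (inner ℝ (c.rhoP x • V.p κ x + c.rhoF x • V.f κ x) (V.p κ x) +
          inner ℝ (c.rhoF x • V.p κ x + c.rhoW x • V.f κ x) (V.f κ x)) =
      (∑ κ ∈ M.cellsP, ∫ x in M.cell κ,
        inner ℝ (c.rhoP x • V.p κ x + c.rhoF x • V.f κ x) (V.p κ x)) +
      ∑ κ ∈ M.cellsP, ∫ x in M.cell κ,
        inner ℝ (c.rhoF x • V.p κ x + c.rhoW x • V.f κ x) (V.f κ x) := by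
    rw [← Finset.sum_add_distrib]
    exact Finset.sum_congr rfl fun κ hκ => integral_add (i1 κ hκ) (i2 κ hκ)
  have s34 : ∑ κ ∈ M.cellsP, ∫ x in M.cell κ, (c.rhoU x * ‖V.p κ x‖ ^ 2 +
        c.rhoF x * c.phi x * ‖V.p κ x + (c.phi x)⁻¹ • V.f κ x‖ ^ 2) =
      (∑ κ ∈ M.cellsP, ∫ x in M.cell κ, c.rhoU x * ‖V.p κ x‖ ^ 2) +
      ∑ κ ∈ M.cellsP, ∫ x in M.cell κ,
        c.rhoF x * c.phi x * ‖V.p κ x + (c.phi x)⁻¹ • V.f κ x‖ ^ 2 := by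
    rw [← Finset.sum_add_distrib]
    exact Finset.sum_congr rfl fun κ hκ => integral_add (i3 κ hκ) (i4 κ hκ)
  rw [← Finset.mul_sum] at hP'
  rw [s34, s12] at hP hP'
  rw [massForm, normZeroSq, hE]
  have hK4 : 0 ≤ K ^ 4 := by positivity
  constructor
  · linarith
  · nlinarith [mul_nonneg hK4 hE0]

end Bounds

/-! ### The energy estimate -/

section Stability

variable {d : ℕ} {Ωe Ωp : Set (Pt d)} {M : PolytopicMesh d Ωe Ωp} {c : Material M} {K : ℝ}
  {deg : M.Cell → ℕ} {c₁ c₂ T : ℝ} {fe fp gp : ℝ → Pt d → Pt d} {U U' U'' : ℝ → Triple M}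

/-- Testing with `U'` turns the integrand of the energy identity into load minus damping. Doubling
the load costs one copy of the damping, so one of the two copies survives on the left. -/
theorem IsSemidiscreteSolution.energy_le (hd : 1 ≤ d) (hΩe : IsOpen Ωe) (hΩp : IsOpen Ωp)
    (hT : 0 ≤ T) (hc : c.Admissible K) (hfe : IsLoad T Ωe fe) (hfp : IsLoad T Ωp fp)
    (hgp : IsLoad T Ωp gp) (h : IsSemidiscreteSolution c deg c₁ c₂ T fe fp gp U U' U'')
    {t : ℝ} (ht : t ∈ Icc 0 T) :
    massForm c (U' t) (U' t) + (Ah c deg c₁ c₂ (U t) (U t) + Ch c deg c₁ c₂ (U t) (U t)) +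
        ∫ s in (0 : ℝ)..t, dampForm c (U' s) (U' s) ≤
      massForm c (U' 0) (U' 0) + (Ah c deg c₁ c₂ (U 0) (U 0) + Ch c deg c₁ c₂ (U 0) (U 0)) +
        ∫ s in (0 : ℝ)..T, loadNormSq c (fe s) (fp s) (gp s) := by
  obtain ⟨hi, hid⟩ := h.energy_identity hd hT hc ht
  have hsub : uIcc 0 t ⊆ uIcc 0 T := by
    rw [uIcc_of_le ht.1, uIcc_of_le hT]
    exact Icc_subset_Icc_right ht.2
  have hD := (h.intervalIntegrable_dampForm hT hc).mono_set hsub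
  have hLT := intervalIntegrable_loadNormSq hc hΩe hΩp hT hfe hfp hgp
  have hL := hLT.mono_set hsub
  have hmono : ∫ s in (0 : ℝ)..t, loadNormSq c (fe s) (fp s) (gp s) ≤
      ∫ s in (0 : ℝ)..T, loadNormSq c (fe s) (fp s) (gp s) :=
    intervalIntegral.integral_mono_interval le_rfl ht.1 ht.2
      (Filter.Eventually.of_forall fun s => loadNormSq_nonneg hc hΩe hΩp _ _ _) hLT
  have hIoc : Ioc 0 t ⊆ Ioc 0 T := Ioc_subset_Ioc_right ht.2
  have hle : (2 * ∫ s in (0 : ℝ)..t, (massForm c (U'' s) (U' s) +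
      (Ah c deg c₁ c₂ (U s) (U' s) + Ch c deg c₁ c₂ (U s) (U' s)))) ≤
      ∫ s in (0 : ℝ)..t, (loadNormSq c (fe s) (fp s) (gp s) - dampForm c (U' s) (U' s)) := by
    rw [← intervalIntegral.integral_const_mul, intervalIntegral.integral_of_le ht.1,
      intervalIntegral.integral_of_le ht.1]
    refine integral_mono_ae (hi.const_mul 2).1 (hL.sub hD).1 ?_
    refine ae_restrict_of_ae_restrict_of_subset hIoc ?_
    filter_upwards [h.eqn, hfe.ae_integrableOn, hfp.ae_integrableOn, hgp.ae_integrableOn,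
      ae_restrict_mem measurableSet_Ioc] with s hs h1 h2 h3 hsT
    have hm := (h.mem s ⟨hsT.1.le, hsT.2⟩).2.1
    have e1 := hs (U' s) hm
    have e2 := loadForm_le hc hΩe hΩp h1 h2 h3 hm.1.isBrokenPoly hm.2.1.isBrokenPoly
      hm.2.2.isBrokenPoly
    linarith
  rw [intervalIntegral.integral_sub hL hD] at hle
  linarith

end Stability

end PoroDG

end

/-! ### The stability theorem. -/

open PoroDG MeasureTheory Set

theorem theorem3p1 (d : ℕ) (hd : d = 2 ∨ d = 3) (Creg Cbv : ℝ) :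
    ∃ c₁₀ c₂₀ : ℝ, 0 < c₁₀ ∧ 0 < c₂₀ ∧ ∀ c₁ c₂ : ℝ, c₁₀ ≤ c₁ → c₂₀ ≤ c₂ →
      ∀ T : ℝ, 0 < T → ∀ K : ℝ, ∃ C : ℝ, 0 < C ∧
        ∀ (Ωe Ωp : Set (Pt d)), IsOpen Ωe → IsOpen Ωp → Disjoint Ωe Ωp →
        ∀ (M : PolytopicMesh d Ωe Ωp) (deg : M.Cell → ℕ) (c : Material M),
          (∀ κ, 1 ≤ deg κ) → M.PolytopicRegular Creg → M.BoundedVariation deg Cbv →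
          c.Admissible K →
        ∀ fe fp gp : ℝ → Pt d → Pt d, IsLoad T Ωe fe → IsLoad T Ωp fp → IsLoad T Ωp gp →
        ∀ U U' U'' : ℝ → Triple M,
          IsSemidiscreteSolution c deg c₁ c₂ T fe fp gp U U' U'' →
          ∀ t ∈ Icc 0 T,
            energySq c deg c₁ c₂ U U' t ≤
              C * (energySq c deg c₁ c₂ U U' 0 +
                ∫ s in (0 : ℝ)..T, loadNormSq c (fe s) (fp s) (gp s)) := by
  have hd1 : 1 ≤ d := by omega
  have hpos := PolytopicMesh.traceConst_pos d Creg
  -- The thresholds are those of `trace_remainder_le`. In the constant, `2 (2 + 4 K⁴)` is twice the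
  -- mass factor, `K` comes from the zero-order term, and 4 covers the numerical coefficients; `|K|`
  -- is written because `K` has no sign until the coefficients are given.
  refine ⟨4 * PolytopicMesh.traceConst d Creg, 4 * PolytopicMesh.traceConst d Creg,
    by positivity, by positivity, fun c₁ c₂ hc₁ hc₂ T hT K =>
    ⟨2 * (2 + 4 * K ^ 4) + |K| + 4, by positivity, ?_⟩⟩
  intro Ωe Ωp hΩe hΩp hdisj M deg c hdeg hreg _ hc fe fp gp hfe hfp hgp U U' U'' h t ht
  have hK := hc.K_pos
  rw [abs_of_pos hK]
  have h0 : (0 : ℝ) ∈ Icc 0 T := left_mem_Icc.2 hT.le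
  have hmu : ∀ κ, 0 < c.mu κ := fun κ => (inv_pos.2 hK).trans_le (hc.mu_mem κ).1
  have hm : ∀ κ ∈ M.cellsP, 0 < c.m κ := fun κ hκ =>
    (inv_pos.2 hK).trans_le (hc.m_mem κ hκ).1
  have hstiff := fun s (hs : s ∈ Icc 0 T) =>
    abs_le.1 (abs_stiffness_sub_le hdisj hd1 hreg hdeg (fun κ => (hc.lam_mem κ).1) hmu hm hc₁ hc₂
      (h.mem s hs).1.1.isBrokenPoly (h.mem s hs).1.2.1.isBrokenPoly
      (h.mem s hs).1.2.2.isBrokenPoly)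
  have hmass := fun s (hs : s ∈ Icc 0 T) =>
    mass_sandwich hc (h.mem s hs).2.1.2.1.isBrokenPoly
      (h.mem s hs).2.1.2.2.isBrokenPoly
  have hE := h.energy_le hd1 hΩe hΩp hT.le hc hfe hfp hgp ht
  have s0 := hstiff 0 h0
  have st := hstiff t ht
  have m0 := hmass 0 h0
  have mt := hmass t ht
  have z0 := zeroOrder_le hc (h.mem 0 h0).1.1.isBrokenPoly (h.mem 0 h0).1.2.1.isBrokenPoly
  have zt := zeroOrder_nonneg hc (U t)
  have n0 := normZeroSq_nonneg hc (U' 0)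
  have nt := normZeroSq_nonneg hc (U' t)
  have D0 := dampForm_self_nonneg hc (U 0)
  have Dt : 0 ≤ ∫ s in (0 : ℝ)..t, dampForm c (U' s) (U' s) :=
    intervalIntegral.integral_nonneg ht.1 fun s _ => dampForm_self_nonneg hc (U' s)
  have L0 : 0 ≤ ∫ s in (0 : ℝ)..T, loadNormSq c (fe s) (fp s) (gp s) :=
    intervalIntegral.integral_nonneg hT.le fun s _ => loadNormSq_nonneg hc hΩe hΩp _ _ _
  have hK4 : 0 < K ^ 4 := by positivity
  rw [energySq, energySq, intervalIntegral.integral_same]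
  set L := ∫ s in (0 : ℝ)..T, loadNormSq c (fe s) (fp s) (gp s)
  set I := ∫ s in (0 : ℝ)..t, dampForm c (U' s) (U' s)
  set N₀ := normZeroSq c (U' 0)
  set Nt := normZeroSq c (U' t)
  set A₀ := seminormDGSq c deg c₁ c₂ (U 0)
  set B₀ := seminormISq c deg c₁ c₂ (U 0)
  set At := seminormDGSq c deg c₁ c₂ (U t)
  set Bt := seminormISq c deg c₁ c₂ (U t)
  set D := dampForm c (U 0) (U 0)
  -- Half of this sum bounds an absolute value in `abs_stiffness_sub_le`, hence it is nonnegative.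
  have hAB : 0 ≤ A₀ + B₀ := by linarith [s0.1, s0.2]
  -- The stiffness at time t controls only half of `At + Bt`, so the energy estimate is doubled: 3
  -- is twice the upper factor 3/2 at time 0, and `K D` is twice the bound of the initial zero-order
  -- term.
  have key : Nt + At + Bt + I + D ≤
      2 * ((2 + 4 * K ^ 4) * N₀) + 3 * (A₀ + B₀) + K * D + D + 2 * L := by
    linarith [s0.2, st.1, m0.2, mt.1]
  have r1 : 0 ≤ K * N₀ := by positivity
  have r2 : 0 ≤ K ^ 4 * (A₀ + B₀) := by positivity
  have r3 : 0 ≤ K * (A₀ + B₀) := by positivity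
  have r4 : 0 ≤ K ^ 4 * D := by positivity
  have r5 : 0 ≤ K ^ 4 * L := by positivity
  have r6 : 0 ≤ K * L := by positivity
  linarith
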